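/- Let $d\ge 1$. For $E\subset\mathbb R^d$ let $\operatorname{cap}(E)=\inf\int_{\mathbb R^d}(|\nabla u|^2+u^2)\,dx$ over all $u\in H^1(\mathbb R^d)$ with $u=1$ a.e. on a neighbourhood of $E$. A set $\Omega\subset\mathbb R^d$ is quasi-open if for every $\varepsilon>0$ there is an open set $\Omega_\varepsilon$ with $\operatorname{cap}(\Omega_\varepsilon)\le\varepsilon$ and $\Omega\cup\Omega_\varepsilon$ open. A function $v$ is quasi-continuous if for every $\varepsilon>0$ there is an open set $G$ with $\operatorname{cap}(G)\le\varepsilon$ such that $v$ restricted to $\mathbb R^d\setminus G$ is continuous. $H^1_0(\Omega)$ is the set of $u\in H^1(\mathbb R^d)$ whose quasi-continuous representative $\tilde u$ satisfies $\operatorname{cap}(\{\tilde u\neq0\}\setminus\Omega)=0$. Let $p\in[1,+\infty]$ with $p\ge \frac{2d}{d+2}$, and $p>1$ if $d=2$; let $p'$ be the conjugate exponent ($\frac1p+\frac1{p'}=1$), and let $\delta>0$. Let $D\subset\mathbb R^d$ be Lebesgue measurable, $\Omega\subset D$ quasi-open of finite Lebesgue measure, and $f\in L^p(\Omega)$. For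 $h\in L^p(\Omega)$ put $$E(\Omega,h)=\min\Big\{\int_\Omega\big(\tfrac12|\nabla u|^2-hu\big)\,dx: u\in H^1_0(\Omega)\Big\},\qquad \mathcal E_{\delta,p}(\Omega)=\sup\big\{E(\Omega,f+g): g\in L^p(D),\ \|g\|_{L^p(D)}\le\delta\big\}.$$ The integrals are well defined, $H^1_0(\Omega)\subset L^{p'}(D)$, the minimum defining $E(\Omega,h)$ is attained, and $$\mathcal E_{\delta,p}(\Omega)=\min\Big\{\int_D\big(\tfrac12|\nabla u|^2-fu\big)\,dx+\delta\|u\|_{L^{p'}(D)}: u\in H^1_0(\Omega)\Big\},$$ where the minimum is attained at a function $u$ that is unique up to a.e. equality. If $p>1$, the supremum defining $\mathcal E_{\delta,p}(\Omega)$ is attained. More precisely, with $u$ this minimizer: * if $1<p<\infty$ and $u\not\equiv0$, it is attained at $g=-\delta\,u|u|^{(2-p)/(p-1)}\|u\|_{L^{p'}(D)}^{-p'/p}$ (with $g=0$ where $u=0$); * if $p=\infty$, it is attained at some $g$ with $g=-\delta\,u|u|^{-1}$ a.e. on $D\cap\{u\ne0\}$. -/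

import Mathlib

open MeasureTheory Set Filter Topology
open scoped ENNReal NNReal ContDiff

noncomputable section

namespace WorstCase

/-- `G` is the weak (distributional) gradient of `u` on `ℝᵈ`:
`∫ u ∂_v φ = - ∫ φ ⟨G, v⟩` for all test functions `φ` and all directions `v`. -/
def IsWeakGradient {d : ℕ} (u : EuclideanSpace ℝ (Fin d) → ℝ)
    (G : EuclideanSpace ℝ (Fin d) → EuclideanSpace ℝ (Fin d)) : Prop :=
  ∀ φ : EuclideanSpace ℝ (Fin d) → ℝ, ContDiff ℝ ∞ φ → HasCompactSupport φ →
    ∀ v : EuclideanSpace ℝ (Fin d),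
      ∫ x, u x * fderiv ℝ φ x v = - ∫ x, φ x * inner ℝ (G x) v

/-- `u ∈ H¹(ℝᵈ)`: `u ∈ L²` and `u` has a weak gradient in `L²`. -/
def MemH1 {d : ℕ} (u : EuclideanSpace ℝ (Fin d) → ℝ) : Prop :=
  MemLp u 2 volume ∧
    ∃ G : EuclideanSpace ℝ (Fin d) → EuclideanSpace ℝ (Fin d),
      MemLp G 2 volume ∧ IsWeakGradient u G

open Classical in
/-- The weak gradient of `u ∈ H¹(ℝᵈ)` (determined up to a null set); `0` if `u ∉ H¹(ℝᵈ)`. -/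
def weakGrad {d : ℕ} (u : EuclideanSpace ℝ (Fin d) → ℝ) :
    EuclideanSpace ℝ (Fin d) → EuclideanSpace ℝ (Fin d) :=
  if h : ∃ G : EuclideanSpace ℝ (Fin d) → EuclideanSpace ℝ (Fin d),
      MemLp G 2 volume ∧ IsWeakGradient u G
  then h.choose else 0

/-- The Sobolev capacity: the infimum of `‖u‖²_{H¹} = ∫ (|∇u|² + u²)` over all `u ∈ H¹(ℝᵈ)`
with `u = 1` almost everywhere on a neighbourhood of `E` (`∞` if there is no such `u`). -/
def cap {d : ℕ} (E : Set (EuclideanSpace ℝ (Fin d))) : ℝ≥0∞ :=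
  ⨅ u ∈ {u : EuclideanSpace ℝ (Fin d) → ℝ | MemH1 u ∧
      ∃ U : Set (EuclideanSpace ℝ (Fin d)), IsOpen U ∧ E ⊆ U ∧
        ∀ᵐ x ∂(volume.restrict U), u x = 1},
    ∫⁻ x, (‖weakGrad u x‖ₑ ^ 2 + ‖u x‖ₑ ^ 2)

/-- Quasi-open sets. -/
def QuasiOpen {d : ℕ} (Ω : Set (EuclideanSpace ℝ (Fin d))) : Prop :=
  ∀ ε : ℝ≥0∞, 0 < ε →
    ∃ G : Set (EuclideanSpace ℝ (Fin d)), IsOpen G ∧ cap G ≤ ε ∧ IsOpen (Ω ∪ G)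

/-- Quasi-continuous functions: continuous off open sets of arbitrarily small capacity. -/
def QuasiContinuous {d : ℕ} (v : EuclideanSpace ℝ (Fin d) → ℝ) : Prop :=
  ∀ ε : ℝ≥0∞, 0 < ε →
    ∃ G : Set (EuclideanSpace ℝ (Fin d)), IsOpen G ∧ cap G ≤ ε ∧ ContinuousOn v Gᶜ

/-- `H¹₀(Ω)`: the functions `u ∈ H¹(ℝᵈ)` whose quasi-continuous representative `v` (which is
unique up to sets of zero capacity) satisfies `cap ({v ≠ 0} \ Ω) = 0`. -/
def H10 {d : ℕ} (Ω : Set (EuclideanSpace ℝ (Fin d))) :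
    Set (EuclideanSpace ℝ (Fin d) → ℝ) :=
  {u | MemH1 u ∧ ∃ v : EuclideanSpace ℝ (Fin d) → ℝ,
    QuasiContinuous v ∧ v =ᵐ[volume] u ∧ cap ({x | v x ≠ 0} \ Ω) = 0}

/-- `J(A, u, h) = ∫_A (½ |∇u|² - h u) dx`. -/
def J {d : ℕ} (A : Set (EuclideanSpace ℝ (Fin d))) (u h : EuclideanSpace ℝ (Fin d) → ℝ) : ℝ :=
  ∫ x in A, ((1 / 2 : ℝ) * ‖weakGrad u x‖ ^ 2 - h x * u x)

/-- The Dirichlet energy `E(Ω, h)`, the least value of `J(Ω, u, h)` over `u ∈ H¹₀(Ω)`, as an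
infimum in the extended reals. -/
def dirichletEnergy {d : ℕ} (Ω : Set (EuclideanSpace ℝ (Fin d)))
    (h : EuclideanSpace ℝ (Fin d) → ℝ) : EReal :=
  ⨅ u ∈ H10 Ω, ((J Ω u h : ℝ) : EReal)

/-- The admissible perturbations: `g ∈ Lᵖ(D)` with `‖g‖_{Lᵖ(D)} ≤ δ`. -/
def perturbations {d : ℕ} (D : Set (EuclideanSpace ℝ (Fin d))) (δ : ℝ) (p : ℝ≥0∞) :
    Set (EuclideanSpace ℝ (Fin d) → ℝ) :=
  {g | MemLp g p (volume.restrict D) ∧ eLpNorm g p (volume.restrict D) ≤ ENNReal.ofReal δ}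

/-- The worst-case functional `sup {E(Ω, f + g) : ‖g‖_{Lᵖ(D)} ≤ δ}`. -/
def worstCaseEnergy {d : ℕ} (D Ω : Set (EuclideanSpace ℝ (Fin d)))
    (f : EuclideanSpace ℝ (Fin d) → ℝ) (δ : ℝ) (p : ℝ≥0∞) : EReal :=
  ⨆ g ∈ perturbations D δ p, dirichletEnergy Ω (f + g)

/-- `∫_D (½ |∇u|² - f u) dx + δ ‖u‖_{L^{p'}(D)}`. -/
def penalizedCost {d : ℕ} (D : Set (EuclideanSpace ℝ (Fin d)))
    (f : EuclideanSpace ℝ (Fin d) → ℝ) (δ : ℝ) (p' : ℝ≥0∞)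
    (u : EuclideanSpace ℝ (Fin d) → ℝ) : ℝ :=
  J D u f + δ * (eLpNorm u p' (volume.restrict D)).toReal

/-- The supremum defining the worst-case functional is attained at `g`. -/
def AttainsWorstCase {d : ℕ} (D Ω : Set (EuclideanSpace ℝ (Fin d)))
    (f : EuclideanSpace ℝ (Fin d) → ℝ) (δ : ℝ) (p : ℝ≥0∞)
    (g : EuclideanSpace ℝ (Fin d) → ℝ) : Prop :=
  g ∈ perturbations D δ p ∧ dirichletEnergy Ω (f + g) = worstCaseEnergy D Ω f δ p

end WorstCase

end

/-!
The value is found by a minimax argument in the Hilbert space of gradients. On `H¹₀(Ω)` write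
`A u = ∇u ∈ L²`, `ℓ u = ∫_Ω f u`, `b_g u = ∫_Ω g u`, so that the Dirichlet energy of `f + g` is the
minimum of `½ ‖A u‖² - (ℓ + b_g) u`, and the penalized cost is `½ ‖A u‖² - ℓ u + δ ‖u‖_{p'}`, where
`δ ‖u‖_{p'}` is the supremum of `- b_g u` over the admissible `g` (`exists_almost_norming`).

If the range of `A` is closed and controls the functionals, each of them has a Riesz representative
in the range. The representatives of the `b_g` form a convex set; let `c` be the point of its
closure that is nearest to `-A t`, where `A t` represents `ℓ`. Then `A u = A t + c` for some `u`,
and the variational inequality for the projection says exactly that `v ↦ ⟪A u, A v⟫ - ℓ v` is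
dominated by `δ ‖v‖_{p'}` and equal to `-δ ‖u‖_{p'}` at `v = u` (`exists_minimax`). Hence `u` minimizes the
penalized cost, with value `-½ ‖A u‖²`, the cost grows quadratically in `A v - A u`, which gives
uniqueness, and approximating `c` by perturbations shows that the worst-case energy is no smaller
(`IsSaddle.worstCaseEnergy_eq`).

For `p > 1` the functional `v ↦ ⟪A u, A v⟫ - ℓ v` is itself a `b_g`: it extends from `H¹₀(Ω)` to
`L^{p'}(Ω)` by the theorem of Hahn and Banach, and as `p' < ∞` it is given by some `g ∈ Lᵖ(Ω)` of
norm at most `δ` (`exists_memLp_of_le_norm`). This `g` attains the supremum, and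
`∫ g u = -δ ‖u‖_{p'}` is an equality case of Hölder's inequality, which forces the explicit form of
`g` (`ae_eq_dualityMap_of_integral_eq`, `ae_eq_of_integral_eq_neg_mul_eLpNorm_one`).

Two facts about `H¹₀(Ω)` make this work. First, its functions vanish almost everywhere off `Ω`, and
so do their gradients, by Stampacchia's theorem (`HasGradL2.ae_eq_zero`). Therefore a Sobolev
inequality in `L^r`, `r ≤ 2`, applied on a set of finite measure, bounds `u` by `∇u` in `L^{p'}` and
in `L²` (`exists_poincare_const`). Second, `H¹₀(Ω)` is a linear space that is closed in `H¹(ℝᵈ)`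
(`mem_H10_of_tendsto`), so that the range of `A` is closed. This rests on the countable
subadditivity of the capacity and the weak-type estimate for `cap {|w| > t}`
(`exists_capLE_iUnion`, `exists_capLE_lt_abs`), which are needed, and proved, only up to constants.
-/

noncomputable section

namespace WorstCase

/-! ### Weak gradients -/

section WeakGradient

variable {d : ℕ}

local notation "𝔼" => EuclideanSpace ℝ (Fin d)

theorem tendsto_integral_mul_of_tendsto_eLpNorm {α : Type*} {m : MeasurableSpace α} {μ : Measure α}
    {p q : ℝ≥0∞} [p.HolderConjugate q] {ι : Type*} {l : Filter ι} {u : ι → α → ℝ} {u₀ w : α → ℝ}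
    (hun : ∀ n, MemLp (u n) p μ) (hu : MemLp u₀ p μ) (hw : MemLp w q μ)
    (h : Tendsto (fun n => eLpNorm (u n - u₀) p μ) l (𝓝 0)) :
    Tendsto (fun n => ∫ x, u n x * w x ∂μ) l (𝓝 (∫ x, u₀ x * w x ∂μ)) := by
  refine tendsto_integral_of_L1' _ (hu.integrable_mul hw).1
    (Eventually.of_forall fun n => (hun n).integrable_mul hw) ?_
  have h0 : Tendsto (fun n => eLpNorm (u n - u₀) p μ * eLpNorm w q μ) l (𝓝 0) := by
    have := ENNReal.Tendsto.mul_const (b := eLpNorm w q μ) h (Or.inr hw.eLpNorm_ne_top)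
    simpa using this
  refine tendsto_of_tendsto_of_tendsto_of_le_of_le tendsto_const_nhds h0 (fun _ => zero_le) ?_
  intro n
  have : ((fun x => u n x * w x) - fun x => u₀ x * w x) = (u n - u₀) • w := by
    ext x; simp [sub_mul]
  change eLpNorm ((fun x => u n x * w x) - fun x => u₀ x * w x) 1 μ ≤ _
  rw [this]
  exact eLpNorm_smul_le_mul_eLpNorm hw.1 ((hun n).1.sub hu.1)

/-- A function of `H¹(ℝᵈ)` together with (a version of) its weak gradient. -/
structure HasGradL2 (u : 𝔼 → ℝ) (G : 𝔼 → 𝔼) : Prop where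
  memLp : MemLp u 2 volume
  memLp_grad : MemLp G 2 volume
  isWeakGradient : IsWeakGradient u G

theorem memLp_fderiv_apply {φ : 𝔼 → ℝ} (hφ : ContDiff ℝ ∞ φ) (hc : HasCompactSupport φ) (v : 𝔼)
    (p : ℝ≥0∞) : MemLp (fun x => fderiv ℝ φ x v) p volume := by
  refine Continuous.memLp_of_hasCompactSupport ?_ (hc.fderiv_apply ℝ v)
  exact (hφ.continuous_fderiv (by simp)).clm_apply continuous_const

theorem memLp_inner_const {p : ℝ≥0∞} {μ : Measure 𝔼} {G : 𝔼 → 𝔼} (hG : MemLp G p μ) (v : 𝔼) :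
    MemLp (fun x => inner ℝ (G x) v) p μ := by
  have := (innerSL ℝ v).comp_memLp' hG
  refine this.ae_eq (Eventually.of_forall fun x => ?_)
  simp [real_inner_comm]

theorem IsWeakGradient.congr_ae {u u' : 𝔼 → ℝ} {G G' : 𝔼 → 𝔼} (h : IsWeakGradient u G)
    (hu : u =ᵐ[volume] u') (hG : G =ᵐ[volume] G') : IsWeakGradient u' G' := by
  intro φ hφ hc v
  have e1 : ∫ x, u' x * fderiv ℝ φ x v = ∫ x, u x * fderiv ℝ φ x v :=
    integral_congr_ae (by filter_upwards [hu] with x hx; rw [hx])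
  have e2 : ∫ x, φ x * inner ℝ (G' x) v = ∫ x, φ x * inner ℝ (G x) v :=
    integral_congr_ae (by filter_upwards [hG] with x hx; rw [hx])
  rw [e1, e2, h φ hφ hc v]

/-- Weak gradients are unique up to null sets. -/
theorem IsWeakGradient.ae_unique {u : 𝔼 → ℝ} {G G' : 𝔼 → 𝔼} (h : IsWeakGradient u G)
    (h' : IsWeakGradient u G') (hG : MemLp G 2 volume) (hG' : MemLp G' 2 volume) :
    G =ᵐ[volume] G' := by
  have key : ∀ v : 𝔼, ∀ᵐ x, inner ℝ (G x - G' x) v = 0 := by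
    intro v
    have hi : MemLp (fun x => inner ℝ (G x - G' x) v) 2 volume := memLp_inner_const (hG.sub hG') v
    refine ae_eq_zero_of_integral_contDiff_smul_eq_zero
      (hi.locallyIntegrable (by norm_num)) ?_
    intro φ hφ hc
    have hφ2 : MemLp φ 2 volume := hφ.continuous.memLp_of_hasCompactSupport hc
    have i1 := hφ2.integrable_mul (memLp_inner_const hG v)
    have i2 := hφ2.integrable_mul (memLp_inner_const hG' v)
    have := (h φ hφ hc v).symm.trans (h' φ hφ hc v)
    have e : ∫ x, φ x * inner ℝ (G x) v = ∫ x, φ x * inner ℝ (G' x) v := neg_injective this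
    calc ∫ x, φ x • inner ℝ (G x - G' x) v
        = ∫ x, (φ x * inner ℝ (G x) v - φ x * inner ℝ (G' x) v) := by
          congr 1; ext x; simp [inner_sub_left, mul_sub]
      _ = 0 := by
          exact (integral_sub i1 i2).trans (sub_eq_zero.2 e)
  have := ae_all_iff.2 fun i : Fin d => key (EuclideanSpace.single i 1)
  filter_upwards [this] with x hx
  rw [← sub_eq_zero]
  ext i
  simpa [EuclideanSpace.inner_single_right] using hx i

theorem HasGradL2.memH1 {u : 𝔼 → ℝ} {G : 𝔼 → 𝔼} (h : HasGradL2 u G) : MemH1 u :=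
  ⟨h.memLp, G, h.memLp_grad, h.isWeakGradient⟩

theorem MemH1.hasGradL2 {u : 𝔼 → ℝ} (h : MemH1 u) : HasGradL2 u (weakGrad u) := by
  have h2 := h.2
  rw [weakGrad, dif_pos h2]
  exact ⟨h.1, h2.choose_spec.1, h2.choose_spec.2⟩

theorem HasGradL2.ae_unique {u : 𝔼 → ℝ} {G G' : 𝔼 → 𝔼} (h : HasGradL2 u G)
    (h' : HasGradL2 u G') : G =ᵐ[volume] G' :=
  h.isWeakGradient.ae_unique h'.isWeakGradient h.memLp_grad h'.memLp_grad

theorem HasGradL2.weakGrad_ae_eq {u : 𝔼 → ℝ} {G : 𝔼 → 𝔼} (h : HasGradL2 u G) :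
    weakGrad u =ᵐ[volume] G :=
  h.memH1.hasGradL2.ae_unique h

theorem HasGradL2.congr_ae {u u' : 𝔼 → ℝ} {G G' : 𝔼 → 𝔼} (h : HasGradL2 u G)
    (hu : u =ᵐ[volume] u') (hG : G =ᵐ[volume] G') : HasGradL2 u' G' :=
  ⟨h.memLp.ae_eq hu, h.memLp_grad.ae_eq hG, h.isWeakGradient.congr_ae hu hG⟩

theorem HasGradL2.add {u u' : 𝔼 → ℝ} {G G' : 𝔼 → 𝔼} (h : HasGradL2 u G)
    (h' : HasGradL2 u' G') : HasGradL2 (u + u') (G + G') := by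
  refine ⟨h.memLp.add h'.memLp, h.memLp_grad.add h'.memLp_grad, fun φ hφ hc v => ?_⟩
  have hφ2 : MemLp φ 2 volume := hφ.continuous.memLp_of_hasCompactSupport hc
  have hd := memLp_fderiv_apply hφ hc v 2
  have i1 := h.memLp.integrable_mul hd
  have i2 := h'.memLp.integrable_mul hd
  have j1 := hφ2.integrable_mul (memLp_inner_const h.memLp_grad v)
  have j2 := hφ2.integrable_mul (memLp_inner_const h'.memLp_grad v)
  have e1 := integral_add i1 i2
  have e2 := integral_add j1 j2
  simp only [Pi.mul_apply] at e1 e2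
  simp only [Pi.add_apply, inner_add_left, add_mul, mul_add]
  rw [e1, e2, h.isWeakGradient φ hφ hc v, h'.isWeakGradient φ hφ hc v]
  ring

theorem HasGradL2.const_smul {u : 𝔼 → ℝ} {G : 𝔼 → 𝔼} (h : HasGradL2 u G) (c : ℝ) :
    HasGradL2 (c • u) (c • G) := by
  refine ⟨h.memLp.const_smul c, h.memLp_grad.const_smul c, fun φ hφ hc v => ?_⟩
  have e1 : ∀ x, (c • u) x * fderiv ℝ φ x v = c * (u x * fderiv ℝ φ x v) := fun x => by
    simp [mul_assoc]
  have e2 : ∀ x, φ x * inner ℝ ((c • G) x) v = c * (φ x * inner ℝ (G x) v) := fun x => by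
    simp [real_inner_smul_left]; ring
  simp_rw [e1, e2, integral_const_mul, h.isWeakGradient φ hφ hc v]
  ring

theorem HasGradL2.sub {u u' : 𝔼 → ℝ} {G G' : 𝔼 → 𝔼} (h : HasGradL2 u G)
    (h' : HasGradL2 u' G') : HasGradL2 (u - u') (G - G') := by
  have := h.add (h'.const_smul (-1))
  simpa [sub_eq_add_neg] using this

theorem HasGradL2.zero : HasGradL2 (0 : 𝔼 → ℝ) 0 :=
  ⟨MemLp.zero, MemLp.zero, fun φ _ _ v => by simp⟩

/-- The graph of the weak gradient is closed in `L² × L²`. -/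
theorem HasGradL2.of_tendsto {ι : Type*} {l : Filter ι} [l.NeBot] {u : ι → 𝔼 → ℝ}
    {G : ι → 𝔼 → 𝔼} {u₀ : 𝔼 → ℝ} {G₀ : 𝔼 → 𝔼}
    (h : ∀ n, HasGradL2 (u n) (G n)) (hu₀ : MemLp u₀ 2 volume) (hG₀ : MemLp G₀ 2 volume)
    (hu : Tendsto (fun n => eLpNorm (u n - u₀) 2 volume) l (𝓝 0))
    (hG : Tendsto (fun n => eLpNorm (G n - G₀) 2 volume) l (𝓝 0)) : HasGradL2 u₀ G₀ := by
  refine ⟨hu₀, hG₀, fun φ hφ hc v => ?_⟩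
  have hφ2 : MemLp φ 2 volume := hφ.continuous.memLp_of_hasCompactSupport hc
  have hd := memLp_fderiv_apply hφ hc v 2
  have t1 := tendsto_integral_mul_of_tendsto_eLpNorm (fun n => (h n).memLp) hu₀ hd hu
  have hG' : Tendsto (fun n => eLpNorm ((fun x => inner ℝ (G n x) v) - fun x => inner ℝ (G₀ x) v)
      2 volume) l (𝓝 0) := by
    have h0 : Tendsto (fun n => ENNReal.ofReal ‖v‖ * eLpNorm (G n - G₀) 2 volume) l (𝓝 0) := by
      have := ENNReal.Tendsto.const_mul (a := ENNReal.ofReal ‖v‖) hG (Or.inr (by simp))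
      simpa using this
    refine tendsto_of_tendsto_of_tendsto_of_le_of_le tendsto_const_nhds h0 (fun _ => zero_le) ?_
    intro n
    refine eLpNorm_le_mul_eLpNorm_of_ae_le_mul (Eventually.of_forall fun x => ?_) 2
    simp only [Pi.sub_apply, ← inner_sub_left]
    rw [mul_comm]
    exact norm_inner_le_norm _ _
  have t2 := tendsto_integral_mul_of_tendsto_eLpNorm
    (fun n => memLp_inner_const (h n).memLp_grad v) (memLp_inner_const hG₀ v) hφ2 hG'
  have e : ∀ n, ∫ x, u n x * fderiv ℝ φ x v = - ∫ x, inner ℝ (G n x) v * φ x := fun n => by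
    rw [(h n).isWeakGradient φ hφ hc v]
    simp_rw [mul_comm]
  simp_rw [e] at t1
  have := tendsto_nhds_unique t1 t2.neg
  rw [this]
  simp_rw [mul_comm]

end WeakGradient

/-! ### Mollification and density of test functions -/

section Mollification

variable {d : ℕ} {F : Type*} [NormedAddCommGroup F] [NormedSpace ℝ F] [CompleteSpace F]

local notation "𝔼" => EuclideanSpace ℝ (Fin d)

open scoped Convolution
open ContinuousLinearMap (lsmul)

omit [NormedSpace ℝ F] [CompleteSpace F] in
/-- Translations act continuously on `Lʳ`, `r < ∞`. -/
theorem tendsto_eLpNorm_translate_sub {f : 𝔼 → F} {r : ℝ≥0∞} (hr : 1 ≤ r) (hr' : r ≠ ⊤)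
    (hf : MemLp f r volume) :
    Tendsto (fun y : 𝔼 => eLpNorm (fun x => f (x - y) - f x) r volume) (𝓝 0) (𝓝 0) := by
  have : Fact (1 ≤ r) := ⟨hr⟩
  let g : 𝔼 → C(𝔼, 𝔼) := fun y => ⟨fun x => x - y, by fun_prop⟩
  have hg : Continuous g := by
    refine ContinuousMap.continuous_of_continuous_uncurry _ ?_
    change Continuous (fun z : 𝔼 × 𝔼 => z.2 - z.1)
    fun_prop
  have hgm : ∀ y, MeasurePreserving (g y) (volume : Measure 𝔼) volume := fun y =>
    measurePreserving_sub_right volume y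
  have hc : Continuous fun y => Lp.compMeasurePreserving (g y) (hgm y) (hf.toLp f) :=
    Continuous.compMeasurePreservingLp (f := fun _ : 𝔼 => hf.toLp f) continuous_const hg hgm hr'
  have h0 : Tendsto (fun y => edist (Lp.compMeasurePreserving (g y) (hgm y) (hf.toLp f))
      (hf.toLp f)) (𝓝 0) (𝓝 0) := by
    have := (hc.edist (continuous_const (y := hf.toLp f))).tendsto 0
    convert! this using 2
    symm
    rw [edist_eq_zero]
    have : Lp.compMeasurePreserving (g 0) (hgm 0) (hf.toLp f) =
      (hf.comp_measurePreserving (hgm 0)).toLp _ := rfl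
    rw [this]
    congr 1
    ext x
    simp [g]
  refine h0.congr fun y => ?_
  have : Lp.compMeasurePreserving (g y) (hgm y) (hf.toLp f) =
      (hf.comp_measurePreserving (hgm y)).toLp _ := rfl
  rw [this, Lp.edist_toLp_toLp]
  rfl

/-- Mollification moves `f` in `Lʳ` at most as far as the worst translation by a vector in the
support of the kernel, by Jensen's inequality and Tonelli's theorem. -/
theorem eLpNorm_normed_convolution_sub_le {f : 𝔼 → F} {r : ℝ≥0∞} (hr : 1 ≤ r) (hr' : r ≠ ⊤)
    (hf : StronglyMeasurable f) (hfl : LocallyIntegrable f volume) (φ : ContDiffBump (0 : 𝔼))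
    {C : ℝ≥0∞}
    (hC : ∀ y ∈ Metric.ball (0 : 𝔼) φ.rOut, eLpNorm (fun x => f (x - y) - f x) r volume ≤ C) :
    eLpNorm (φ.normed volume ⋆[lsmul ℝ ℝ, volume] f - f) r volume ≤ C := by
  have hr0 : r ≠ 0 := (one_pos.trans_le hr).ne'
  have hrpos : 0 < r.toReal := ENNReal.toReal_pos hr0 hr'
  set ρ : 𝔼 → ℝ := φ.normed volume with hρ
  have hρc : Continuous ρ := φ.continuous_normed
  have hρ0 : ∀ x, 0 ≤ ρ x := φ.nonneg_normed
  have hρm : Measurable fun y => ENNReal.ofReal (ρ y) := hρc.measurable.ennreal_ofReal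
  set ν : Measure 𝔼 := volume.withDensity fun y => ENNReal.ofReal (ρ y) with hν
  have hρi : Integrable ρ volume := hρc.integrable_of_hasCompactSupport φ.hasCompactSupport_normed
  have hρ1 : ∫ x, ρ x = 1 := φ.integral_normed
  have : IsProbabilityMeasure ν := ⟨by
    rw [hν, withDensity_apply _ MeasurableSet.univ, Measure.restrict_univ,
      ← ofReal_integral_eq_lintegral_ofReal hρi (Eventually.of_forall hρ0), hρ1,
      ENNReal.ofReal_one]⟩
  have hball : ∀ᵐ y ∂ν, y ∈ Metric.ball (0 : 𝔼) φ.rOut := by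
    rw [hν, ae_withDensity_iff hρm]
    filter_upwards with y hy
    by_contra hyb
    have : y ∉ Function.support ρ := by rwa [hρ, φ.support_normed_eq]
    simp at this
    simp [this] at hy
  have hpt : ∀ x, ‖(ρ ⋆[lsmul ℝ ℝ, volume] f - f) x‖ₑ ^ r.toReal ≤
      ∫⁻ y, ‖f (x - y) - f x‖ₑ ^ r.toReal ∂ν := by
    intro x
    have hex : ConvolutionExistsAt ρ f x (lsmul ℝ ℝ) volume :=
      φ.hasCompactSupport_normed.convolutionExists_left _ hρc hfl x
    have i1 : Integrable (fun y => ρ y • f (x - y)) volume := hex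
    have i2 : Integrable (fun y => ρ y • f x) volume := hρi.smul_const _
    have e : (ρ ⋆[lsmul ℝ ℝ, volume] f - f) x = ∫ y, (f (x - y) - f x) ∂ν := by
      rw [hν, integral_withDensity_eq_integral_toReal_smul hρm (by simp)]
      simp_rw [ENNReal.toReal_ofReal (hρ0 _), smul_sub]
      rw [integral_sub i1 i2, integral_smul_const, hρ1, one_smul]
      rfl
    rw [e]
    have hm : AEStronglyMeasurable (fun y => f (x - y) - f x) ν :=
      ((hf.comp_measurable (measurable_const.sub measurable_id)).sub
        stronglyMeasurable_const).aestronglyMeasurable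
    have h1 : ‖∫ y, (f (x - y) - f x) ∂ν‖ₑ ≤ eLpNorm (fun y => f (x - y) - f x) r ν := by
      refine (enorm_integral_le_lintegral_enorm _).trans ?_
      rw [← eLpNorm_one_eq_lintegral_enorm]
      exact eLpNorm_le_eLpNorm_of_exponent_le hr hm
    rw [eLpNorm_eq_lintegral_rpow_enorm_toReal hr0 hr'] at h1
    calc _ ≤ _ := ENNReal.rpow_le_rpow h1 hrpos.le
      _ = _ := by rw [← ENNReal.rpow_mul, one_div, inv_mul_cancel₀ hrpos.ne', ENNReal.rpow_one]
  have hmeas : AEMeasurable (Function.uncurry fun x y : 𝔼 => ‖f (x - y) - f x‖ₑ ^ r.toReal)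
      (volume.prod ν) := by
    have h1 : StronglyMeasurable fun z : 𝔼 × 𝔼 => f (z.1 - z.2) :=
      hf.comp_measurable (measurable_fst.sub measurable_snd)
    have h2 : StronglyMeasurable fun z : 𝔼 × 𝔼 => f z.1 := hf.comp_measurable measurable_fst
    exact ((h1.sub h2).enorm.pow_const _).aemeasurable
  rw [eLpNorm_eq_lintegral_rpow_enorm_toReal hr0 hr']
  have main : ∫⁻ x, ‖(ρ ⋆[lsmul ℝ ℝ, volume] f - f) x‖ₑ ^ r.toReal ≤ C ^ r.toReal := by
    calc _ ≤ ∫⁻ x, ∫⁻ y, ‖f (x - y) - f x‖ₑ ^ r.toReal ∂ν := lintegral_mono hpt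
      _ = ∫⁻ y, (∫⁻ x, ‖f (x - y) - f x‖ₑ ^ r.toReal) ∂ν := lintegral_lintegral_swap hmeas
      _ ≤ ∫⁻ y, C ^ r.toReal ∂ν := by
          refine lintegral_mono_ae ?_
          filter_upwards [hball] with y hy
          have := ENNReal.rpow_le_rpow (hC y hy) hrpos.le
          rw [eLpNorm_eq_lintegral_rpow_enorm_toReal hr0 hr', ← ENNReal.rpow_mul, one_div,
            inv_mul_cancel₀ hrpos.ne', ENNReal.rpow_one] at this
          exact this
      _ = C ^ r.toReal := by simp
  calc _ ≤ (C ^ r.toReal) ^ (1 / r.toReal) := ENNReal.rpow_le_rpow main (by positivity)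
    _ = C := by rw [← ENNReal.rpow_mul, mul_one_div_cancel hrpos.ne', ENNReal.rpow_one]

/-- Mollifications converge in `Lʳ`, `1 ≤ r < ∞`. -/
theorem tendsto_eLpNorm_normed_convolution_sub {f : 𝔼 → F} {r : ℝ≥0∞} (hr : 1 ≤ r) (hr' : r ≠ ⊤)
    (hf : MemLp f r volume) {φ : ℕ → ContDiffBump (0 : 𝔼)}
    (hφ : Tendsto (fun n => (φ n).rOut) atTop (𝓝 0)) :
    Tendsto (fun n => eLpNorm ((φ n).normed volume ⋆[lsmul ℝ ℝ, volume] f - f) r volume)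
      atTop (𝓝 0) := by
  obtain ⟨g, hg, hfg⟩ := hf.1
  have hgL : MemLp g r volume := hf.ae_eq hfg
  have e : ∀ n, eLpNorm ((φ n).normed volume ⋆[lsmul ℝ ℝ, volume] f - f) r volume =
      eLpNorm ((φ n).normed volume ⋆[lsmul ℝ ℝ, volume] g - g) r volume := fun n => by
    rw [convolution_congr _ (Filter.EventuallyEq.refl _ _) hfg]
    exact eLpNorm_congr_ae ((Filter.EventuallyEq.refl _ _).sub hfg)
  simp_rw [e]
  rw [ENNReal.tendsto_nhds_zero]
  intro ε hε
  have ht := ENNReal.tendsto_nhds_zero.1 (tendsto_eLpNorm_translate_sub hr hr' hgL) ε hε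
  obtain ⟨η, hη, hball⟩ := Metric.eventually_nhds_iff_ball.1 ht
  filter_upwards [hφ.eventually (gt_mem_nhds hη)] with n hn
  exact eLpNorm_normed_convolution_sub_le hr hr' hg (hgL.locallyIntegrable hr) (φ n)
    fun y hy => hball y (Metric.ball_subset_ball hn.le hy)

/-- The gradient of a mollification is the mollification of the weak gradient. -/
theorem fderiv_normed_convolution {u : 𝔼 → ℝ} {G : 𝔼 → 𝔼} (h : HasGradL2 u G)
    (φ : ContDiffBump (0 : 𝔼)) (x v : 𝔼) :
    fderiv ℝ (φ.normed volume ⋆[lsmul ℝ ℝ, volume] u) x v =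
      inner ℝ ((φ.normed volume ⋆[lsmul ℝ ℝ, volume] G) x) v := by
  set ρ : 𝔼 → ℝ := φ.normed volume with hρ
  have hul : LocallyIntegrable u volume := h.memLp.locallyIntegrable (by norm_num)
  have hGl : LocallyIntegrable G volume := h.memLp_grad.locallyIntegrable (by norm_num)
  have hρs : ContDiff ℝ ∞ ρ := φ.contDiff_normed
  have hρc : HasCompactSupport ρ := φ.hasCompactSupport_normed
  have hd := hρc.hasFDerivAt_convolution_left (lsmul ℝ ℝ) (hρs.of_le (by simp)) hul x
  rw [hd.fderiv]
  have hex : ConvolutionExistsAt (fderiv ℝ ρ) u x ((lsmul ℝ ℝ).precompL 𝔼) volume :=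
    (hρc.fderiv ℝ).convolutionExists_left _ (hρs.continuous_fderiv (by simp)) hul x
  have hexG : ConvolutionExistsAt ρ G x (lsmul ℝ ℝ) volume :=
    hρc.convolutionExists_left _ hρs.continuous hGl x
  -- the test function is the reflected and translated kernel
  set ψ : 𝔼 → ℝ := fun t => ρ (x - t) with hψ
  have hψs : ContDiff ℝ ∞ ψ := hρs.comp (contDiff_const.sub contDiff_id)
  have hψc : HasCompactSupport ψ := hρc.comp_homeomorph (Homeomorph.subLeft x)
  have hψd : ∀ t, fderiv ℝ ψ t v = - fderiv ℝ ρ (x - t) v := by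
    intro t
    have h1 : HasFDerivAt ψ ((fderiv ℝ ρ (x - t)).comp (-ContinuousLinearMap.id ℝ 𝔼)) t :=
      ((hρs.differentiable (by simp)) (x - t)).hasFDerivAt.comp t
        ((hasFDerivAt_id t).const_sub x)
    rw [h1.fderiv]
    simp
  have h1 := h.isWeakGradient ψ hψs hψc v
  simp_rw [hψd, mul_neg, integral_neg] at h1
  have h2 := neg_injective h1
  rw [convolution_eq_swap, ContinuousLinearMap.integral_apply
    (by simpa using hex.integrable_swap), convolution_eq_swap, real_inner_comm]
  have e := (innerSL ℝ v).integral_comp_comm hexG.integrable_swap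
  simp only [innerSL_apply_apply] at e
  rw [← e]
  have l : ∀ t, (((lsmul ℝ ℝ).precompL 𝔼) (fderiv ℝ ρ (x - t)) (u t)) v =
      u t * fderiv ℝ ρ (x - t) v := fun t => by
    simp [ContinuousLinearMap.precompL_apply, mul_comm]
  have k : ∀ t, inner ℝ v ((lsmul ℝ ℝ) (ρ (x - t)) (G t)) = ψ t * inner ℝ (G t) v := fun t => by
    simp [hψ, real_inner_smul_right, real_inner_comm]
  simp_rw [l, k]
  exact h2

/-- Dominated convergence to zero in `Lʳ`. -/
theorem tendsto_eLpNorm_zero_of_dominated {α E : Type*} {m : MeasurableSpace α} {μ : Measure α}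
    [NormedAddCommGroup E] {r : ℝ≥0∞} (hr0 : r ≠ 0) (hr' : r ≠ ⊤) {g : α → ℝ} (hg : MemLp g r μ)
    {f : ℕ → α → E} (hf : ∀ n, AEStronglyMeasurable (f n) μ)
    (hfg : ∀ n, ∀ᵐ x ∂μ, ‖f n x‖ ≤ g x) (h : ∀ᵐ x ∂μ, Tendsto (fun n => f n x) atTop (𝓝 0)) :
    Tendsto (fun n => eLpNorm (f n) r μ) atTop (𝓝 0) := by
  have hrpos : 0 < r.toReal := ENNReal.toReal_pos hr0 hr'
  have key : Tendsto (fun n => ∫⁻ x, ‖f n x‖ₑ ^ r.toReal ∂μ) atTop (𝓝 (∫⁻ _, 0 ∂μ)) := by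
    refine tendsto_lintegral_of_dominated_convergence' (fun x => ‖g x‖ₑ ^ r.toReal)
      (fun n => (hf n).enorm.pow_const _) (fun n => ?_) ?_ ?_
    · filter_upwards [hfg n] with x hx
      gcongr
      exact enorm_le_iff_norm_le.2 (hx.trans (le_abs_self _))
    · have := hg.eLpNorm_lt_top
      rw [eLpNorm_eq_lintegral_rpow_enorm_toReal hr0 hr'] at this
      exact ((ENNReal.rpow_lt_top_iff_of_pos (by positivity)).1 this).ne
    · filter_upwards [h] with x hx
      have h1 := (ENNReal.continuous_rpow_const (y := r.toReal)).tendsto 0 |>.comp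
        ((tendsto_zero_iff_enorm_tendsto_zero).1 hx)
      simpa [ENNReal.zero_rpow_of_pos hrpos, Function.comp_def] using h1
  have := (ENNReal.continuous_rpow_const (y := 1 / r.toReal)).tendsto 0 |>.comp
    (by simpa using key)
  rw [ENNReal.zero_rpow_of_pos (by positivity)] at this
  exact this.congr fun n => by rw [eLpNorm_eq_lintegral_rpow_enorm_toReal hr0 hr']; rfl

variable (d) in
/-- Smooth cutoff functions with vanishing gradients, exhausting `ℝᵈ`. -/
theorem exists_cutoff : ∃ (χ : ℕ → 𝔼 → ℝ) (K : ℝ), 0 ≤ K ∧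
    (∀ n, ContDiff ℝ ∞ (χ n)) ∧ (∀ n, HasCompactSupport (χ n)) ∧ (∀ n x, 0 ≤ χ n x) ∧
    (∀ n x, χ n x ≤ 1) ∧ (∀ n x, ‖gradient (χ n) x‖ ≤ K / (n + 1)) ∧
    ∀ x, Tendsto (fun n => χ n x) atTop (𝓝 1) := by
  let φ : ContDiffBump (0 : 𝔼) := ⟨1, 2, one_pos, one_lt_two⟩
  have hφs : ContDiff ℝ ∞ φ := φ.contDiff
  have hφc : HasCompactSupport φ := φ.hasCompactSupport
  obtain ⟨K, hK⟩ := (hφs.continuous_fderiv (by simp)).bounded_above_of_compact_support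
    (hφc.fderiv ℝ)
  have hpos : ∀ n : ℕ, (0 : ℝ) < n + 1 := fun n => by positivity
  refine ⟨fun n x => φ ((n + 1 : ℝ)⁻¹ • x), K, (norm_nonneg _).trans (hK 0), fun n => ?_,
    fun n => ?_, fun n x => φ.nonneg, fun n x => φ.le_one, fun n x => ?_, fun x => ?_⟩
  · exact hφs.comp (contDiff_id.const_smul _)
  · exact hφc.comp_homeomorph (Homeomorph.smulOfNeZero _ (inv_ne_zero (hpos n).ne'))
  · have h0 : HasFDerivAt (fun x : 𝔼 => (n + 1 : ℝ)⁻¹ • x)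
        ((n + 1 : ℝ)⁻¹ • ContinuousLinearMap.id ℝ 𝔼) x :=
      ((n + 1 : ℝ)⁻¹ • ContinuousLinearMap.id ℝ 𝔼).hasFDerivAt
    have h1 : HasFDerivAt (fun x => φ ((n + 1 : ℝ)⁻¹ • x))
        ((fderiv ℝ φ ((n + 1 : ℝ)⁻¹ • x)).comp ((n + 1 : ℝ)⁻¹ • ContinuousLinearMap.id ℝ 𝔼)) x :=
      ((hφs.differentiable (by simp)) _).hasFDerivAt.comp x h0
    rw [gradient, LinearIsometryEquiv.norm_map, h1.fderiv, ContinuousLinearMap.comp_smul,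
      norm_smul, ContinuousLinearMap.comp_id, norm_inv, Real.norm_of_nonneg (hpos n).le,
      inv_mul_eq_div]
    have := hpos n
    gcongr
    exact hK _
  · refine tendsto_const_nhds.congr' ?_
    filter_upwards [eventually_ge_atTop ⌈‖x‖⌉₊] with n hn
    have hx : ‖x‖ ≤ n + 1 := (Nat.ceil_le.1 hn).trans (by simp)
    refine (φ.one_of_mem_closedBall ?_).symm
    rw [mem_closedBall_zero_iff, norm_smul, norm_inv, Real.norm_of_nonneg (hpos n).le,
      inv_mul_eq_div]
    exact (div_le_one (hpos n)).2 hx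

theorem inner_gradient {f : 𝔼 → ℝ} (x v : 𝔼) : inner ℝ (gradient f x) v = fderiv ℝ f x v := by
  simp [gradient]

/-- Approximation by test functions in the `Lʳ` norms of `u` and its gradient, when these are finite
and `1 ≤ r < ∞`: mollify, then multiply by cutoffs. Exponents `r < 2` are needed for the Sobolev
inequalities below. -/
theorem HasGradL2.exists_test_approx {u : 𝔼 → ℝ} {G : 𝔼 → 𝔼} (h : HasGradL2 u G) {r : ℝ≥0∞}
    (hr : 1 ≤ r) (hr' : r ≠ ⊤) (hu : MemLp u r volume) (hG : MemLp G r volume) :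
    ∃ w : ℕ → 𝔼 → ℝ, (∀ n, ContDiff ℝ ∞ (w n)) ∧ (∀ n, HasCompactSupport (w n)) ∧
      Tendsto (fun n => eLpNorm (w n - u) r volume) atTop (𝓝 0) ∧
      Tendsto (fun n => eLpNorm (gradient (w n) - G) r volume) atTop (𝓝 0) := by
  have hr0 : r ≠ 0 := (one_pos.trans_le hr).ne'
  obtain ⟨χ, K, hK0, hχs, hχc, hχ0, hχ1, hχK, hχt⟩ := exists_cutoff d
  let φ : ℕ → ContDiffBump (0 : 𝔼) := fun n =>
    ⟨1 / (n + 1) / 2, 1 / (n + 1), by positivity, half_lt_self (by positivity)⟩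
  have hφ : Tendsto (fun n => (φ n).rOut) atTop (𝓝 0) := tendsto_one_div_add_atTop_nhds_zero_nat
  have hul : LocallyIntegrable u volume := h.memLp.locallyIntegrable (by norm_num)
  set U : ℕ → 𝔼 → ℝ := fun n => (φ n).normed volume ⋆[lsmul ℝ ℝ, volume] u with hU
  set H : ℕ → 𝔼 → 𝔼 := fun n => (φ n).normed volume ⋆[lsmul ℝ ℝ, volume] G with hH
  have hUs : ∀ n, ContDiff ℝ ∞ (U n) := fun n =>
    (φ n).hasCompactSupport_normed.contDiff_convolution_left _ (φ n).contDiff_normed hul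
  have hUt : Tendsto (fun n => eLpNorm (U n - u) r volume) atTop (𝓝 0) :=
    tendsto_eLpNorm_normed_convolution_sub hr hr' hu hφ
  have hHt : Tendsto (fun n => eLpNorm (H n - G) r volume) atTop (𝓝 0) :=
    tendsto_eLpNorm_normed_convolution_sub hr hr' hG hφ
  have hHc : ∀ n, Continuous (H n) := fun n =>
    (φ n).hasCompactSupport_normed.continuous_convolution_left _ (φ n).continuous_normed
      (h.memLp_grad.locallyIntegrable (by norm_num))
  have hUg : ∀ n, gradient (U n) = H n := fun n => by
    ext1 x
    refine ext_inner_right ℝ fun v => ?_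
    rw [inner_gradient]
    exact fderiv_normed_convolution h (φ n) x v
  have hgrad : ∀ n x, gradient (fun x => χ n x * U n x) x =
      χ n x • H n x + U n x • gradient (χ n) x := fun n x => by
    refine ext_inner_right ℝ fun v => ?_
    have h1 := ((hχs n).differentiable (by simp) x).hasFDerivAt.mul
      ((hUs n).differentiable (by simp) x).hasFDerivAt
    change HasFDerivAt (fun x => χ n x * U n x) _ x at h1
    rw [inner_gradient, h1.fderiv, inner_add_left, real_inner_smul_left, real_inner_smul_left,
      ← hUg n, inner_gradient, inner_gradient]
    simp
  -- multiplication by the cutoffs does not destroy convergence in `Lʳ`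
  have gen : ∀ {E : Type} [NormedAddCommGroup E] [NormedSpace ℝ E] (f : ℕ → 𝔼 → E) (g : 𝔼 → E),
      (∀ n, AEStronglyMeasurable (f n) volume) → MemLp g r volume →
      Tendsto (fun n => eLpNorm (f n - g) r volume) atTop (𝓝 0) →
      Tendsto (fun n => eLpNorm ((fun x => χ n x • f n x) - g) r volume) atTop (𝓝 0) := by
    intro E _ _ f g hf hg ht
    have h2 : Tendsto (fun n => eLpNorm (fun x => (χ n x - 1) • g x) r volume) atTop (𝓝 0) := by
      refine tendsto_eLpNorm_zero_of_dominated hr0 hr' hg.norm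
        (fun n => ((hχs n).continuous.sub continuous_const).aestronglyMeasurable.smul hg.1)
        (fun n => Eventually.of_forall fun x => ?_) (Eventually.of_forall fun x => ?_)
      · rw [norm_smul]
        refine mul_le_of_le_one_left (norm_nonneg _) ?_
        rw [Real.norm_eq_abs, abs_le]
        constructor <;> linarith [hχ0 n x, hχ1 n x]
      · have := ((hχt x).sub_const 1).smul_const (g x)
        simpa using this
    have h3 := ht.add h2
    rw [add_zero] at h3
    refine tendsto_of_tendsto_of_tendsto_of_le_of_le tendsto_const_nhds h3 (fun _ => zero_le) ?_
    intro n
    have e : (fun x => χ n x • f n x) - g = (fun x => χ n x • (f n - g) x) +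
        fun x => (χ n x - 1) • g x := by
      ext1 x
      simp only [Pi.sub_apply, Pi.add_apply, smul_sub, sub_smul, one_smul]
      abel
    have m1 : AEStronglyMeasurable (fun x => χ n x • (f n - g) x) volume :=
      (hχs n).continuous.aestronglyMeasurable.smul ((hf n).sub hg.1)
    have m2 : AEStronglyMeasurable (fun x => (χ n x - 1) • g x) volume :=
      ((hχs n).continuous.sub continuous_const).aestronglyMeasurable.smul hg.1
    simp only
    rw [e]
    refine (eLpNorm_add_le m1 m2 hr).trans (add_le_add_left (eLpNorm_mono fun x => ?_) _)
    rw [norm_smul]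
    refine mul_le_of_le_one_left (norm_nonneg _) ?_
    rw [Real.norm_of_nonneg (hχ0 n x)]
    exact hχ1 n x
  refine ⟨fun n x => χ n x * U n x, fun n => (hχs n).mul (hUs n), fun n => (hχc n).mul_right,
    gen U u (fun n => (hUs n).continuous.aestronglyMeasurable) hu hUt, ?_⟩
  have t1 := gen H G (fun n => (hHc n).aestronglyMeasurable) hG hHt
  have hgc : ∀ n, Continuous (gradient (χ n)) := fun n =>
    (InnerProductSpace.toDual ℝ 𝔼).symm.continuous.comp ((hχs n).continuous_fderiv (by simp))
  have t2 : Tendsto (fun n => eLpNorm (fun x => U n x • gradient (χ n) x) r volume)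
      atTop (𝓝 0) := by
    have hb : Tendsto (fun n : ℕ => ENNReal.ofReal (K / (n + 1)) *
        (eLpNorm (U n - u) r volume + eLpNorm u r volume)) atTop (𝓝 0) := by
      have k1 : Tendsto (fun n : ℕ => ENNReal.ofReal (K / (n + 1))) atTop (𝓝 0) := by
        have : Tendsto (fun n : ℕ => K / ((n : ℝ) + 1)) atTop (𝓝 0) := by
          simpa [div_eq_mul_inv] using
            (tendsto_one_div_add_atTop_nhds_zero_nat (𝕜 := ℝ)).const_mul K
        simpa using ENNReal.tendsto_ofReal this
      have k2 := hUt.add_const (eLpNorm u r volume)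
      rw [zero_add] at k2
      have := ENNReal.Tendsto.mul k1 (Or.inr hu.eLpNorm_ne_top) k2 (Or.inr (by simp))
      simpa using this
    refine tendsto_of_tendsto_of_tendsto_of_le_of_le tendsto_const_nhds hb (fun _ => zero_le) ?_
    intro n
    have k3 : eLpNorm (fun x => U n x • gradient (χ n) x) r volume ≤
        ENNReal.ofReal (K / (n + 1)) * eLpNorm (U n) r volume := by
      refine eLpNorm_le_mul_eLpNorm_of_ae_le_mul (Eventually.of_forall fun x => ?_) r
      rw [norm_smul, mul_comm]
      gcongr
      exact hχK n x
    refine k3.trans ?_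
    beta_reduce
    gcongr
    have := eLpNorm_add_le (((hUs n).continuous.aestronglyMeasurable (μ := volume)).sub hu.1)
      hu.1 hr
    simpa using this
  have t3 := t1.add t2
  rw [add_zero] at t3
  refine tendsto_of_tendsto_of_tendsto_of_le_of_le tendsto_const_nhds t3 (fun _ => zero_le) ?_
  intro n
  have e : gradient (fun x => χ n x * U n x) - G =
      ((fun x => χ n x • H n x) - G) + fun x => U n x • gradient (χ n) x := by
    ext1 x
    simp only [Pi.sub_apply, Pi.add_apply, hgrad]
    abel
  simp only
  rw [e]
  exact eLpNorm_add_le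
    (((hχs n).continuous.smul (hHc n)).aestronglyMeasurable.sub hG.1)
    ((hUs n).continuous.smul (hgc n)).aestronglyMeasurable hr

end Mollification

/-! ### The chain rule and the gradient on level sets -/

section ChainRule

variable {d : ℕ}

local notation "𝔼" => EuclideanSpace ℝ (Fin d)

theorem hasGradL2_of_contDiff {f : 𝔼 → ℝ} (hf : ContDiff ℝ 1 f) (hc : HasCompactSupport f) :
    HasGradL2 f (gradient f) := by
  have hgc : Continuous (gradient f) :=
    (InnerProductSpace.toDual ℝ 𝔼).symm.continuous.comp (hf.continuous_fderiv (by simp))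
  have hgs : HasCompactSupport (gradient f) :=
    (hc.fderiv ℝ).comp_left (g := (InnerProductSpace.toDual ℝ 𝔼).symm) (by simp)
  refine ⟨hf.continuous.memLp_of_hasCompactSupport hc, hgc.memLp_of_hasCompactSupport hgs, ?_⟩
  intro φ hφ hφc v
  have c1 : Continuous fun x => fderiv ℝ f x v :=
    (hf.continuous_fderiv (by simp)).clm_apply continuous_const
  have c2 : Continuous fun x => fderiv ℝ φ x v :=
    (hφ.continuous_fderiv (by simp)).clm_apply continuous_const
  rw [integral_mul_fderiv_eq_neg_fderiv_mul_of_integrable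
    ((c1.mul hφ.continuous).integrable_of_hasCompactSupport hφc.mul_left)
    ((hf.continuous.mul c2).integrable_of_hasCompactSupport hc.mul_right)
    ((hf.continuous.mul hφ.continuous).integrable_of_hasCompactSupport hc.mul_right)
    (fun x _ => hf.differentiable (by simp) x) (fun x _ => hφ.differentiable (by simp) x)]
  simp_rw [inner_gradient, mul_comm]

/-- The chain rule for the composition with a `C¹` function with bounded derivative. -/
theorem HasGradL2.comp {u : 𝔼 → ℝ} {G : 𝔼 → 𝔼} (h : HasGradL2 u G) {ψ : ℝ → ℝ}
    (hψ : ContDiff ℝ 1 ψ) (hψ0 : ψ 0 = 0) {K : ℝ} (hK : ∀ t, |deriv ψ t| ≤ K) :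
    HasGradL2 (fun x => ψ (u x)) (fun x => deriv ψ (u x) • G x) := by
  have hK0 : 0 ≤ K := (abs_nonneg _).trans (hK 0)
  obtain ⟨w, hws, hwc, hwu, hwG⟩ := h.exists_test_approx (r := 2) (by norm_num) (by norm_num)
    h.memLp h.memLp_grad
  have hdc : Continuous (deriv ψ) := hψ.continuous_deriv le_rfl
  have hlip : ∀ a b, |ψ a - ψ b| ≤ K * |a - b| := fun a b =>
    (convex_univ (𝕜 := ℝ)).norm_image_sub_le_of_norm_deriv_le
      (fun x _ => hψ.differentiable (by simp) x) (fun x _ => hK x) (mem_univ b) (mem_univ a)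
  obtain ⟨ns, hns, hae⟩ := (tendstoInMeasure_of_tendsto_eLpNorm (by norm_num)
    (fun n => (hws n).continuous.aestronglyMeasurable) h.memLp.1 hwu).exists_seq_tendsto_ae
  have hwu' := hwu.comp hns.tendsto_atTop
  have hwG' := hwG.comp hns.tendsto_atTop
  have hgc : ∀ n, Continuous (gradient (w n)) := fun n =>
    (InnerProductSpace.toDual ℝ 𝔼).symm.continuous.comp ((hws n).continuous_fderiv (by simp))
  have hgrad : ∀ n, gradient (fun x => ψ (w n x)) =
      fun x => deriv ψ (w n x) • gradient (w n) x := by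
    intro n
    ext1 x
    refine ext_inner_right ℝ fun v => ?_
    have h1 := ((hψ.differentiable (by simp) (w n x)).hasDerivAt).comp_hasFDerivAt x
      ((hws n).differentiable (by simp) x).hasFDerivAt
    change HasFDerivAt (fun x => ψ (w n x)) _ x at h1
    rw [inner_gradient, h1.fderiv, real_inner_smul_left, inner_gradient]
    simp
  have hn : ∀ n, HasGradL2 (fun x => ψ (w n x)) (fun x => deriv ψ (w n x) • gradient (w n) x) := by
    intro n
    rw [← hgrad n]
    exact hasGradL2_of_contDiff (hψ.comp ((hws n).of_le (by simp)))
      ((hwc n).comp_left (g := ψ) hψ0)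
  have mu : AEStronglyMeasurable (fun x => ψ (u x)) volume :=
    hψ.continuous.comp_aestronglyMeasurable h.memLp.1
  have mG : AEStronglyMeasurable (fun x => deriv ψ (u x)) volume :=
    hdc.comp_aestronglyMeasurable h.memLp.1
  refine HasGradL2.of_tendsto (l := atTop) (fun n => hn (ns n))
    (h.memLp.of_le_mul (c := K) mu (Eventually.of_forall fun x => ?_))
    (h.memLp_grad.of_le_mul (c := K) (mG.smul h.memLp_grad.1) (Eventually.of_forall fun x => ?_))
    ?_ ?_
  · have := hlip (u x) 0
    simpa [hψ0] using this
  · rw [norm_smul]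
    gcongr
    exact hK _
  · have h0 := ENNReal.Tendsto.const_mul (a := ENNReal.ofReal K) hwu' (Or.inr (by simp))
    rw [mul_zero] at h0
    refine tendsto_of_tendsto_of_tendsto_of_le_of_le tendsto_const_nhds h0 (fun _ => zero_le) ?_
    intro n
    exact eLpNorm_le_mul_eLpNorm_of_ae_le_mul (Eventually.of_forall fun x => hlip _ _) 2
  · have h0 := ENNReal.Tendsto.const_mul (a := ENNReal.ofReal K) hwG' (Or.inr (by simp))
    have h1 : Tendsto (fun n => eLpNorm (fun x => (deriv ψ (w (ns n) x) - deriv ψ (u x)) • G x)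
        2 volume) atTop (𝓝 0) := by
      refine tendsto_eLpNorm_zero_of_dominated (by norm_num) (by norm_num)
        (h.memLp_grad.norm.const_mul (2 * K)) (fun n =>
        ((hdc.comp (hws _).continuous).aestronglyMeasurable.sub mG).smul h.memLp_grad.1)
        (fun n => Eventually.of_forall fun x => ?_) ?_
      · rw [norm_smul]
        gcongr
        refine (norm_sub_le _ _).trans ?_
        have := hK (w (ns n) x)
        have := hK (u x)
        simp only [Real.norm_eq_abs]
        linarith
      · filter_upwards [hae] with x hx
        have := (((hdc.tendsto _).comp hx).sub_const (deriv ψ (u x))).smul_const (G x)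
        simpa using this
    have h2 := h0.add h1
    rw [mul_zero, add_zero] at h2
    refine tendsto_of_tendsto_of_tendsto_of_le_of_le tendsto_const_nhds h2 (fun _ => zero_le) ?_
    intro n
    have e : (fun x => deriv ψ (w (ns n) x) • gradient (w (ns n)) x) -
        (fun x => deriv ψ (u x) • G x) =
        (fun x => deriv ψ (w (ns n) x) • (gradient (w (ns n)) - G) x) +
        fun x => (deriv ψ (w (ns n) x) - deriv ψ (u x)) • G x := by
      ext1 x
      simp only [Pi.sub_apply, Pi.add_apply, smul_sub, sub_smul]
      abel
    beta_reduce
    rw [e]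
    refine (eLpNorm_add_le (((hdc.comp (hws _).continuous).aestronglyMeasurable).smul
      ((hgc _).aestronglyMeasurable.sub h.memLp_grad.1))
      (((hdc.comp (hws _).continuous).aestronglyMeasurable.sub mG).smul h.memLp_grad.1)
      (by norm_num)).trans (add_le_add_left ?_ _)
    refine eLpNorm_le_mul_eLpNorm_of_ae_le_mul (Eventually.of_forall fun x => ?_) 2
    change ‖deriv ψ (w (ns n) x) • (gradient (w (ns n)) - G) x‖ ≤ _
    rw [norm_smul]
    gcongr
    exact hK _

/-- Stampacchia: the weak gradient of `u` vanishes almost everywhere on `{u = 0}`. The functions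
`arctan (n u) / n` tend to `0` while their gradients tend to `1_{u = 0} ∇u`. -/
theorem HasGradL2.ae_eq_zero {u : 𝔼 → ℝ} {G : 𝔼 → 𝔼} (h : HasGradL2 u G) :
    ∀ᵐ x, u x = 0 → G x = 0 := by
  have hpos : ∀ n : ℕ, (0 : ℝ) < n + 1 := fun n => by positivity
  let ψ : ℕ → ℝ → ℝ := fun n t => Real.arctan ((n + 1) * t) / (n + 1)
  have hder : ∀ n t, HasDerivAt (ψ n) (1 / (1 + ((n + 1) * t) ^ 2)) t := by
    intro n t
    have h1 : HasDerivAt (fun t : ℝ => ((n : ℝ) + 1) * t) ((n : ℝ) + 1) t := by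
      simpa using (hasDerivAt_id t).const_mul ((n : ℝ) + 1)
    have h2 := (h1.arctan).div_const ((n : ℝ) + 1)
    convert! h2 using 1
    have := hpos n
    field_simp
  have hder' : ∀ n, deriv (ψ n) = fun t : ℝ => 1 / (1 + ((n + 1) * t) ^ 2) := fun n =>
    funext fun t => (hder n t).deriv
  have hψ : ∀ n, ContDiff ℝ 1 (ψ n) := fun n =>
    (Real.contDiff_arctan.comp (contDiff_const.mul contDiff_id)).div_const _
  have hψ0 : ∀ n, ψ n 0 = 0 := fun n => by simp [ψ]
  have hK : ∀ n t, |deriv (ψ n) t| ≤ 1 := fun n t => by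
    rw [hder', abs_of_nonneg (by positivity)]
    exact div_le_one_of_le₀ (by nlinarith [sq_nonneg ((n + 1) * t)]) (by positivity)
  have hlip : ∀ n t, |ψ n t| ≤ |t| := fun n t => by
    have := (convex_univ (𝕜 := ℝ)).norm_image_sub_le_of_norm_deriv_le (f := ψ n)
      (fun x _ => (hψ n).differentiable (by simp) x) (fun x _ => hK n x) (mem_univ 0) (mem_univ t)
    simpa [hψ0] using this
  have hψt : ∀ t, Tendsto (fun n => ψ n t) atTop (𝓝 0) := fun t => by
    refine squeeze_zero_norm (a := fun n : ℕ => (Real.pi / 2) * (1 / ((n : ℝ) + 1)))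
      (fun n => ?_) ?_
    · rw [Real.norm_eq_abs, abs_div, abs_of_pos (hpos n), div_eq_mul_one_div]
      have := hpos n
      gcongr
      exact abs_le.2 ⟨(Real.neg_pi_div_two_lt_arctan _).le, (Real.arctan_lt_pi_div_two _).le⟩
    · simpa using (tendsto_one_div_add_atTop_nhds_zero_nat (𝕜 := ℝ)).const_mul (Real.pi / 2)
  have hdt : ∀ t, Tendsto (fun n => deriv (ψ n) t) atTop (𝓝 (if t = 0 then 1 else 0)) := fun t => by
    simp_rw [hder']
    split_ifs with ht
    · simp [ht]
    · refine Tendsto.div_atTop tendsto_const_nhds (tendsto_atTop_add_const_left _ _ ?_)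
      have h1 : Tendsto (fun n : ℕ => ((n : ℝ) + 1)) atTop atTop :=
        tendsto_atTop_add_const_right _ _ tendsto_natCast_atTop_atTop
      have h2 := (tendsto_pow_atTop (two_ne_zero)).comp h1
      have h3 := h2.atTop_mul_const (show 0 < t ^ 2 by positivity)
      refine h3.congr fun n => ?_
      simp [mul_pow]
  set G₀ : 𝔼 → 𝔼 := fun x => (if u x = 0 then (1 : ℝ) else 0) • G x with hG₀
  have hGn : ∀ n, HasGradL2 (fun x => ψ n (u x)) (fun x => deriv (ψ n) (u x) • G x) := fun n =>
    h.comp (hψ n) (hψ0 n) (hK n)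
  have hlim : ∀ x, Tendsto (fun n => deriv (ψ n) (u x) • G x) atTop (𝓝 (G₀ x)) := fun x =>
    (hdt (u x)).smul_const _
  have mG₀ : AEStronglyMeasurable G₀ volume :=
    aestronglyMeasurable_of_tendsto_ae atTop (fun n => (hGn n).memLp_grad.1)
      (Eventually.of_forall hlim)
  have hG₀le : ∀ x, ‖G₀ x‖ ≤ ‖G x‖ := fun x => by
    simp only [hG₀]
    split_ifs <;> simp
  have key : HasGradL2 (0 : 𝔼 → ℝ) G₀ := by
    refine HasGradL2.of_tendsto (l := atTop) hGn MemLp.zero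
      (h.memLp_grad.of_le mG₀ (Eventually.of_forall hG₀le)) ?_ ?_
    · refine tendsto_eLpNorm_zero_of_dominated (by norm_num) (by norm_num) h.memLp.norm
        (fun n => (hGn n).memLp.1.sub aestronglyMeasurable_zero)
        (fun n => Eventually.of_forall fun x => ?_) (Eventually.of_forall fun x => ?_)
      · simpa using hlip n (u x)
      · simpa using hψt (u x)
    · refine tendsto_eLpNorm_zero_of_dominated (by norm_num) (by norm_num)
        (h.memLp_grad.norm.const_mul 2) (fun n => (hGn n).memLp_grad.1.sub mG₀)
        (fun n => Eventually.of_forall fun x => ?_) (Eventually.of_forall fun x => ?_)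
      · refine (norm_sub_le _ _).trans ?_
        have h1 : ‖deriv (ψ n) (u x) • G x‖ ≤ ‖G x‖ := by
          rw [norm_smul]
          exact mul_le_of_le_one_left (norm_nonneg _) (hK n _)
        linarith [hG₀le x]
      · simpa using (hlim x).sub_const (G₀ x)
  filter_upwards [key.ae_unique HasGradL2.zero] with x hx hux
  simpa [hG₀, hux] using hx

end ChainRule

/-! ### Sobolev inequalities for functions supported in a set of finite measure -/

section Sobolev

variable {d : ℕ}

local notation "𝔼" => EuclideanSpace ℝ (Fin d)

/-- On a set of finite measure the `Lˢ` norm controls the `Lʳ` norm, `r ≤ s`. -/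
theorem eLpNorm_le_of_ae_eq_zero_off {α E : Type*} {m : MeasurableSpace α} {μ : Measure α}
    [NormedAddCommGroup E] {Ω : Set α} {f : α → E} (hf : AEStronglyMeasurable f μ)
    (h : ∀ᵐ x ∂μ, x ∉ Ω → f x = 0) {r s : ℝ≥0∞} (hrs : r ≤ s) :
    eLpNorm f r μ ≤ eLpNorm f s μ * μ Ω ^ (1 / r.toReal - 1 / s.toReal) := by
  have hS := measurableSet_toMeasurable μ Ω
  have e : f =ᵐ[μ] (toMeasurable μ Ω).indicator f := by
    filter_upwards [h] with x hx
    by_cases hxS : x ∈ toMeasurable μ Ω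
    · simp [hxS]
    · simp [hxS, hx fun hxΩ => hxS (subset_toMeasurable μ Ω hxΩ)]
  rw [eLpNorm_congr_ae e, eLpNorm_indicator_eq_eLpNorm_restrict hS]
  refine (eLpNorm_le_eLpNorm_mul_rpow_measure_univ hrs hf.restrict).trans ?_
  rw [Measure.restrict_apply_univ, measure_toMeasurable]
  gcongr
  exact Measure.restrict_le_self

theorem HasGradL2.ae_eq_zero_off {u : 𝔼 → ℝ} {G : 𝔼 → 𝔼} (h : HasGradL2 u G) {Ω : Set 𝔼}
    (hu : ∀ᵐ x, x ∉ Ω → u x = 0) : ∀ᵐ x, x ∉ Ω → G x = 0 := by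
  filter_upwards [hu, h.ae_eq_zero] with x hx hG hxΩ using hG (hx hxΩ)

/-- A Sobolev inequality for test functions extends to all functions with the right
integrability. -/
theorem HasGradL2.eLpNorm_le_of_test {u : 𝔼 → ℝ} {G : 𝔼 → 𝔼} (h : HasGradL2 u G) {q r C : ℝ≥0∞}
    (hr : 1 ≤ r) (hr' : r ≠ ⊤) (hC : C ≠ ⊤) (hu : MemLp u r volume) (hG : MemLp G r volume)
    (hw : ∀ w : 𝔼 → ℝ, ContDiff ℝ ∞ w → HasCompactSupport w →
      eLpNorm w q volume ≤ C * eLpNorm (gradient w) r volume) :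
    eLpNorm u q volume ≤ C * eLpNorm G r volume := by
  obtain ⟨w, hws, hwc, hwu, hwG⟩ := h.exists_test_approx hr hr' hu hG
  obtain ⟨ns, hns, hae⟩ := (tendstoInMeasure_of_tendsto_eLpNorm (one_pos.trans_le hr).ne'
    (fun n => (hws n).continuous.aestronglyMeasurable) hu.1 hwu).exists_seq_tendsto_ae
  refine (Lp.eLpNorm_lim_le_liminf_eLpNorm
    (fun n => (hws (ns n)).continuous.aestronglyMeasurable) u hae).trans ?_
  have ht : Tendsto (fun n => C * (eLpNorm (gradient (w (ns n)) - G) r volume +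
      eLpNorm G r volume)) atTop (𝓝 (C * (0 + eLpNorm G r volume))) :=
    ENNReal.Tendsto.const_mul ((hwG.comp hns.tendsto_atTop).add_const _) (Or.inr hC)
  rw [zero_add] at ht
  rw [← ht.liminf_eq]
  refine liminf_le_liminf (Eventually.of_forall fun n => ?_)
  refine (hw _ (hws _) (hwc _)).trans ?_
  gcongr
  have hgc : Continuous (gradient (w (ns n))) :=
    (InnerProductSpace.toDual ℝ 𝔼).symm.continuous.comp ((hws _).continuous_fderiv (by simp))
  have := eLpNorm_add_le (hgc.aestronglyMeasurable.sub hG.1) hG.1 hr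
  simpa using this

theorem eLpNorm_gradient (w : 𝔼 → ℝ) (r : ℝ≥0∞) :
    eLpNorm (gradient w) r volume = eLpNorm (fderiv ℝ w) r volume :=
  eLpNorm_congr_norm_ae (Eventually.of_forall fun x => by
    simp only [gradient, LinearIsometryEquiv.norm_map])

/-- In dimension one, test functions are bounded by the `L¹` norm of the derivative. -/
theorem eLpNorm_top_le_eLpNorm_gradient_one (w : EuclideanSpace ℝ (Fin 1) → ℝ)
    (hw : ContDiff ℝ ∞ w) (hwc : HasCompactSupport w) :
    eLpNorm w ⊤ volume ≤ eLpNorm (gradient w) 1 volume := by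
  let L : ℝ ≃ₗᵢ[ℝ] EuclideanSpace ℝ (Fin 1) := (OrthonormalBasis.singleton (Fin 1) ℝ).repr
  have hf : ContDiff ℝ 1 (fun t => w (L t)) := (hw.of_le (by simp)).comp L.contDiff
  have hfc : HasCompactSupport fun t => w (L t) := hwc.comp_homeomorph L.toHomeomorph
  have hder : ∀ t, deriv (fun t => w (L t)) t = fderiv ℝ w (L t) (L 1) := by
    intro t
    have hL : HasDerivAt L (L 1) t := by
      simpa using (L.toContinuousLinearEquiv.hasFDerivAt (x := t)).hasDerivAt
    exact ((hw.differentiable (by simp) (L t)).hasFDerivAt.comp_hasDerivAt t hL).deriv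
  rw [eLpNorm_exponent_top]
  refine eLpNormEssSup_le_of_ae_enorm_bound (Eventually.of_forall fun x => ?_)
  obtain ⟨t, rfl⟩ := L.surjective x
  refine (hfc.enorm_le_lintegral_Ici_deriv hf t).trans ?_
  refine (setLIntegral_le_lintegral _ _).trans ?_
  rw [eLpNorm_one_eq_lintegral_enorm,
    ← (L.measurePreserving).lintegral_comp_emb L.toHomeomorph.measurableEmbedding]
  refine lintegral_mono fun s => ?_
  rw [hder, ← inner_gradient]
  refine enorm_le_iff_norm_le.2 ((norm_inner_le_norm _ _).trans ?_)
  simp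

/-- The Sobolev inequality `‖u‖_q ≤ C ‖∇u‖₂` for the functions of `H¹(ℝᵈ)` that vanish outside a
set of finite measure: `q = ∞` if `d = 1`, and `q ≥ 2` with `1/q ≥ 1/2 - 1/d` otherwise. -/
theorem exists_sobolev_const (hd : 1 ≤ d) {Ω : Set 𝔼} (hΩ : volume Ω < ⊤) {q : ℝ≥0∞}
    (hq : d = 1 ∧ q = ⊤ ∨ 2 ≤ d ∧ q ≠ ⊤ ∧ 2 ≤ q ∧ (2 : ℝ)⁻¹ ≤ q.toReal⁻¹ + (d : ℝ)⁻¹) :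
    ∃ C : ℝ≥0∞, C ≠ ⊤ ∧ ∀ (u : 𝔼 → ℝ) (G : 𝔼 → 𝔼), HasGradL2 u G →
      (∀ᵐ x, x ∉ Ω → u x = 0) → eLpNorm u q volume ≤ C * eLpNorm G 2 volume := by
  obtain ⟨r, C, hr, hr2, hC, hw⟩ : ∃ r C : ℝ≥0∞, 1 ≤ r ∧ r ≤ 2 ∧ C ≠ ⊤ ∧
      ∀ w : 𝔼 → ℝ, ContDiff ℝ ∞ w → HasCompactSupport w →
      eLpNorm w q volume ≤ C * eLpNorm (gradient w) r volume := by
    rcases hq with ⟨rfl, rfl⟩ | ⟨hd2, hqt, hq2, hqd⟩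
    · exact ⟨1, 1, le_rfl, by norm_num, by simp, fun w hw hwc => by
        simpa using eLpNorm_top_le_eLpNorm_gradient_one w hw hwc⟩
    · lift q to ℝ≥0 using hqt
      have hq2' : (2 : ℝ) ≤ q := by exact_mod_cast hq2
      have hd2' : (2 : ℝ) ≤ d := by exact_mod_cast hd2
      -- the exponent of the Gagliardo-Nirenberg-Sobolev inequality with target `L^q`
      set r : ℝ≥0 := (q⁻¹ + (d : ℝ≥0)⁻¹)⁻¹ with hr
      have hrinv : (r : ℝ)⁻¹ = (q : ℝ)⁻¹ + (d : ℝ)⁻¹ := by simp [hr]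
      have hq0 : (q : ℝ)⁻¹ ≤ 2⁻¹ := by gcongr
      have hd0 : (d : ℝ)⁻¹ ≤ 2⁻¹ := by gcongr
      have hdpos : (0 : ℝ) < (d : ℝ)⁻¹ := by positivity
      have hqpos : (0 : ℝ) < (q : ℝ)⁻¹ := by positivity
      have hr0 : (0 : ℝ) < r := by
        rw [← inv_pos, hrinv]; positivity
      have hr1 : 1 ≤ r := by
        have : (r : ℝ)⁻¹ ≤ 1 := by rw [hrinv]; linarith
        have := (inv_le_one₀ hr0).1 this
        exact_mod_cast this
      have hr2 : r ≤ 2 := by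
        have h2 : (2 : ℝ)⁻¹ ≤ (r : ℝ)⁻¹ := by rw [hrinv]; simpa using hqd
        have := (inv_le_inv₀ (by norm_num) hr0).1 h2
        exact_mod_cast this
      refine ⟨r, SNormLESNormFDerivOfEqConst ℝ (volume : Measure 𝔼) r, by exact_mod_cast hr1,
        by exact_mod_cast hr2, by simp, fun w hw hwc => ?_⟩
      rw [eLpNorm_gradient]
      refine eLpNorm_le_eLpNorm_fderiv_of_eq (μ := volume) (hw.of_le (by simp)) hwc hr1
        (by simpa using (by omega : 0 < d)) ?_
      simp [hrinv]
  have hr' : r ≠ ⊤ := (hr2.trans_lt (by norm_num)).ne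
  have hexp : 0 ≤ 1 / r.toReal - 1 / (2 : ℝ≥0∞).toReal := by
    have h1 : r.toReal ≤ 2 := by simpa using ENNReal.toReal_mono (by norm_num) hr2
    have h0 : 0 < r.toReal := ENNReal.toReal_pos (one_pos.trans_le hr).ne' hr'
    have : 1 / (2 : ℝ) ≤ 1 / r.toReal := by gcongr
    simpa using this
  have hΩpow : volume Ω ^ (1 / r.toReal - 1 / (2 : ℝ≥0∞).toReal) ≠ ⊤ :=
    ENNReal.rpow_ne_top_of_nonneg hexp hΩ.ne
  refine ⟨C * volume Ω ^ (1 / r.toReal - 1 / (2 : ℝ≥0∞).toReal), ENNReal.mul_ne_top hC hΩpow,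
    fun u G h hu => ?_⟩
  have hG0 := h.ae_eq_zero_off hu
  have bu := eLpNorm_le_of_ae_eq_zero_off h.memLp.1 hu hr2
  have bG := eLpNorm_le_of_ae_eq_zero_off h.memLp_grad.1 hG0 hr2
  refine (h.eLpNorm_le_of_test hr hr' hC
    ⟨h.memLp.1, bu.trans_lt (ENNReal.mul_lt_top h.memLp.2 hΩpow.lt_top)⟩
    ⟨h.memLp_grad.1, bG.trans_lt (ENNReal.mul_lt_top h.memLp_grad.2 hΩpow.lt_top)⟩ hw).trans ?_
  rw [mul_assoc, mul_comm (volume Ω ^ _)]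
  gcongr

/-- For `p ≥ 2d/(d+2)`, `p > 1` if `d = 2`, the functions of `H¹(ℝᵈ)` that vanish outside a set of
finite measure are controlled by their gradient in `L^{p'}` and in `L²`: the condition on `p` says
that `1/p' ≥ 1/2 - 1/d`, so that the Sobolev inequality applies to `max p' 2`. -/
theorem exists_poincare_const (hd : 1 ≤ d) {p p' : ℝ≥0∞}
    (hp : ENNReal.ofReal (2 * (d : ℝ) / ((d : ℝ) + 2)) ≤ p) (hp2 : d = 2 → 1 < p)
    (hpp' : ENNReal.HolderConjugate p p') {Ω : Set 𝔼} (hΩ : volume Ω < ⊤) :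
    ∃ C : ℝ≥0∞, C ≠ ⊤ ∧ ∀ (u : 𝔼 → ℝ) (G : 𝔼 → 𝔼), HasGradL2 u G →
      (∀ᵐ x, x ∉ Ω → u x = 0) → eLpNorm u p' volume ≤ C * eLpNorm G 2 volume ∧
        eLpNorm u 2 volume ≤ C * eLpNorm G 2 volume := by
  have hdpos : (0 : ℝ) < d := by exact_mod_cast hd
  have hpp'' : ENNReal.HolderConjugate p' p := hpp'.symm
  have hp'1 : 1 ≤ p' := ENNReal.HolderConjugate.one_le p' p
  have hp'0 : p' ≠ 0 := (one_pos.trans_le hp'1).ne'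
  obtain ⟨q, hqp, hq2, hq⟩ : ∃ q : ℝ≥0∞, p' ≤ q ∧ 2 ≤ q ∧
      (d = 1 ∧ q = ⊤ ∨ 2 ≤ d ∧ q ≠ ⊤ ∧ 2 ≤ q ∧ (2 : ℝ)⁻¹ ≤ q.toReal⁻¹ + (d : ℝ)⁻¹) := by
    by_cases h1 : d = 1
    · exact ⟨⊤, le_top, le_top, Or.inl ⟨h1, rfl⟩⟩
    have hd2 : 2 ≤ d := by omega
    have hp1 : 1 < p := by
      rcases eq_or_ne d 2 with h2 | h2
      · exact hp2 h2
      · refine lt_of_lt_of_le ?_ hp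
        have h3 : (3 : ℝ) ≤ d := by exact_mod_cast (by omega : 3 ≤ d)
        rw [← ENNReal.ofReal_one, ENNReal.ofReal_lt_ofReal_iff (by positivity), lt_div_iff₀
          (by positivity)]
        linarith
    have hp't : p' ≠ ⊤ := ((ENNReal.HolderConjugate.lt_top_iff_one_lt p' p).2 hp1).ne
    refine ⟨max p' 2, le_max_left _ _, le_max_right _ _, Or.inr ⟨hd2, by simp [hp't],
      le_max_right _ _, ?_⟩⟩
    have hinv : p.toReal⁻¹ + p'.toReal⁻¹ = 1 := by
      have h1 := congrArg ENNReal.toReal (ENNReal.HolderConjugate.inv_add_inv_eq_one p p')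
      rwa [ENNReal.toReal_add (by simpa using (zero_lt_one.trans hp1).ne') (by simp [hp'0]),
        ENNReal.toReal_inv, ENNReal.toReal_inv, ENNReal.toReal_one] at h1
    have hpd : p.toReal⁻¹ ≤ 2⁻¹ + (d : ℝ)⁻¹ := by
      rcases eq_or_ne p ⊤ with rfl | hpt
      · simp only [ENNReal.toReal_top, inv_zero]; positivity
      · have h1 : 2 * (d : ℝ) / (d + 2) ≤ p.toReal := (ENNReal.ofReal_le_iff_le_toReal hpt).1 hp
        have h2 : p.toReal⁻¹ ≤ (2 * (d : ℝ) / (d + 2))⁻¹ := by gcongr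
        refine h2.trans (le_of_eq ?_)
        field_simp
    rcases le_total p' 2 with h2 | h2
    · simp [max_eq_right h2]
    · rw [max_eq_left h2]
      linarith
  obtain ⟨C, hC, h⟩ := exists_sobolev_const hd hΩ hq
  have hpow : ∀ s : ℝ≥0∞, s ≤ q → 1 ≤ s → volume Ω ^ (1 / s.toReal - 1 / q.toReal) ≠ ⊤ := by
    intro s hs h1
    refine ENNReal.rpow_ne_top_of_nonneg (sub_nonneg.2 ?_) hΩ.ne
    rcases eq_or_ne q ⊤ with rfl | hqt
    · simp
    · have h0 : 0 < s.toReal :=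
        ENNReal.toReal_pos (one_pos.trans_le h1).ne' (ne_top_of_le_ne_top hqt hs)
      have := ENNReal.toReal_mono hqt hs
      gcongr
  refine ⟨C * volume Ω ^ (1 / p'.toReal - 1 / q.toReal) +
    C * volume Ω ^ (1 / (2 : ℝ≥0∞).toReal - 1 / q.toReal),
    ENNReal.add_ne_top.2 ⟨ENNReal.mul_ne_top hC (hpow _ hqp hp'1),
      ENNReal.mul_ne_top hC (hpow _ hq2 (by norm_num))⟩, fun u G hG hu => ⟨?_, ?_⟩⟩
  · refine (eLpNorm_le_of_ae_eq_zero_off hG.memLp.1 hu hqp).trans ?_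
    rw [add_mul]
    refine le_trans ?_ le_self_add
    rw [mul_right_comm]
    gcongr
    exact h u G hG hu
  · refine (eLpNorm_le_of_ae_eq_zero_off hG.memLp.1 hu hq2).trans ?_
    rw [add_mul]
    refine le_trans ?_ le_add_self
    rw [mul_right_comm]
    gcongr
    exact h u G hG hu

end Sobolev

/-! ### Capacity -/

section Capacity

variable {d : ℕ}

local notation "𝔼" => EuclideanSpace ℝ (Fin d)

/-- A nonnegative `C¹` function of bounded slope that vanishes at `0` and is `1` for `|s| ≥ 1`. It
turns potentials with `|u| ≥ 1` on a set into competitors for the capacity, which are equal to `1`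
there. -/
theorem exists_truncation : ∃ (ψ : ℝ → ℝ) (K : ℝ), ContDiff ℝ 1 ψ ∧ ψ 0 = 0 ∧ (∀ s, 0 ≤ ψ s) ∧
    (∀ s, 1 ≤ |s| → ψ s = 1) ∧ 0 < K ∧ ∀ s, |deriv ψ s| ≤ K := by
  have h1 : ∀ s : ℝ, 1 ≤ |s| → Real.smoothTransition (s ^ 2) = 1 := fun s hs =>
    Real.smoothTransition.one_of_one_le (by nlinarith [sq_abs s, abs_nonneg s])
  have hc : ContDiff ℝ 1 fun s : ℝ => Real.smoothTransition (s ^ 2) :=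
    Real.smoothTransition.contDiff.comp (contDiff_id.pow 2)
  have hs : HasCompactSupport (deriv fun s : ℝ => Real.smoothTransition (s ^ 2)) := by
    refine HasCompactSupport.intro (isCompact_Icc (a := (-1 : ℝ)) (b := 1)) fun s hs => ?_
    have hs1 : 1 < |s| := by
      by_contra h
      exact hs (abs_le.1 (not_lt.1 h))
    have : (fun s : ℝ => Real.smoothTransition (s ^ 2)) =ᶠ[𝓝 s] fun _ => 1 := by
      filter_upwards [(continuous_abs.tendsto s).eventually (lt_mem_nhds hs1)] with t ht
      exact h1 t ht.le
    rw [this.deriv_eq, deriv_const]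
  obtain ⟨K, hK⟩ := (hc.continuous_deriv le_rfl).bounded_above_of_compact_support hs
  exact ⟨fun s => Real.smoothTransition (s ^ 2), max K 1, hc, by simp,
    fun s => Real.smoothTransition.nonneg _, h1, by simp,
    fun s => (hK s).trans (le_max_left _ _)⟩

/-- `E` has a neighbourhood on which `|u| ≥ 1` for a function `u ∈ H¹(ℝᵈ)` with
`‖u‖₂ ≤ ε` and `‖∇u‖₂ ≤ ε`. Up to constants, this says that `cap E ≤ ε²`. -/
def CapLE (E : Set 𝔼) (ε : ℝ) : Prop :=
  ∃ (u : 𝔼 → ℝ) (G : 𝔼 → 𝔼) (U : Set 𝔼), IsOpen U ∧ E ⊆ U ∧ HasGradL2 u G ∧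
    (∀ᵐ x, x ∈ U → 1 ≤ |u x|) ∧ eLpNorm u 2 volume ≤ ENNReal.ofReal ε ∧
    eLpNorm G 2 volume ≤ ENNReal.ofReal ε

theorem CapLE.mono {E F : Set 𝔼} {ε η : ℝ} (h : CapLE F ε) (hEF : E ⊆ F) (hεη : ε ≤ η) :
    CapLE E η := by
  obtain ⟨u, G, U, hU, hFU, huG, h1, hu, hG⟩ := h
  exact ⟨u, G, U, hU, hEF.trans hFU, huG, h1, hu.trans (ENNReal.ofReal_le_ofReal hεη),
    hG.trans (ENNReal.ofReal_le_ofReal hεη)⟩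

theorem CapLE.exists_isOpen {E : Set 𝔼} {ε : ℝ} (h : CapLE E ε) :
    ∃ U, IsOpen U ∧ E ⊆ U ∧ CapLE U ε := by
  obtain ⟨u, G, U, hU, hFU, huG, h1, hu, hG⟩ := h
  exact ⟨U, hU, hFU, u, G, U, hU, Subset.rfl, huG, h1, hu, hG⟩

theorem lintegral_enorm_sq {α E : Type*} {m : MeasurableSpace α} {μ : Measure α}
    [NormedAddCommGroup E] (f : α → E) : ∫⁻ x, ‖f x‖ₑ ^ 2 ∂μ = eLpNorm f 2 μ ^ 2 := by
  have := eLpNorm_nnreal_pow_eq_lintegral (μ := μ) (f := f) (p := 2) two_ne_zero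
  simpa using this.symm

theorem lintegral_weakGrad_add {u : 𝔼 → ℝ} {G : 𝔼 → 𝔼} (h : HasGradL2 u G) :
    ∫⁻ x, (‖weakGrad u x‖ₑ ^ 2 + ‖u x‖ₑ ^ 2) = eLpNorm G 2 volume ^ 2 + eLpNorm u 2 volume ^ 2 := by
  rw [lintegral_add_right' _ (h.memLp.1.enorm.pow_const _), lintegral_enorm_sq, lintegral_enorm_sq,
    eLpNorm_congr_ae h.weakGrad_ae_eq]

/-- Sets of small capacity satisfy `CapLE` with a small constant. -/
theorem CapLE.of_cap_lt {E : Set 𝔼} {ε : ℝ} (hε : 0 < ε)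
    (h : cap E < ENNReal.ofReal (ε ^ 2)) : CapLE E ε := by
  simp only [cap, iInf_lt_iff] at h
  obtain ⟨u, ⟨hu, U, hU, hEU, h1⟩, hlt⟩ := h
  rw [lintegral_weakGrad_add hu.hasGradL2, ENNReal.ofReal_pow hε.le] at hlt
  rw [ae_restrict_iff' hU.measurableSet] at h1
  refine ⟨u, weakGrad u, U, hU, hEU, hu.hasGradL2, ?_, ?_, ?_⟩
  · filter_upwards [h1] with x hx hxU
    simp [hx hxU]
  · exact (ENNReal.pow_le_pow_left_iff two_ne_zero).1 (le_add_self.trans hlt.le)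
  · exact (ENNReal.pow_le_pow_left_iff two_ne_zero).1 (le_self_add.trans hlt.le)

theorem eLpNorm_truncation_le {u : 𝔼 → ℝ} {G : 𝔼 → 𝔼} {ψ : ℝ → ℝ} {K : ℝ}
    (hψ : ContDiff ℝ 1 ψ) (hψ0 : ψ 0 = 0) (hK : ∀ s, |deriv ψ s| ≤ K) (hK0 : 0 < K) {N : ℝ}
    (hu : eLpNorm u 2 volume ≤ ENNReal.ofReal N) (hG : eLpNorm G 2 volume ≤ ENNReal.ofReal N) :
    eLpNorm (fun x => ψ (u x)) 2 volume ≤ ENNReal.ofReal (K * N) ∧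
      eLpNorm (fun x => deriv ψ (u x) • G x) 2 volume ≤ ENNReal.ofReal (K * N) := by
  rw [ENNReal.ofReal_mul hK0.le]
  constructor
  · refine (eLpNorm_le_mul_eLpNorm_of_ae_le_mul (g := u) (c := K) (Eventually.of_forall fun x => ?_)
      2).trans (by gcongr)
    have := (convex_univ (𝕜 := ℝ)).norm_image_sub_le_of_norm_deriv_le (f := ψ)
      (fun x _ => hψ.differentiable (by simp) x) (fun x _ => hK x) (mem_univ 0) (mem_univ (u x))
    simpa [hψ0] using this
  · refine (eLpNorm_le_mul_eLpNorm_of_ae_le_mul (g := G) (c := K) (Eventually.of_forall fun x => ?_)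
      2).trans (by gcongr)
    rw [norm_smul]
    refine mul_le_mul_of_nonneg_right ?_ (norm_nonneg _)
    exact hK _

/-- Sets satisfying `CapLE` with a small constant have small capacity. -/
theorem exists_cap_le_of_capLE (d : ℕ) {c : ℝ≥0∞} (hc : 0 < c) :
    ∃ η : ℝ, 0 < η ∧ ∀ E : Set (EuclideanSpace ℝ (Fin d)), CapLE E η → cap E ≤ c := by
  obtain ⟨ψ, K, hψ, hψ0, hψn, hψ1, hK0, hK⟩ := exists_truncation
  have hcont : Tendsto (fun η : ℝ => ENNReal.ofReal (K * η) ^ 2 + ENNReal.ofReal (K * η) ^ 2)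
      (𝓝[>] 0) (𝓝 0) := by
    have h1 : Tendsto (fun η : ℝ => ENNReal.ofReal (K * η) ^ 2) (𝓝 0) (𝓝 0) := by
      have : Continuous (fun η : ℝ => ENNReal.ofReal (K * η) ^ 2) :=
        (ENNReal.continuous_pow 2).comp (ENNReal.continuous_ofReal.comp (by fun_prop))
      simpa using this.tendsto 0
    have := (h1.add h1).mono_left (nhdsWithin_le_nhds (s := Ioi (0 : ℝ)))
    simpa using this
  obtain ⟨η, hη, hηpos⟩ := ((hcont.eventually (gt_mem_nhds hc)).and self_mem_nhdsWithin).exists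
  refine ⟨η, hηpos, fun E hE => ?_⟩
  obtain ⟨u, G, U, hU, hEU, huG, h1, hu, hG⟩ := hE
  have hb := eLpNorm_truncation_le hψ hψ0 hK hK0 hu hG
  have hcomp := huG.comp hψ hψ0 hK
  refine le_trans ?_ hη.le
  refine (iInf₂_le (fun x => ψ (u x)) ⟨hcomp.memH1, U, hU, hEU, ?_⟩).trans ?_
  · refine (lintegral_weakGrad_add hcomp).le.trans ?_
    gcongr
    exacts [hb.2, hb.1]
  · rw [ae_restrict_iff' hU.measurableSet]
    filter_upwards [h1] with x hx hxU using hψ1 _ (hx hxU)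

theorem cap_eq_zero_of_forall_capLE {E : Set 𝔼} (h : ∀ ε : ℝ, 0 < ε → CapLE E ε) : cap E = 0 := by
  by_contra hne
  obtain ⟨c, hc0, hc⟩ := exists_between (pos_iff_ne_zero.2 hne)
  obtain ⟨η, hη, hE⟩ := exists_cap_le_of_capLE d hc0
  exact (hE E (h η hη)).not_gt hc

/-- Countable subadditivity: the potentials are made nonnegative by the truncation and summed. -/
theorem exists_capLE_iUnion (d : ℕ) : ∃ K : ℝ, 0 < K ∧ ∀ {ι : Type} [Countable ι]
    (E : ι → Set (EuclideanSpace ℝ (Fin d))) (ε : ι → ℝ) (s : ℝ), (∀ i, 0 ≤ ε i) → HasSum ε s →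
    (∀ i, CapLE (E i) (ε i)) → CapLE (⋃ i, E i) (K * s) := by
  obtain ⟨ψ, K, hψ, hψ0, hψn, hψ1, hK0, hK⟩ := exists_truncation
  refine ⟨K, hK0, fun {ι} _ E ε s hε hs hE => ?_⟩
  choose u G U hU hEU huG h1 hu hG using hE
  have hb := fun i => eLpNorm_truncation_le hψ hψ0 hK hK0 (hu i) (hG i)
  have hcomp := fun i => (huG i).comp hψ hψ0 hK
  let z : ι → Lp ℝ 2 (volume : Measure (EuclideanSpace ℝ (Fin d))) := fun i => (hcomp i).memLp.toLp
  let g : ι → Lp (EuclideanSpace ℝ (Fin d)) 2 (volume : Measure (EuclideanSpace ℝ (Fin d))) :=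
    fun i => (hcomp i).memLp_grad.toLp
  have hKs : HasSum (fun i => K * ε i) (K * s) := hs.mul_left K
  have hz : ∀ i, ‖z i‖ ≤ K * ε i := fun i => by
    rw [Lp.norm_toLp]
    exact ENNReal.toReal_le_of_le_ofReal (mul_nonneg hK0.le (hε i)) (hb i).1
  have hg : ∀ i, ‖g i‖ ≤ K * ε i := fun i => by
    rw [Lp.norm_toLp]
    exact ENNReal.toReal_le_of_le_ofReal (mul_nonneg hK0.le (hε i)) (hb i).2
  have hzs : Summable z := Summable.of_norm_bounded hKs.summable hz
  have hgs : Summable g := Summable.of_norm_bounded hKs.summable hg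
  have hfin : ∀ S : Finset ι, HasGradL2 (∑ i ∈ S, z i : Lp ℝ 2 volume)
      (∑ i ∈ S, g i : Lp (EuclideanSpace ℝ (Fin d)) 2 volume) := by
    classical
    intro S
    induction S using Finset.induction_on with
    | empty =>
      simp only [Finset.sum_empty]
      exact HasGradL2.zero.congr_ae (Lp.coeFn_zero _ _ _).symm (Lp.coeFn_zero _ _ _).symm
    | insert i S hi ih =>
      rw [Finset.sum_insert hi, Finset.sum_insert hi]
      refine (((hcomp i).congr_ae (MemLp.coeFn_toLp (hcomp i).memLp).symm
        (MemLp.coeFn_toLp (hcomp i).memLp_grad).symm).add ih).congr_ae ?_ ?_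
      · exact (Lp.coeFn_add _ _).symm
      · exact (Lp.coeFn_add _ _).symm
  have hsum : HasGradL2 (∑' i, z i : Lp ℝ 2 volume)
      (∑' i, g i : Lp (EuclideanSpace ℝ (Fin d)) 2 volume) := by
    refine HasGradL2.of_tendsto (l := atTop) hfin (Lp.memLp _) (Lp.memLp _) ?_ ?_
    · exact (Lp.tendsto_Lp_iff_tendsto_eLpNorm' _ _).1 hzs.hasSum
    · exact (Lp.tendsto_Lp_iff_tendsto_eLpNorm' _ _).1 hgs.hasSum
  have hz0 : ∀ i, 0 ≤ z i := fun i => by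
    rw [← Lp.coeFn_nonneg]
    filter_upwards [MemLp.coeFn_toLp (hcomp i).memLp] with x hx
    rw [hx]
    exact hψn _
  have hle : ∀ i, z i ≤ ∑' j, z j := fun i => hzs.le_tsum i fun j _ => hz0 j
  refine ⟨(∑' i, z i : Lp ℝ 2 volume), (∑' i, g i : Lp (EuclideanSpace ℝ (Fin d)) 2 volume),
    ⋃ i, U i, isOpen_iUnion hU, iUnion_mono hEU, hsum, ?_, ?_, ?_⟩
  · have h2 : ∀ᵐ x, ∀ i, x ∈ U i → 1 ≤ (∑' i, z i : Lp ℝ 2 volume) x := by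
      rw [ae_all_iff]
      intro i
      filter_upwards [h1 i, MemLp.coeFn_toLp (hcomp i).memLp, (Lp.coeFn_le _ _).2 (hle i)]
        with x hx hzx hlex hxU
      rw [← hψ1 _ (hx hxU), ← hzx]
      exact hlex
    filter_upwards [h2] with x hx hxU
    obtain ⟨i, hi⟩ := mem_iUnion.1 hxU
    exact (hx i hi).trans (le_abs_self _)
  · rw [← Lp.enorm_def, ← ofReal_norm]
    exact ENNReal.ofReal_le_ofReal (tsum_of_norm_bounded hKs hz)
  · rw [← Lp.enorm_def, ← ofReal_norm]
    exact ENNReal.ofReal_le_ofReal (tsum_of_norm_bounded hKs hg)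

theorem exists_capLE_union (d : ℕ) : ∃ K : ℝ, 0 < K ∧ ∀ (E F : Set (EuclideanSpace ℝ (Fin d)))
    (ε η : ℝ), 0 ≤ ε → 0 ≤ η → CapLE E ε → CapLE F η → CapLE (E ∪ F) (K * (ε + η)) := by
  obtain ⟨K, hK0, hK⟩ := exists_capLE_iUnion d
  refine ⟨K, hK0, fun E F ε η hε hη hE hF => ?_⟩
  have := hK (fun b : Bool => cond b E F) (fun b => cond b ε η) (ε + η)
    (by rintro (_ | _) <;> assumption) (by simpa using hasSum_fintype fun b : Bool => cond b ε η)
    (by rintro (_ | _) <;> assumption)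
  rwa [← union_eq_iUnion] at this

theorem cap_eq_zero_iff {E : Set 𝔼} : cap E = 0 ↔ ∀ ε : ℝ, 0 < ε → CapLE E ε :=
  ⟨fun h ε hε => CapLE.of_cap_lt hε (by rw [h]; simpa using by positivity),
    cap_eq_zero_of_forall_capLE⟩

theorem cap_iUnion_eq_zero {E : ℕ → Set 𝔼} (h : ∀ n, cap (E n) = 0) : cap (⋃ n, E n) = 0 := by
  obtain ⟨K, hK0, hK⟩ := exists_capLE_iUnion d
  refine cap_eq_zero_of_forall_capLE fun ε hε => ?_
  have := hK E (fun n => ε / K / 2 / 2 ^ n) (ε / K) (fun n => by positivity)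
    (hasSum_geometric_two' _) fun n => cap_eq_zero_iff.1 (h n) _ (by positivity)
  rwa [mul_div_cancel₀ _ hK0.ne'] at this

theorem cap_mono {E F : Set 𝔼} (h : E ⊆ F) : cap E ≤ cap F := by
  refine le_iInf₂ fun u hu => iInf₂_le u ⟨hu.1, ?_⟩
  obtain ⟨U, hU, hFU, h1⟩ := hu.2
  exact ⟨U, hU, h.trans hFU, h1⟩

/-- The capacity dominates the Lebesgue measure. -/
theorem volume_le_cap (E : Set 𝔼) : volume E ≤ cap E := by
  refine le_iInf₂ fun u hu => ?_
  obtain ⟨U, hU, hEU, h1⟩ := hu.2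
  calc volume E ≤ volume U := measure_mono hEU
    _ = ∫⁻ _ in U, 1 := by simp
    _ ≤ ∫⁻ x in U, (‖weakGrad u x‖ₑ ^ 2 + ‖u x‖ₑ ^ 2) := by
        refine lintegral_mono_ae ?_
        filter_upwards [h1] with x hx
        simp [hx]
    _ ≤ _ := setLIntegral_le_lintegral _ _

theorem QuasiContinuous.exists_capLE {v : 𝔼 → ℝ} (hv : QuasiContinuous v) {ε : ℝ} (hε : 0 < ε) :
    ∃ G, IsOpen G ∧ CapLE G ε ∧ ContinuousOn v Gᶜ := by
  obtain ⟨G, hG, hcap, hc⟩ := hv (ENNReal.ofReal ((ε / 2) ^ 2)) (by simpa using by positivity)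
  refine ⟨G, hG, CapLE.of_cap_lt hε (hcap.trans_lt ?_), hc⟩
  rw [ENNReal.ofReal_lt_ofReal_iff (by positivity)]
  nlinarith

theorem QuasiContinuous.of_capLE {v : 𝔼 → ℝ}
    (h : ∀ ε : ℝ, 0 < ε → ∃ G, IsOpen G ∧ CapLE G ε ∧ ContinuousOn v Gᶜ) : QuasiContinuous v := by
  intro c hc
  obtain ⟨η, hη, hE⟩ := exists_cap_le_of_capLE d hc
  obtain ⟨G, hG, hcap, hGc⟩ := h η hη
  exact ⟨G, hG, hE G hcap, hGc⟩

theorem QuasiContinuous.add {v w : 𝔼 → ℝ} (hv : QuasiContinuous v) (hw : QuasiContinuous w) :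
    QuasiContinuous (v + w) := by
  obtain ⟨K, hK0, hK⟩ := exists_capLE_union d
  refine .of_capLE fun ε hε => ?_
  obtain ⟨G, hG, hcG, hvG⟩ := hv.exists_capLE (ε := ε / K / 2) (by positivity)
  obtain ⟨H, hH, hcH, hwH⟩ := hw.exists_capLE (ε := ε / K / 2) (by positivity)
  refine ⟨G ∪ H, hG.union hH, ?_, ?_⟩
  · have := hK G H _ _ (by positivity) (by positivity) hcG hcH
    rwa [add_halves, mul_div_cancel₀ _ hK0.ne'] at this
  · exact (hvG.mono (compl_subset_compl.2 subset_union_left)).add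
      (hwH.mono (compl_subset_compl.2 subset_union_right))

theorem QuasiContinuous.const_smul {v : 𝔼 → ℝ} (hv : QuasiContinuous v) (c : ℝ) :
    QuasiContinuous (c • v) := fun ε hε => by
  obtain ⟨G, hG, hcG, hvG⟩ := hv ε hε
  exact ⟨G, hG, hcG, hvG.const_smul c⟩

theorem CapLE.empty : CapLE (∅ : Set 𝔼) 0 :=
  ⟨0, 0, ∅, isOpen_empty, Subset.rfl, HasGradL2.zero, by simp, by simp, by simp⟩

theorem QuasiContinuous.zero : QuasiContinuous (0 : 𝔼 → ℝ) :=
  .of_capLE fun _ε hε => ⟨∅, isOpen_empty, CapLE.empty.mono Subset.rfl hε.le, continuousOn_const⟩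

/-- The weak-type capacitary estimate: a quasi-continuous function with small `H¹` norm is small
outside a set of small capacity. If `w` is continuous off the open set `A`, then `{|w| > t} ∪ A` is
open, and truncations of `w / t` and of a potential of `A` add up to a potential of it. -/
theorem exists_capLE_lt_abs (d : ℕ) : ∃ K : ℝ, 0 < K ∧ ∀ (w : EuclideanSpace ℝ (Fin d) → ℝ)
    (H : EuclideanSpace ℝ (Fin d) → EuclideanSpace ℝ (Fin d)) (N t : ℝ), QuasiContinuous w →
    HasGradL2 w H → 0 < N → 0 < t → eLpNorm w 2 volume ≤ ENNReal.ofReal N →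
    eLpNorm H 2 volume ≤ ENNReal.ofReal N → CapLE {x | t < |w x|} (K * (N / t)) := by
  obtain ⟨ψ, K, hψ, hψ0, hψn, hψ1, hK0, hK⟩ := exists_truncation
  refine ⟨2 * K, by positivity, fun w H N t hw hH hN ht hwN hHN => ?_⟩
  have hNt : 0 < N / t := by positivity
  obtain ⟨A, hA, hcA, hwA⟩ := hw.exists_capLE hNt
  obtain ⟨z, Z, U, hU, hAU, hzZ, hz1, hz, hZ⟩ := hcA
  have hs := hH.const_smul t⁻¹
  have hinv : ‖(t⁻¹ : ℝ)‖ₑ = ENNReal.ofReal t⁻¹ := by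
    rw [← ofReal_norm, Real.norm_of_nonneg (by positivity)]
  have b1 : eLpNorm (t⁻¹ • w) 2 volume ≤ ENNReal.ofReal (N / t) := by
    rw [eLpNorm_const_smul, hinv, div_eq_inv_mul, ENNReal.ofReal_mul (by positivity)]
    gcongr
  have b2 : eLpNorm (t⁻¹ • H) 2 volume ≤ ENNReal.ofReal (N / t) := by
    rw [eLpNorm_const_smul, hinv, div_eq_inv_mul, ENNReal.ofReal_mul (by positivity)]
    gcongr
  have c1 := eLpNorm_truncation_le hψ hψ0 hK hK0 b1 b2
  have c2 := eLpNorm_truncation_le hψ hψ0 hK hK0 hz hZ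
  have d1 := hs.comp hψ hψ0 hK
  have d2 := hzZ.comp hψ hψ0 hK
  have hopen : IsOpen ({x | t < |w x|} ∪ A) := by
    obtain ⟨V, hV, hVe⟩ := (continuousOn_iff'.1 hwA.abs) (Ioi t) isOpen_Ioi
    have : {x | t < |w x|} ∪ A = V ∪ A := by
      ext x
      by_cases hx : x ∈ A
      · simp [hx]
      · have := Set.ext_iff.1 hVe x
        simpa [hx] using this
    rw [this]
    exact hV.union hA
  have hsum : ENNReal.ofReal (K * (N / t)) + ENNReal.ofReal (K * (N / t)) =
      ENNReal.ofReal (2 * K * (N / t)) := by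
    rw [← ENNReal.ofReal_add (by positivity) (by positivity)]
    congr 1
    ring
  refine ⟨_, _, _, hopen, subset_union_left, d1.add d2, ?_, ?_, ?_⟩
  · filter_upwards [hz1] with x hx hxU
    refine le_trans ?_ (le_abs_self _)
    simp only [Pi.add_apply, Pi.smul_apply, smul_eq_mul]
    rcases hxU with hxw | hxA
    · rw [hψ1 (t⁻¹ * w x)]
      · linarith [hψn (z x)]
      · rw [abs_mul, abs_of_pos (by positivity : 0 < t⁻¹), inv_mul_eq_div, one_le_div ht]
        exact le_of_lt hxw
    · rw [hψ1 (z x) (hx (hAU hxA))]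
      linarith [hψn (t⁻¹ * w x)]
  · exact (eLpNorm_add_le d1.memLp.1 d2.memLp.1 (by norm_num)).trans
      ((add_le_add c1.1 c2.1).trans hsum.le)
  · exact (eLpNorm_add_le d1.memLp_grad.1 d2.memLp_grad.1 (by norm_num)).trans
      ((add_le_add c1.2 c2.2).trans hsum.le)

end Capacity

/-! ### The space `H¹₀(Ω)` -/

section HOneZero

variable {d : ℕ}

local notation "𝔼" => EuclideanSpace ℝ (Fin d)

/-- Up to a null set, a quasi-open set is the intersection of the open sets `Ω ∪ G n` with
`cap (G n) → 0`. -/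
theorem QuasiOpen.nullMeasurableSet {Ω : Set 𝔼} (h : QuasiOpen Ω) :
    NullMeasurableSet Ω volume := by
  have hε : ∀ n : ℕ, (0 : ℝ≥0∞) < (n : ℝ≥0∞)⁻¹ := fun n => by simp
  choose G hG hcap hΩG using fun n => h _ (hε n)
  have hA : MeasurableSet (⋂ n, (Ω ∪ G n)) := MeasurableSet.iInter fun n => (hΩG n).measurableSet
  have hnull : volume (⋂ n, G n) = 0 := by
    refine le_antisymm (ge_of_tendsto' ENNReal.tendsto_inv_nat_nhds_zero fun n => ?_) zero_le
    exact (measure_mono (iInter_subset _ n)).trans ((volume_le_cap _).trans (hcap n))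
  refine hA.nullMeasurableSet.congr ?_
  have hx : ∀ᵐ x, x ∉ ⋂ n, G n := measure_eq_zero_iff_ae_notMem.1 hnull
  filter_upwards [hx] with x hx
  refine propext ⟨fun h1 => ?_, fun h1 => mem_iInter.2 fun n => Or.inl h1⟩
  by_contra hxΩ
  refine hx (mem_iInter.2 fun n => ?_)
  exact (mem_iInter.1 h1 n).resolve_left hxΩ

theorem H10.hasGradL2 {Ω : Set 𝔼} {u : 𝔼 → ℝ} (h : u ∈ H10 Ω) : HasGradL2 u (weakGrad u) :=
  h.1.hasGradL2

theorem H10.ae_eq_zero_off {Ω : Set 𝔼} {u : 𝔼 → ℝ} (h : u ∈ H10 Ω) :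
    ∀ᵐ x, x ∉ Ω → u x = 0 := by
  obtain ⟨v, -, hvu, hcap⟩ := h.2
  have h0 : volume ({x | v x ≠ 0} \ Ω) = 0 := le_antisymm (hcap ▸ volume_le_cap _) zero_le
  filter_upwards [measure_eq_zero_iff_ae_notMem.1 h0, hvu] with x hx hvx hxΩ
  rw [← hvx]
  by_contra hne
  exact hx ⟨hne, hxΩ⟩

theorem zero_mem_H10 (Ω : Set 𝔼) : (0 : 𝔼 → ℝ) ∈ H10 Ω := by
  refine ⟨HasGradL2.zero.memH1, 0, QuasiContinuous.zero, EventuallyEq.rfl, ?_⟩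
  simpa using cap_eq_zero_iff.2 fun ε hε => CapLE.empty.mono Subset.rfl hε.le

theorem add_mem_H10 {Ω : Set 𝔼} {u v : 𝔼 → ℝ} (hu : u ∈ H10 Ω) (hv : v ∈ H10 Ω) :
    u + v ∈ H10 Ω := by
  refine ⟨((H10.hasGradL2 hu).add (H10.hasGradL2 hv)).memH1, ?_⟩
  obtain ⟨-, u', hu', huu', hcu⟩ := hu
  obtain ⟨-, v', hv', hvv', hcv⟩ := hv
  refine ⟨u' + v', hu'.add hv', huu'.add hvv', ?_⟩
  refine le_antisymm ((cap_mono (F := ⋃ n : ℕ, if n = 0 then {x | u' x ≠ 0} \ Ω else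
    {x | v' x ≠ 0} \ Ω) fun x hx => ?_).trans_eq (cap_iUnion_eq_zero fun n => ?_)) zero_le
  · by_cases h0 : u' x = 0
    · refine mem_iUnion.2 ⟨1, ?_⟩
      have h1 : u' x + v' x ≠ 0 := hx.1
      rw [h0, zero_add] at h1
      simpa using ⟨h1, hx.2⟩
    · refine mem_iUnion.2 ⟨0, ?_⟩
      simpa using ⟨h0, hx.2⟩
  · split_ifs <;> assumption

theorem smul_mem_H10 {Ω : Set 𝔼} {u : 𝔼 → ℝ} (c : ℝ) (hu : u ∈ H10 Ω) : c • u ∈ H10 Ω := by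
  refine ⟨((H10.hasGradL2 hu).const_smul c).memH1, ?_⟩
  obtain ⟨-, u', hu', huu', hcu⟩ := hu
  refine ⟨c • u', hu'.const_smul c, huu'.const_smul c, ?_⟩
  have hsub : {x | (c • u') x ≠ 0} \ Ω ⊆ {x | u' x ≠ 0} \ Ω := fun x hx =>
    ⟨fun h0 => hx.1 (by simp [h0]), hx.2⟩
  exact le_antisymm ((cap_mono hsub).trans_eq hcu) zero_le

/-- `H¹₀(Ω)` is closed in `H¹(ℝᵈ)`: a rapidly converging subsequence of quasi-continuous
representatives converges uniformly off open sets of small capacity, by the weak-type capacitary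
estimate. -/
theorem mem_H10_of_tendsto {Ω : Set 𝔼} {u : ℕ → 𝔼 → ℝ} {G : ℕ → 𝔼 → 𝔼} {u₀ : 𝔼 → ℝ} {G₀ : 𝔼 → 𝔼}
    (hu : ∀ n, u n ∈ H10 Ω) (hG : ∀ n, HasGradL2 (u n) (G n)) (hu₀ : MemLp u₀ 2 volume)
    (hG₀ : MemLp G₀ 2 volume) (htu : Tendsto (fun n => eLpNorm (u n - u₀) 2 volume) atTop (𝓝 0))
    (htG : Tendsto (fun n => eLpNorm (G n - G₀) 2 volume) atTop (𝓝 0)) : u₀ ∈ H10 Ω := by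
  refine ⟨(HasGradL2.of_tendsto hG hu₀ hG₀ htu htG).memH1, ?_⟩
  obtain ⟨K₁, hK₁, hweak⟩ := exists_capLE_lt_abs d
  obtain ⟨K₂, hK₂, hUnion⟩ := exists_capLE_iUnion d
  obtain ⟨K₃, hK₃, hunion⟩ := exists_capLE_union d
  obtain ⟨ns, hns, hae⟩ := (tendstoInMeasure_of_tendsto_eLpNorm (by norm_num)
    (fun n => (hG n).memLp.1) hu₀.1 htu).exists_seq_tendsto_ae
  have htu' := htu.comp hns.tendsto_atTop
  have htG' := htG.comp hns.tendsto_atTop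
  obtain ⟨φ, hφ, hφp⟩ : ∃ φ : ℕ → ℕ, StrictMono φ ∧ ∀ n,
      eLpNorm (u (ns (φ n)) - u₀) 2 volume ≤ ENNReal.ofReal ((1 / 4) ^ n / 2) ∧
      eLpNorm (G (ns (φ n)) - G₀) 2 volume ≤ ENNReal.ofReal ((1 / 4) ^ n / 2) := by
    refine Filter.extraction_forall_of_eventually (P := fun n k =>
      eLpNorm (u (ns k) - u₀) 2 volume ≤ ENNReal.ofReal ((1 / 4) ^ n / 2) ∧
      eLpNorm (G (ns k) - G₀) 2 volume ≤ ENNReal.ofReal ((1 / 4) ^ n / 2)) fun n => ?_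
    have hpos : (0 : ℝ≥0∞) < ENNReal.ofReal ((1 / 4) ^ n / 2) := by
      rw [ENNReal.ofReal_pos]; positivity
    exact (ENNReal.tendsto_nhds_zero.1 htu' _ hpos).and (ENNReal.tendsto_nhds_zero.1 htG' _ hpos)
  choose v hv hvu hcap using fun n => (hu (ns (φ n))).2
  set H : ℕ → 𝔼 → 𝔼 := fun n => G (ns (φ n)) with hH
  have hvH : ∀ n, HasGradL2 (v n) (H n) := fun n => (hG _).congr_ae (hvu n).symm EventuallyEq.rfl
  have hdist : ∀ n, eLpNorm (v n - u₀) 2 volume ≤ ENNReal.ofReal ((1 / 4) ^ n / 2) := fun n => by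
    rw [eLpNorm_congr_ae ((hvu n).sub (EventuallyEq.refl _ u₀))]
    exact (hφp n).1
  have hquarter : ∀ n : ℕ, ENNReal.ofReal ((1 / 4) ^ (n + 1) / 2) + ENNReal.ofReal ((1 / 4) ^ n / 2)
      ≤ ENNReal.ofReal ((1 / 4) ^ n) := fun n => by
    rw [← ENNReal.ofReal_add (by positivity) (by positivity)]
    refine ENNReal.ofReal_le_ofReal ?_
    have : (0 : ℝ) ≤ (1 / 4) ^ n := by positivity
    rw [pow_succ]
    linarith
  have hd : ∀ {E : Type} [NormedAddCommGroup E] (f g h : 𝔼 → E), MemLp f 2 volume →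
      MemLp g 2 volume → MemLp h 2 volume → eLpNorm (f - g) 2 volume ≤
      eLpNorm (f - h) 2 volume + eLpNorm (g - h) 2 volume := by
    intro E _ f g h hf hg hh
    have : f - g = (f - h) - (g - h) := by abel
    rw [this]
    exact eLpNorm_sub_le (hf.1.sub hh.1) (hg.1.sub hh.1) (by norm_num)
  have hdv : ∀ n, eLpNorm (v (n + 1) - v n) 2 volume ≤ ENNReal.ofReal ((1 / 4) ^ n) := fun n =>
    (hd _ _ _ (hvH _).memLp (hvH _).memLp hu₀).trans
      ((add_le_add (hdist _) (hdist _)).trans (hquarter n))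
  have hdH : ∀ n, eLpNorm (H (n + 1) - H n) 2 volume ≤ ENNReal.ofReal ((1 / 4) ^ n) := fun n =>
    (hd _ _ _ (hvH _).memLp_grad (hvH _).memLp_grad hG₀).trans
      ((add_le_add (hφp _).2 (hφp _).2).trans (hquarter n))
  let A : ℕ → Set 𝔼 := fun n => {x | (1 / 2) ^ n < |(v (n + 1) - v n) x|}
  have hA : ∀ n, CapLE (A n) (K₁ * (1 / 2) ^ n) := by
    intro n
    have hq : QuasiContinuous (v (n + 1) - v n) := by
      have := (hv (n + 1)).add ((hv n).const_smul (-1))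
      simpa [sub_eq_add_neg] using this
    have := hweak _ _ ((1 / 4) ^ n) ((1 / 2) ^ n) hq ((hvH (n + 1)).sub (hvH n)) (by positivity)
      (by positivity) (hdv n) (hdH n)
    rwa [← div_pow, show (1 / 4 : ℝ) / (1 / 2) = 1 / 2 by norm_num] at this
  -- where the limit does not exist, the value of `w` is irrelevant, except that `w` vanishes
  -- wherever all `v n` do
  let w : 𝔼 → ℝ := fun x => limUnder atTop fun n => v n x
  refine ⟨w, .of_capLE fun ε hε => ?_, ?_, ?_⟩
  · obtain ⟨m, hm⟩ : ∃ m : ℕ, K₂ * (K₁ * (1 / 2) ^ m * 2) ≤ ε / K₃ / 2 := by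
      have h1 : Tendsto (fun m : ℕ => K₂ * (K₁ * (1 / 2 : ℝ) ^ m * 2)) atTop (𝓝 0) := by
        have := (((tendsto_pow_atTop_nhds_zero_of_lt_one (r := (1 / 2 : ℝ)) (by norm_num)
          (by norm_num)).const_mul K₁).mul_const 2).const_mul K₂
        simpa using this
      exact (h1.eventually (ge_mem_nhds (by positivity : 0 < ε / K₃ / 2))).exists
    have hAm : CapLE (⋃ n, A (n + m)) (ε / K₃ / 2) := by
      refine (hUnion (fun n => A (n + m)) (fun n => K₁ * (1 / 2) ^ m * (1 / 2) ^ n) _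
        (fun n => by positivity) (hasSum_geometric_two.mul_left _) fun n => ?_).mono Subset.rfl hm
      exact (hA _).mono Subset.rfl (by rw [pow_add]; exact le_of_eq (by ring))
    obtain ⟨U, hU, hAU, hcU⟩ := hAm.exists_isOpen
    choose B hB hcB hvB using fun n => (hv n).exists_capLE
      (ε := ε / K₃ / 2 / K₂ / 2 / 2 ^ n) (by positivity)
    have hcB' := hUnion B _ _ (fun n => by positivity) (hasSum_geometric_two' _) hcB
    rw [mul_div_cancel₀ _ hK₂.ne'] at hcB'
    have hW := hunion U (⋃ n, B n) _ _ (by positivity) (by positivity) hcU hcB'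
    rw [add_halves, mul_div_cancel₀ _ hK₃.ne'] at hW
    refine ⟨U ∪ ⋃ n, B n, hU.union (isOpen_iUnion hB), hW, ?_⟩
    have hstep : ∀ x ∈ (U ∪ ⋃ n, B n)ᶜ, ∀ n,
        dist (v (n + m) x) (v (n + 1 + m) x) ≤ (1 / 2) ^ m * (1 / 2) ^ n := by
      intro x hx n
      have hxA : x ∉ A (n + m) := fun h => hx (Or.inl (hAU (mem_iUnion.2 ⟨n, h⟩)))
      have := not_lt.1 (show ¬ (1 / 2) ^ (n + m) < |(v (n + m + 1) - v (n + m)) x| from hxA)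
      rw [dist_comm, Real.dist_eq, show n + 1 + m = n + m + 1 by ring, mul_comm, ← pow_add]
      exact this
    have hlim : ∀ x ∈ (U ∪ ⋃ n, B n)ᶜ, Tendsto (fun n => v (n + m) x) atTop (𝓝 (w x)) := by
      intro x hx
      obtain ⟨l, hl⟩ := cauchySeq_tendsto_of_complete
        (cauchySeq_of_le_geometric (1 / 2) _ (by norm_num) (hstep x hx))
      have hl' := (tendsto_add_atTop_iff_nat (f := fun n => v n x) m).1 hl
      have : w x = l := hl'.limUnder_eq
      rwa [this]
    have hunif : TendstoUniformlyOn (fun n => v (n + m)) w atTop (U ∪ ⋃ n, B n)ᶜ := by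
      rw [Metric.tendstoUniformlyOn_iff]
      intro η hη
      have h1 : Tendsto (fun n : ℕ => (1 / 2 : ℝ) ^ m * (1 / 2) ^ n / (1 - 1 / 2)) atTop (𝓝 0) := by
        have := ((tendsto_pow_atTop_nhds_zero_of_lt_one (r := (1 / 2 : ℝ)) (by norm_num)
          (by norm_num)).const_mul ((1 / 2 : ℝ) ^ m)).div_const (1 - 1 / 2)
        simpa using this
      filter_upwards [h1.eventually (gt_mem_nhds hη)] with n hn x hx
      rw [dist_comm]
      exact (dist_le_of_le_geometric_of_tendsto (1 / 2) _ (by norm_num) (hstep x hx) (hlim x hx)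
        n).trans_lt hn
    refine hunif.continuousOn (Eventually.of_forall fun n => ?_).frequently
    exact (hvB (n + m)).mono (compl_subset_compl.2
      ((subset_iUnion B (n + m)).trans subset_union_right))
  · filter_upwards [hae, ae_all_iff.2 hvu] with x hx hvx
    refine Tendsto.limUnder_eq ?_
    simp_rw [hvx]
    exact hx.comp hφ.tendsto_atTop
  · refine le_antisymm ((cap_mono fun x hx => ?_).trans_eq (cap_iUnion_eq_zero hcap)) zero_le
    by_contra hxn
    have h0 : ∀ n, v n x = 0 := fun n => by
      by_contra hne
      exact hxn (mem_iUnion.2 ⟨n, hne, hx.2⟩)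
    refine hx.1 (Tendsto.limUnder_eq ?_)
    simp_rw [h0]
    exact tendsto_const_nhds

/-- `H¹₀(Ω)` as a linear space of functions, not of classes modulo null sets. -/
def H10Submodule (Ω : Set 𝔼) : Submodule ℝ (𝔼 → ℝ) where
  carrier := H10 Ω
  add_mem' := add_mem_H10
  zero_mem' := zero_mem_H10 Ω
  smul_mem' c _ hu := smul_mem_H10 c hu

/-- The weak gradient as a linear map from `H¹₀(Ω)` to `L²`. -/
def gradMap (Ω : Set 𝔼) : H10Submodule Ω →ₗ[ℝ] Lp 𝔼 2 (volume : Measure 𝔼) where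
  toFun u := (H10.hasGradL2 u.2).memLp_grad.toLp
  map_add' u v := by
    rw [← MemLp.toLp_add, MemLp.toLp_eq_toLp_iff]
    exact ((H10.hasGradL2 u.2).add (H10.hasGradL2 v.2)).weakGrad_ae_eq
  map_smul' c u := by
    rw [RingHom.id_apply, ← MemLp.toLp_const_smul, MemLp.toLp_eq_toLp_iff]
    exact ((H10.hasGradL2 u.2).const_smul c).weakGrad_ae_eq

theorem enorm_gradMap {Ω : Set 𝔼} (u : H10Submodule Ω) :
    ‖gradMap Ω u‖ₑ = eLpNorm (weakGrad (u : 𝔼 → ℝ)) 2 volume :=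
  Lp.enorm_toLp (H10.hasGradL2 u.2).memLp_grad

theorem coeFn_gradMap {Ω : Set 𝔼} (u : H10Submodule Ω) :
    gradMap Ω u =ᵐ[volume] weakGrad (u : 𝔼 → ℝ) :=
  MemLp.coeFn_toLp (H10.hasGradL2 u.2).memLp_grad

/-- By a Poincaré inequality, the gradients of the functions of `H¹₀(Ω)` form a closed subspace
of `L²`. -/
theorem isClosed_range_gradMap {Ω : Set 𝔼} {C : ℝ≥0∞} (hC : C ≠ ⊤)
    (hP : ∀ u ∈ H10 Ω, eLpNorm u 2 volume ≤ C * eLpNorm (weakGrad u) 2 volume) :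
    IsClosed (range (gradMap Ω)) := by
  refine IsSeqClosed.isClosed fun g g₀ hg hg₀ => ?_
  choose u hu using hg
  have hcauchy : CauchySeq g := hg₀.cauchySeq
  let z : ℕ → Lp ℝ 2 (volume : Measure 𝔼) := fun n => (H10.hasGradL2 (u n).2).memLp.toLp
  have hzd : ∀ n m, edist (z n) (z m) ≤ C * edist (g n) (g m) := by
    intro n m
    have h1 := hP _ (u n - u m).2
    rw [← enorm_gradMap, map_sub, hu, hu] at h1
    rwa [Lp.edist_toLp_toLp, edist_eq_enorm_sub]
  have hz : CauchySeq z := by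
    lift C to ℝ≥0 using hC
    rw [EMetric.cauchySeq_iff] at hcauchy ⊢
    intro ε hε
    obtain ⟨N, hN⟩ := hcauchy (ε / (C + 1)) (ENNReal.div_pos hε.ne' (by simp))
    refine ⟨N, fun n hn m hm => (hzd n m).trans_lt ?_⟩
    have h2 := hN n hn m hm
    rw [ENNReal.lt_div_iff_mul_lt (by simp) (by simp)] at h2
    refine lt_of_le_of_lt ?_ h2
    rw [mul_comm]
    gcongr
    exact le_self_add
  obtain ⟨z₀, hz₀⟩ := cauchySeq_tendsto_of_complete hz
  have hzu : ∀ n, (z n : 𝔼 → ℝ) =ᵐ[volume] u n := fun n => MemLp.coeFn_toLp _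
  have hgu : ∀ n, (g n : 𝔼 → 𝔼) =ᵐ[volume] weakGrad (u n : 𝔼 → ℝ) := fun n => by
    rw [← hu n]
    exact coeFn_gradMap (u n)
  have t1 : Tendsto (fun n => eLpNorm ((u n : 𝔼 → ℝ) - (z₀ : 𝔼 → ℝ)) 2 volume) atTop (𝓝 0) :=
    ((Lp.tendsto_Lp_iff_tendsto_eLpNorm' _ _).1 hz₀).congr fun n =>
      eLpNorm_congr_ae ((hzu n).sub EventuallyEq.rfl)
  have t2 : Tendsto (fun n => eLpNorm (weakGrad (u n : 𝔼 → ℝ) - (g₀ : 𝔼 → 𝔼)) 2 volume)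
      atTop (𝓝 0) :=
    ((Lp.tendsto_Lp_iff_tendsto_eLpNorm' _ _).1 hg₀).congr fun n =>
      eLpNorm_congr_ae ((hgu n).sub EventuallyEq.rfl)
  have hmem : (z₀ : 𝔼 → ℝ) ∈ H10 Ω := mem_H10_of_tendsto (fun n => (u n).2)
    (fun n => H10.hasGradL2 (u n).2) (Lp.memLp z₀) (Lp.memLp g₀) t1 t2
  have hgrad : HasGradL2 (z₀ : 𝔼 → ℝ) g₀ := HasGradL2.of_tendsto
    (fun n => H10.hasGradL2 (u n).2) (Lp.memLp z₀) (Lp.memLp g₀) t1 t2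
  refine ⟨⟨z₀, hmem⟩, ?_⟩
  ext1
  exact (coeFn_gradMap _).trans hgrad.weakGrad_ae_eq

end HOneZero

/-! ### Quadratic minimization and minimax in a Hilbert space -/

section Minimax

/-- A functional on `V` that is bounded by `‖A ·‖` factors through the range of `A`. -/
theorem exists_functional_on_range {V E : Type*} [AddCommGroup V] [Module ℝ V]
    [NormedAddCommGroup E] [NormedSpace ℝ E] (A : V →ₗ[ℝ] E) (ℓ : V →ₗ[ℝ] ℝ) {C : ℝ} (hC : 0 ≤ C)
    (h : ∀ u, |ℓ u| ≤ C * ‖A u‖) :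
    ∃ f : StrongDual ℝ (LinearMap.range A), ‖f‖ ≤ C ∧ ∀ u, f ⟨A u, u, rfl⟩ = ℓ u := by
  have hker : LinearMap.ker A ≤ LinearMap.ker ℓ := fun u hu => by
    have := h u
    rw [LinearMap.mem_ker.1 hu, norm_zero, mul_zero] at this
    exact abs_nonpos_iff.1 this
  let f₀ : LinearMap.range A →ₗ[ℝ] ℝ :=
    ((LinearMap.ker A).liftQ ℓ hker).comp A.quotKerEquivRange.symm.toLinearMap
  have hf₀ : ∀ u, f₀ ⟨A u, u, rfl⟩ = ℓ u := fun u => by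
    have : A.quotKerEquivRange.symm ⟨A u, u, rfl⟩ = (LinearMap.ker A).mkQ u := by
      rw [LinearEquiv.symm_apply_eq]
      rfl
    simp only [f₀, LinearMap.comp_apply, LinearEquiv.coe_coe, this]
    rfl
  have hb : ∀ x, ‖f₀ x‖ ≤ C * ‖x‖ := by
    rintro ⟨_, u, rfl⟩
    rw [hf₀]
    exact h u
  exact ⟨f₀.mkContinuous C hb, f₀.mkContinuous_norm_le hC hb, fun u => hf₀ u⟩

variable {V H : Type*} [AddCommGroup V] [Module ℝ V] [NormedAddCommGroup H]
  [InnerProductSpace ℝ H] [CompleteSpace H] {A : V →ₗ[ℝ] H}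

/-- Riesz representation with respect to the semi-inner product `⟪A u, A v⟫` on `V`. -/
theorem exists_riesz (hA : IsClosed (range A)) (ℓ : V →ₗ[ℝ] ℝ) {C : ℝ}
    (h : ∀ u, |ℓ u| ≤ C * ‖A u‖) : ∃ w : V, ∀ u, ℓ u = inner ℝ (A w) (A u) := by
  have h' : ∀ u, |ℓ u| ≤ |C| * ‖A u‖ := fun u =>
    (h u).trans (mul_le_mul_of_nonneg_right (le_abs_self C) (norm_nonneg _))
  obtain ⟨f, -, hf⟩ := exists_functional_on_range A ℓ (abs_nonneg C) h'
  have : CompleteSpace (LinearMap.range A) :=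
    IsComplete.completeSpace_coe (s := (LinearMap.range A : Set H))
      (by rw [LinearMap.coe_range]; exact hA.isComplete)
  obtain ⟨w, hw⟩ := ((InnerProductSpace.toDual ℝ (LinearMap.range A)).symm f).2
  refine ⟨w, fun u => ?_⟩
  rw [hw, ← hf u, ← InnerProductSpace.toDual_symm_apply]
  rfl

omit [CompleteSpace H] in
theorem half_norm_sq_sub_inner_ge (x y : H) :
    -(1 / 2 * ‖x‖ ^ 2) ≤ 1 / 2 * ‖y‖ ^ 2 - inner ℝ x y := by
  have := norm_sub_sq_real x y
  nlinarith [sq_nonneg ‖x - y‖]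

/-- The minimax theorem behind the worst-case formula. Let `N` be the support function of `-B` for
a convex set `B` of bounded functionals. The Riesz representatives of `B` form a convex set, and
the point of its closure nearest to minus the representative of `ℓ` produces a `u` such that
`⟪A u, A v⟫ - ℓ v` is a limit of elements of `B` and attains the support function at `u`. Then
`u` minimizes `½ ‖A v‖² - ℓ v + N v`, and the minimum is the supremum over `b ∈ B` of the minima of
`½ ‖A v‖² - (ℓ + b) v`. -/
theorem exists_minimax (hA : IsClosed (range A)) (ℓ : V →ₗ[ℝ] ℝ) {C : ℝ}
    (hℓ : ∀ u, |ℓ u| ≤ C * ‖A u‖) (B : Set (V →ₗ[ℝ] ℝ)) (hBc : Convex ℝ B) (hBn : B.Nonempty)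
    (hB : ∀ b ∈ B, ∃ C : ℝ, ∀ u, |b u| ≤ C * ‖A u‖) (N : V → ℝ) (hN : ∀ b ∈ B, ∀ u, -b u ≤ N u)
    (hN' : ∀ u, ∀ ε : ℝ, 0 < ε → ∃ b ∈ B, N u - ε ≤ -b u) :
    ∃ u : V, (∀ v, -(inner ℝ (A u) (A v) - ℓ v) ≤ N v) ∧ inner ℝ (A u) (A u) - ℓ u = -N u ∧
      ∀ ε : ℝ, 0 < ε → ∃ b ∈ B, ∀ v,
        -(1 / 2 * ‖A u‖ ^ 2) - ε ≤ 1 / 2 * ‖A v‖ ^ 2 - (ℓ v + b v) := by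
  obtain ⟨t, ht⟩ := exists_riesz hA ℓ hℓ
  set S : Set H := {x | x ∈ range A ∧ ∃ b ∈ B, ∀ v, b v = inner ℝ x (A v)} with hS
  have hSn : S.Nonempty := by
    obtain ⟨b, hb⟩ := hBn
    obtain ⟨C', hC'⟩ := hB b hb
    obtain ⟨w, hw⟩ := exists_riesz hA b hC'
    exact ⟨A w, ⟨w, rfl⟩, b, hb, hw⟩
  have hSc : Convex ℝ S := by
    rintro _ ⟨⟨x, rfl⟩, b, hb, hbx⟩ _ ⟨⟨y, rfl⟩, b', hb', hby⟩ r s hr hs hrs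
    refine ⟨⟨r • x + s • y, by simp⟩, r • b + s • b', hBc hb hb' hr hs hrs, fun v => ?_⟩
    simp [hbx, hby, inner_add_left, real_inner_smul_left]
  have hSr : closure S ⊆ range A := closure_minimal (fun x hx => hx.1) hA
  obtain ⟨c, hc, hcmin⟩ := exists_norm_eq_iInf_of_complete_convex hSn.closure
    isClosed_closure.isComplete hSc.closure (-A t)
  have hproj := (norm_eq_iInf_iff_real_inner_le_zero hSc.closure hc).1 hcmin
  obtain ⟨w, hw⟩ := hSr hc
  have hu : A (t + w) = A t + c := by rw [map_add, hw]
  have hdiff : ∀ v, inner ℝ (A (t + w)) (A v) - ℓ v = inner ℝ c (A v) := fun v => by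
    rw [hu, inner_add_left, ht]
    ring
  have h1 : ∀ v, -(inner ℝ (A (t + w)) (A v) - ℓ v) ≤ N v := by
    intro v
    rw [hdiff]
    have hcl : IsClosed {x : H | -inner ℝ x (A v) ≤ N v} :=
      isClosed_le (by fun_prop) continuous_const
    refine closure_minimal ?_ hcl hc
    rintro x ⟨-, b, hb, hbx⟩
    change -inner ℝ x (A v) ≤ N v
    rw [← hbx]
    exact hN b hb v
  refine ⟨t + w, h1, le_antisymm ?_ ?_, fun ε hε => ?_⟩
  · rw [hdiff]
    refine le_of_forall_pos_le_add fun ε hε => ?_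
    obtain ⟨b, hb, hbε⟩ := hN' (t + w) ε hε
    obtain ⟨C', hC'⟩ := hB b hb
    obtain ⟨x, hx⟩ := exists_riesz hA b hC'
    have h2 := hproj (A x) (subset_closure ⟨⟨x, rfl⟩, b, hb, hx⟩)
    have h3 : -A t - c = -A (t + w) := by rw [hu]; abel
    rw [h3, inner_neg_left, inner_sub_right, real_inner_comm (A x), ← hx,
      real_inner_comm c] at h2
    linarith
  · linarith [h1 (t + w)]
  · have hcont : Continuous fun x : H => -(1 / 2 * ‖A t + x‖ ^ 2) := by fun_prop
    have hev := (hcont.tendsto c).eventually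
      (lt_mem_nhds (sub_lt_self (-(1 / 2 * ‖A t + c‖ ^ 2)) hε))
    obtain ⟨x, hxε, -, b, hb, hbx⟩ := (mem_closure_iff_nhds.1 hc _ hev)
    refine ⟨b, hb, fun v => ?_⟩
    have h4 := half_norm_sq_sub_inner_ge (A t + x) (A v)
    rw [inner_add_left, ← ht, ← hbx] at h4
    rw [hu]
    exact hxε.le.trans h4

end Minimax

/-! ### Duality of Lebesgue spaces -/

section Duality

variable {α : Type*} {m : MeasurableSpace α} {μ : Measure α}

/-- The duality map of `Lʳ`, up to normalization. -/
def dualityMap (r : ℝ) (f : α → ℝ) (x : α) : ℝ := f x * |f x| ^ (r - 2)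

theorem abs_mul_abs_rpow {r : ℝ} (hr : 1 < r) (t : ℝ) : |t * |t| ^ (r - 2)| = |t| ^ (r - 1) := by
  rcases eq_or_ne t 0 with rfl | ht
  · simp [Real.zero_rpow (sub_pos.2 hr).ne']
  · have h0 : 0 < |t| := abs_pos.2 ht
    rw [abs_mul, abs_of_nonneg (Real.rpow_nonneg h0.le _), ← Real.rpow_one_add' h0.le (by linarith)]
    congr 1
    ring

theorem mul_abs_rpow_mul {r : ℝ} (hr : 1 < r) (t : ℝ) : t * |t| ^ (r - 2) * t = |t| ^ r := by
  rcases eq_or_ne t 0 with rfl | ht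
  · simp [Real.zero_rpow (show r ≠ 0 by linarith)]
  · have h0 : 0 < |t| := abs_pos.2 ht
    rw [mul_right_comm, ← sq, ← sq_abs, ← Real.rpow_natCast, ← Real.rpow_add h0]
    congr 1
    push_cast
    ring

theorem aestronglyMeasurable_dualityMap {f : α → ℝ} (hf : AEStronglyMeasurable f μ) (r : ℝ) :
    AEStronglyMeasurable (dualityMap r f) μ :=
  (hf.aemeasurable.mul ((continuous_abs.measurable.comp_aemeasurable hf.aemeasurable).pow_const
    (r - 2))).aestronglyMeasurable

section

variable {p q : ℝ≥0∞} [p.HolderConjugate q] (hp : p ≠ ⊤) (hq : q ≠ ⊤)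
include hp hq

/-- The `Lᵖ` norm of the image of `f ∈ L^q` under the duality map. -/
theorem eLpNorm_dualityMap (f : α → ℝ) :
    eLpNorm (dualityMap q.toReal f) p μ = eLpNorm f q μ ^ (q.toReal - 1) := by
  have h := ENNReal.HolderConjugate.toReal_of_ne_top hp hq
  have hp0 := ENNReal.HolderConjugate.ne_zero p q
  have hq0 := ENNReal.HolderConjugate.ne_zero q p
  rw [eLpNorm_eq_lintegral_rpow_enorm_toReal hp0 hp, eLpNorm_eq_lintegral_rpow_enorm_toReal hq0 hq]
  have e : ∀ x, ‖dualityMap q.toReal f x‖ₑ ^ p.toReal = ‖f x‖ₑ ^ q.toReal := fun x => by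
    rw [← ofReal_norm, dualityMap, Real.norm_eq_abs, abs_mul_abs_rpow h.symm.lt,
      ← ENNReal.ofReal_rpow_of_nonneg (abs_nonneg _) h.symm.sub_one_pos.le, ← ENNReal.rpow_mul,
      h.symm.sub_one_mul_conj, ← Real.norm_eq_abs, ofReal_norm]
  simp_rw [e]
  rw [← ENNReal.rpow_mul]
  congr 1
  have := h.symm.pos
  have := h.pos
  have h3 := h.symm.sub_one_mul_conj
  field_simp
  linarith

theorem integral_dualityMap_mul {f : α → ℝ} (hf : MemLp f q μ) :
    ∫ x, dualityMap q.toReal f x * f x ∂μ = (eLpNorm f q μ).toReal ^ q.toReal := by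
  have h := ENNReal.HolderConjugate.toReal_of_ne_top hp hq
  have hq0 := ENNReal.HolderConjugate.ne_zero q p
  simp_rw [dualityMap, mul_abs_rpow_mul h.symm.lt]
  rw [hf.eLpNorm_eq_integral_rpow_norm hq0 hq, ENNReal.toReal_ofReal (by positivity),
    ← Real.rpow_mul (integral_nonneg fun x => by positivity), inv_mul_cancel₀ h.symm.pos.ne',
    Real.rpow_one]
  rfl

theorem memLp_dualityMap {f : α → ℝ} (hf : MemLp f q μ) : MemLp (dualityMap q.toReal f) p μ := by
  have h := ENNReal.HolderConjugate.toReal_of_ne_top hp hq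
  refine ⟨aestronglyMeasurable_dualityMap hf.1 _, ?_⟩
  rw [eLpNorm_dualityMap hp hq]
  exact ENNReal.rpow_lt_top_of_nonneg h.symm.sub_one_pos.le hf.eLpNorm_ne_top

end

/-- Hölder's inequality for the integral of a product. -/
theorem abs_integral_mul_le {p q : ℝ≥0∞} [p.HolderConjugate q] {f g : α → ℝ} (hf : MemLp f p μ)
    (hg : MemLp g q μ) :
    |∫ x, f x * g x ∂μ| ≤ (eLpNorm f p μ).toReal * (eLpNorm g q μ).toReal := by
  have h1 : eLpNorm (f • g) 1 μ ≤ eLpNorm f p μ * eLpNorm g q μ :=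
    eLpNorm_smul_le_mul_eLpNorm hg.1 hf.1
  have h2 : ‖∫ x, f x * g x ∂μ‖ₑ ≤ eLpNorm (f • g) 1 μ := by
    rw [eLpNorm_one_eq_lintegral_enorm]
    exact enorm_integral_le_lintegral_enorm _
  rw [← ENNReal.toReal_mul, ← Real.norm_eq_abs, ← toReal_enorm]
  exact ENNReal.toReal_mono (ENNReal.mul_ne_top hf.eLpNorm_ne_top hg.eLpNorm_ne_top) (h2.trans h1)

/-- The equality case of Young's inequality. -/
theorem eq_mul_abs_rpow_of_young_eq {p q : ℝ} (h : p.HolderConjugate q) {x y : ℝ}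
    (hxy : |x| ^ p / p + |y| ^ q / q ≤ x * y) : x = y * |y| ^ (q - 2) := by
  have hp := h.pos
  have hq := h.symm.pos
  have hyoung := Real.young_inequality_of_nonneg (abs_nonneg x) (abs_nonneg y) h
  have hxyle : x * y ≤ |x| * |y| := (le_abs_self _).trans (abs_mul x y).le
  have hmul : x * y = |x| * |y| := le_antisymm hxyle (hyoung.trans hxy)
  have heq : |x| * |y| = p⁻¹ * |x| ^ p + q⁻¹ * |y| ^ q := by
    rw [← div_eq_inv_mul, ← div_eq_inv_mul]
    exact le_antisymm hyoung (hxy.trans hxyle)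
  have hpow : |x| ^ p = |y| ^ q := by
    rw [← Real.geom_mean_eq_arith_mean2_weighted_iff_of_pos (h.inv_pos) (h.symm.inv_pos)
      (by positivity) (by positivity) h.inv_add_inv_eq_one, ← heq,
      Real.rpow_rpow_inv (abs_nonneg _) hp.ne', Real.rpow_rpow_inv (abs_nonneg _) hq.ne']
  have habs : |x| = |y| ^ (q - 1) := by
    rw [← Real.rpow_rpow_inv (abs_nonneg x) hp.ne', hpow, ← Real.rpow_mul (abs_nonneg _)]
    congr 1
    have := h.symm.sub_one_mul_conj
    field_simp
    linarith
  rcases eq_or_ne y 0 with rfl | hy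
  · rw [abs_zero, Real.zero_rpow h.symm.sub_one_pos.ne', abs_eq_zero] at habs
    simp [habs]
  · have hy0 : 0 < |y| := abs_pos.2 hy
    refine mul_right_cancel₀ hy ?_
    rw [mul_abs_rpow_mul h.symm.lt, hmul, habs, ← Real.rpow_add_one hy0.ne']
    congr 1
    ring

/-- The equality case of Hölder's inequality. -/
theorem ae_eq_dualityMap_of_integral_eq {p q : ℝ≥0∞} [p.HolderConjugate q] (hp : p ≠ ⊤)
    (hq : q ≠ ⊤) {δ : ℝ} (hδ : 0 < δ) {g u : α → ℝ} (hg : MemLp g p μ) (hu : MemLp u q μ)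
    (hgδ : eLpNorm g p μ ≤ ENNReal.ofReal δ) (hu0 : 0 < (eLpNorm u q μ).toReal)
    (h : ∫ x, g x * u x ∂μ = -(δ * (eLpNorm u q μ).toReal)) :
    ∀ᵐ x ∂μ, g x = -δ * u x * |u x| ^ (q.toReal - 2) *
      (eLpNorm u q μ).toReal ^ (-(q.toReal - 1)) := by
  have hc := ENNReal.HolderConjugate.toReal_of_ne_top hp hq
  have hp0 := ENNReal.HolderConjugate.ne_zero p q
  have hq0 := ENNReal.HolderConjugate.ne_zero q p
  set M := (eLpNorm u q μ).toReal with hM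
  have hpp := hc.pos
  have hqp := hc.symm.pos
  -- normalize both functions to norm at most one
  set x : α → ℝ := fun t => -g t / δ with hx
  set y : α → ℝ := fun t => u t / M with hy
  have ix : Integrable (fun t => |g t| ^ p.toReal) μ := hg.integrable_norm_rpow hp0 hp
  have iy : Integrable (fun t => |u t| ^ q.toReal) μ := hu.integrable_norm_rpow hq0 hq
  have ex : ∀ t, |x t| ^ p.toReal / p.toReal = (δ ^ p.toReal * p.toReal)⁻¹ * |g t| ^ p.toReal := by
    intro t
    rw [hx, abs_div, abs_neg, abs_of_pos hδ, Real.div_rpow (abs_nonneg _) hδ.le]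
    field_simp
  have ey : ∀ t, |y t| ^ q.toReal / q.toReal = (M ^ q.toReal * q.toReal)⁻¹ * |u t| ^ q.toReal := by
    intro t
    rw [hy, abs_div, abs_of_pos hu0, Real.div_rpow (abs_nonneg _) hu0.le]
    field_simp
  have exy : ∀ t, x t * y t = -(δ * M)⁻¹ * (g t * u t) := fun t => by
    simp only [hx, hy]
    field_simp
  have i1 : Integrable (fun t => |x t| ^ p.toReal / p.toReal + |y t| ^ q.toReal / q.toReal) μ := by
    simp_rw [ex, ey]
    exact (ix.const_mul _).add (iy.const_mul _)
  have i2 : Integrable (fun t => x t * y t) μ := by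
    simp_rw [exy]
    exact (hg.integrable_mul hu).const_mul _
  have ng : ∫ t, |g t| ^ p.toReal ∂μ ≤ δ ^ p.toReal := by
    have h1 := hg.eLpNorm_eq_integral_rpow_norm hp0 hp
    rw [h1, ENNReal.ofReal_le_ofReal_iff hδ.le] at hgδ
    have h2 := Real.rpow_le_rpow (by positivity) hgδ hpp.le
    rwa [← Real.rpow_mul (integral_nonneg fun t => by positivity), inv_mul_cancel₀ hpp.ne',
      Real.rpow_one] at h2
  have nu : ∫ t, |u t| ^ q.toReal ∂μ = M ^ q.toReal := by
    rw [hM, hu.eLpNorm_eq_integral_rpow_norm hq0 hq, ENNReal.toReal_ofReal (by positivity),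
      ← Real.rpow_mul (integral_nonneg fun t => by positivity), inv_mul_cancel₀ hqp.ne',
      Real.rpow_one]
    rfl
  have j1 : ∫ t, (|x t| ^ p.toReal / p.toReal + |y t| ^ q.toReal / q.toReal) ∂μ ≤ 1 := by
    simp_rw [ex, ey]
    rw [integral_add (ix.const_mul _) (iy.const_mul _), integral_const_mul, integral_const_mul, nu]
    calc _ ≤ (δ ^ p.toReal * p.toReal)⁻¹ * δ ^ p.toReal +
          (M ^ q.toReal * q.toReal)⁻¹ * M ^ q.toReal := by gcongr
      _ = p.toReal⁻¹ + q.toReal⁻¹ := by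
          have := Real.rpow_pos_of_pos hδ p.toReal
          have := Real.rpow_pos_of_pos hu0 q.toReal
          field_simp
      _ = 1 := hc.inv_add_inv_eq_one
  have j2 : ∫ t, x t * y t ∂μ = 1 := by
    simp_rw [exy]
    rw [integral_const_mul, h]
    field_simp
  have hnn : 0 ≤ᵐ[μ] fun t =>
      |x t| ^ p.toReal / p.toReal + |y t| ^ q.toReal / q.toReal - x t * y t := by
    filter_upwards with t
    exact sub_nonneg.2 (Real.young_inequality _ _ hc)
  have hzero : ∫ t, (|x t| ^ p.toReal / p.toReal + |y t| ^ q.toReal / q.toReal - x t * y t) ∂μ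
      = 0 := by
    refine le_antisymm ?_ (integral_nonneg_of_ae hnn)
    rw [integral_sub i1 i2, j2]
    linarith
  filter_upwards [(integral_eq_zero_iff_of_nonneg_ae hnn (i1.sub i2)).1 hzero] with t ht
  have h1 := eq_mul_abs_rpow_of_young_eq hc (x := x t) (y := y t) (sub_nonpos.1 ht.le)
  simp only [hx, hy] at h1
  rw [abs_div, abs_of_pos hu0, Real.div_rpow (abs_nonneg _) hu0.le] at h1
  have h2 : M ^ (-(q.toReal - 1)) = (M * M ^ (q.toReal - 2))⁻¹ := by
    rw [Real.rpow_neg hu0.le, ← Real.rpow_one_add' hu0.le (by linarith [hc.symm.lt])]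
    congr 2
    ring
  rw [h2]
  have := Real.rpow_pos_of_pos hu0 (q.toReal - 2)
  field_simp at h1 ⊢
  linarith

end Duality

section DualRepresentation

variable {α : Type*} {m : MeasurableSpace α} {μ : Measure α}

/-- The `L^q` norm is the supremum of the pairings with the unit ball of the conjugate space, also
at the endpoints, where the supremum need not be attained. -/
theorem exists_almost_norming [IsFiniteMeasure μ] {p q : ℝ≥0∞} [p.HolderConjugate q] {u : α → ℝ}
    (hu : MemLp u q μ) {δ ε : ℝ} (hδ : 0 < δ) (hε : 0 < ε) :
    ∃ g, MemLp g p μ ∧ eLpNorm g p μ ≤ ENNReal.ofReal δ ∧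
      ∫ x, g x * u x ∂μ ≤ -(δ * (eLpNorm u q μ).toReal) + ε := by
  have : q.HolderConjugate p := ENNReal.HolderConjugate.symm
  set M := (eLpNorm u q μ).toReal with hM
  have hM0 : 0 ≤ M := ENNReal.toReal_nonneg
  by_cases hsmall : δ * M ≤ ε
  · exact ⟨0, MemLp.zero, by simp, by simp; linarith⟩
  have hMpos : 0 < M := by
    by_contra h0
    have : M = 0 := le_antisymm (not_lt.1 h0) hM0
    rw [this, mul_zero] at hsmall
    exact hsmall hε.le
  rcases eq_or_ne p ⊤ with rfl | hp
  -- `q = 1`: the sign of `u`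
  · obtain rfl : q = 1 := (ENNReal.HolderConjugate.eq_top_iff_eq_one ⊤ q).1 rfl
    have hb : ∀ x, ‖-δ * (u x / |u x|)‖ ≤ δ := fun x => by
      rw [norm_mul, norm_neg, Real.norm_of_nonneg hδ.le, Real.norm_eq_abs, abs_div, abs_abs]
      exact mul_le_of_le_one_right hδ.le (div_self_le_one _)
    have hm : AEStronglyMeasurable (fun x => -δ * (u x / |u x|)) μ :=
      ((hu.1.aemeasurable.div (continuous_abs.measurable.comp_aemeasurable
        hu.1.aemeasurable)).const_mul _).aestronglyMeasurable
    refine ⟨fun x => -δ * (u x / |u x|), memLp_top_of_bound hm δ (Eventually.of_forall hb), ?_, ?_⟩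
    · rw [eLpNorm_exponent_top]
      refine eLpNormEssSup_le_of_ae_enorm_bound (Eventually.of_forall fun x => ?_)
      rw [← ofReal_norm]
      exact ENNReal.ofReal_le_ofReal (hb x)
    · have e : ∀ x, -δ * (u x / |u x|) * u x = -δ * ‖u x‖ := fun x => by
        rcases eq_or_ne (u x) 0 with h0 | h0
        · simp [h0]
        · have := abs_pos.2 h0
          rw [Real.norm_eq_abs]
          field_simp
          rw [sq_abs]
      simp_rw [e]
      rw [integral_const_mul, integral_norm_eq_lintegral_enorm hu.1,
        ← eLpNorm_one_eq_lintegral_enorm]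
      linarith
  rcases eq_or_ne q ⊤ with rfl | hq
  -- `q = ∞`: the normalized sign of `u` on a set where `|u|` almost attains its supremum
  · obtain rfl : p = 1 := (ENNReal.HolderConjugate.eq_top_iff_eq_one ⊤ p).1 rfl
    set c : ℝ := M - ε / δ with hc
    have hc0 : 0 < c := by
      rw [hc, sub_pos, div_lt_iff₀ hδ, mul_comm]
      exact not_le.1 hsmall
    set w : α → ℝ := hu.1.mk u with hw
    have hwm : Measurable w := hu.1.stronglyMeasurable_mk.measurable
    have huw : u =ᵐ[μ] w := hu.1.ae_eq_mk
    set A : Set α := {x | c < |w x|} with hA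
    have hAm : MeasurableSet A := measurableSet_lt measurable_const hwm.abs
    have hAμ : μ A ≠ 0 := by
      intro h0
      have hle : eLpNorm u ⊤ μ ≤ ENNReal.ofReal c := by
        rw [eLpNorm_exponent_top]
        refine eLpNormEssSup_le_of_ae_enorm_bound ?_
        filter_upwards [measure_eq_zero_iff_ae_notMem.1 h0, huw] with x hx hxw
        rw [← ofReal_norm, hxw]
        exact ENNReal.ofReal_le_ofReal (not_lt.1 hx)
      have h1 : M ≤ c := ENNReal.toReal_le_of_le_ofReal hc0.le hle
      have : 0 < ε / δ := by positivity
      linarith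
    have hAr : 0 < μ.real A := ENNReal.toReal_pos hAμ (measure_ne_top _ _)
    set g : α → ℝ := A.indicator fun x => -(δ / μ.real A) * (w x / |w x|) with hg
    have hgm : AEStronglyMeasurable g μ :=
      (((hwm.div hwm.abs).const_mul _).indicator hAm).aestronglyMeasurable
    have hgb : ∀ x, ‖g x‖ ≤ ‖A.indicator (fun _ => δ / μ.real A) x‖ := fun x => by
      by_cases hx : x ∈ A
      · simp only [hg, indicator_of_mem hx]
        rw [norm_mul, norm_neg, Real.norm_eq_abs (w x / _), abs_div, abs_abs]
        exact mul_le_of_le_one_right (norm_nonneg _) (div_self_le_one _)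
      · simp [hg, hx]
    have hgn : eLpNorm g 1 μ ≤ ENNReal.ofReal δ := by
      refine (eLpNorm_mono hgb).trans (le_of_eq ?_)
      rw [eLpNorm_indicator_const hAm one_ne_zero ENNReal.one_ne_top, ← ofReal_norm,
        Real.norm_of_nonneg (by positivity)]
      simp only [ENNReal.toReal_one, div_one, ENNReal.rpow_one]
      rw [← ofReal_measureReal, ← ENNReal.ofReal_mul (by positivity), div_mul_cancel₀ _ hAr.ne']
    refine ⟨g, ⟨hgm, hgn.trans_lt ENNReal.ofReal_lt_top⟩, hgn, ?_⟩
    have hle : ∀ᵐ x ∂μ, g x * u x ≤ A.indicator (fun _ => -(δ / μ.real A) * c) x := by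
      filter_upwards [huw] with x hxw
      by_cases hx : x ∈ A
      · simp only [hg, indicator_of_mem hx, hxw]
        have hx' : c < |w x| := hx
        have e : -(δ / μ.real A) * (w x / |w x|) * w x = -(δ / μ.real A) * |w x| := by
          have := hc0.trans hx'
          field_simp
          rw [sq_abs]
        rw [e]
        have : 0 < δ / μ.real A := by positivity
        nlinarith
      · simp [hg, hx]
    have hgL : MemLp g 1 μ := ⟨hgm, hgn.trans_lt ENNReal.ofReal_lt_top⟩
    calc _ ≤ ∫ x, A.indicator (fun _ => -(δ / μ.real A) * c) x ∂μ :=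
          integral_mono_ae (hgL.integrable_mul hu) ((integrable_const _).indicator hAm) hle
      _ = -(δ * M) + ε := by
          rw [integral_indicator_const _ hAm, hc, smul_eq_mul]
          field_simp
          ring
  -- `1 < q < ∞`: the duality map
  · have hcj := ENNReal.HolderConjugate.toReal_of_ne_top hp hq
    set k : ℝ := -δ * M ^ (-(q.toReal - 1)) with hk
    have hh := memLp_dualityMap hp hq hu
    refine ⟨k • dualityMap q.toReal u, hh.const_smul k, ?_, ?_⟩
    · rw [eLpNorm_const_smul, eLpNorm_dualityMap hp hq, ← ENNReal.ofReal_toReal hu.eLpNorm_ne_top,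
        ENNReal.ofReal_rpow_of_pos hMpos, ← ofReal_norm, ← ENNReal.ofReal_mul (norm_nonneg _)]
      refine ENNReal.ofReal_le_ofReal (le_of_eq ?_)
      have := Real.rpow_pos_of_pos hMpos (q.toReal - 1)
      rw [hk, norm_mul, norm_neg, Real.norm_of_nonneg hδ.le,
        Real.norm_of_nonneg (Real.rpow_nonneg hM0 _), Real.rpow_neg hM0, mul_assoc]
      change δ * ((M ^ (q.toReal - 1))⁻¹ * M ^ (q.toReal - 1)) = δ
      field_simp
    · simp only [Pi.smul_apply, smul_eq_mul, mul_assoc]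
      rw [integral_const_mul, integral_dualityMap_mul hp hq hu]
      change k * M ^ q.toReal ≤ _
      have e : M ^ (-(q.toReal - 1)) * M ^ q.toReal = M := by
        rw [← Real.rpow_add hMpos]
        simp
      rw [hk, mul_assoc, e]
      linarith

/-- A functional on `L^q` that is an integral on indicators is an integral. -/
theorem eq_integral_of_indicator [IsFiniteMeasure μ] {p q : ℝ≥0∞} [p.HolderConjugate q]
    [Fact (1 ≤ q)] (hq : q ≠ ⊤) (ℓ : StrongDual ℝ (Lp ℝ q μ)) {k : α → ℝ} (hk : MemLp k p μ)
    (h : ∀ (S : Set α) (hS : MeasurableSet S),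
      ∫ x in S, k x ∂μ = ℓ (indicatorConstLp q hS (measure_ne_top μ S) 1)) (v : Lp ℝ q μ) :
    ℓ v = ∫ x, k x * v x ∂μ := by
  have : Fact (1 ≤ p) := ⟨ENNReal.HolderConjugate.one_le p q⟩
  let P : StrongDual ℝ (Lp ℝ q μ) :=
    (ContinuousLinearMap.mul ℝ ℝ).lpPairing μ p q hk.toLp
  have hP : ∀ v : Lp ℝ q μ, P v = ∫ x, k x * v x ∂μ := fun v => by
    rw [show P v = _ from ContinuousLinearMap.lpPairing_eq_integral _ _ _]
    refine integral_congr_ae ?_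
    filter_upwards [hk.coeFn_toLp] with x hx
    simp [hx]
  rw [← hP]
  refine Lp.induction hq (motive := fun v => ℓ v = P v) ?_ ?_ ?_ v
  · intro c S hS hμS
    rw [Lp.simpleFunc.coe_indicatorConst]
    have e : indicatorConstLp q hS hμS.ne c =
        c • indicatorConstLp q hS (measure_ne_top μ S) (1 : ℝ) := by
      ext1
      filter_upwards [indicatorConstLp_coeFn (p := q) (hs := hS) (hμs := hμS.ne) (c := c),
        Lp.coeFn_smul c (indicatorConstLp q hS (measure_ne_top μ S) (1 : ℝ)),
        indicatorConstLp_coeFn (p := q) (hs := hS) (hμs := measure_ne_top μ S) (c := (1 : ℝ))]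
        with x h1 h2 h3
      rw [h1, h2, Pi.smul_apply, h3]
      by_cases hx : x ∈ S <;> simp [hx]
    rw [e, map_smul, map_smul, hP, ← h S hS, ← integral_indicator hS]
    congr 1
    refine integral_congr_ae ?_
    filter_upwards [indicatorConstLp_coeFn (p := q) (hs := hS) (hμs := measure_ne_top μ S)
      (c := (1 : ℝ))] with x hx
    rw [hx]
    by_cases hxS : x ∈ S <;> simp [hxS]
  · intro f g hf hg _ h1 h2
    rw [map_add, map_add, h1, h2]
  · exact isClosed_eq ℓ.continuous P.continuous

/-- The signed measure `S ↦ ℓ 1_S` of a functional on `L^q`. -/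
theorem exists_signedMeasure_of_dual [IsFiniteMeasure μ] {q : ℝ≥0∞} [Fact (1 ≤ q)] (hq : q ≠ ⊤)
    (ℓ : StrongDual ℝ (Lp ℝ q μ)) : ∃ s : SignedMeasure α, ∀ (S : Set α) (hS : MeasurableSet S),
      s S = ℓ (indicatorConstLp q hS (measure_ne_top μ S) 1) := by
  classical
  let F : Set α → ℝ := fun S => if hS : MeasurableSet S then
    ℓ (indicatorConstLp q hS (measure_ne_top μ S) 1) else 0
  have hF : ∀ (S : Set α) (hS : MeasurableSet S),
      F S = ℓ (indicatorConstLp q hS (measure_ne_top μ S) 1) := fun S hS => dif_pos hS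
  have hempty : F ∅ = 0 := by
    rw [hF ∅ MeasurableSet.empty, indicatorConstLp_empty, map_zero]
  refine ⟨⟨F, hempty, fun S hS => dif_neg hS, fun f hf hdisj => ?_⟩, hF⟩
  have hfm : ∀ T : Finset ℕ, MeasurableSet (⋃ i ∈ T, f i) := fun T =>
    T.measurableSet_biUnion fun i _ => hf i
  have hU : MeasurableSet (⋃ i, f i) := MeasurableSet.iUnion hf
  have hsum : ∀ T : Finset ℕ, ∑ i ∈ T, F (f i) = F (⋃ i ∈ T, f i) := by
    intro T
    induction T using Finset.induction_on with
    | empty => simpa using hempty.symm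
    | insert i T hi ih =>
      have hd : Disjoint (f i) (⋃ j ∈ T, f j) := by
        simp only [disjoint_iUnion_right]
        exact fun j hj => hdisj fun hij => hi (hij ▸ hj)
      rw [Finset.sum_insert hi, ih, Finset.set_biUnion_insert, hF _ (hf i), hF _ (hfm T),
        hF _ ((hf i).union (hfm T)), ← map_add,
        indicatorConstLp_disjoint_union (hf i) (hfm T) (measure_ne_top _ _) (measure_ne_top _ _) hd]
  change Tendsto (fun T : Finset ℕ => ∑ i ∈ T, F (f i)) atTop (𝓝 (F (⋃ i, f i)))
  simp_rw [hsum, hF _ (hfm _), hF _ hU]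
  refine (ℓ.continuous.tendsto _).comp (tendsto_indicatorConstLp_set hq ?_)
  have hmeas : HasSum (fun i => μ.real (f i)) (μ.real (⋃ i, f i)) := by
    have := μ.toSignedMeasure.m_iUnion hf hdisj
    simpa [Measure.toSignedMeasure_apply, hf, hU] using this
  have hdiff : Tendsto (fun T : Finset ℕ => μ.real (⋃ i, f i) - ∑ i ∈ T, μ.real (f i))
      atTop (𝓝 0) := by
    have : Tendsto (fun T : Finset ℕ => ∑ i ∈ T, μ.real (f i)) atTop (𝓝 (μ.real (⋃ i, f i))) :=
      hmeas
    simpa using this.const_sub (μ.real (⋃ i, f i))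
  have h0 := ENNReal.tendsto_ofReal hdiff
  rw [ENNReal.ofReal_zero] at h0
  refine h0.congr fun T => ?_
  have hsub : (⋃ i ∈ T, f i) ⊆ ⋃ i, f i := iUnion₂_subset_iUnion _ _
  rw [symmDiff_of_le hsub, ← measureReal_biUnion_finset (fun i _ j _ hij => hdisj hij)
    (fun i _ => hf i), ← measureReal_sdiff hsub (hfm T), ofReal_measureReal]

/-- The dual of `L^q` of a finite measure, `1 ≤ q < ∞`, is `Lᵖ` for the conjugate exponent `p`. The
representing function is the Radon-Nikodym derivative of `S ↦ ℓ 1_S`. -/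
theorem exists_memLp_of_dual [IsFiniteMeasure μ] {p q : ℝ≥0∞} [p.HolderConjugate q]
    [Fact (1 ≤ q)] (hq : q ≠ ⊤) (ℓ : StrongDual ℝ (Lp ℝ q μ)) {δ : ℝ} (hδ : ‖ℓ‖ ≤ δ) :
    ∃ g, MemLp g p μ ∧ eLpNorm g p μ ≤ ENNReal.ofReal δ ∧
      ∀ v : Lp ℝ q μ, ℓ v = ∫ x, g x * v x ∂μ := by
  have hδ0 : 0 ≤ δ := (norm_nonneg _).trans hδ
  have hqp : q.HolderConjugate p := ENNReal.HolderConjugate.symm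
  have : Fact (1 ≤ p) := ⟨ENNReal.HolderConjugate.one_le p q⟩
  obtain ⟨s, hs⟩ := exists_signedMeasure_of_dual hq ℓ
  have hac : s ≪ᵥ μ.toENNRealVectorMeasure := by
    refine VectorMeasure.AbsolutelyContinuous.mk fun S hS h0 => ?_
    rw [Measure.toENNRealVectorMeasure_apply_measurable hS] at h0
    rw [hs S hS]
    have : indicatorConstLp q hS (measure_ne_top μ S) (1 : ℝ) = 0 := by
      ext1
      filter_upwards [indicatorConstLp_coeFn (p := q) (hs := hS) (hμs := measure_ne_top μ S)
        (c := (1 : ℝ)), Lp.coeFn_zero ℝ q μ, measure_eq_zero_iff_ae_notMem.1 h0] with x h1 h2 h3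
      rw [h1, h2, indicator_of_notMem h3]
      rfl
    rw [this, map_zero]
  set g : α → ℝ := s.rnDeriv μ with hg
  have hgm : Measurable g := SignedMeasure.measurable_rnDeriv s μ
  have hgi : Integrable g μ := SignedMeasure.integrable_rnDeriv s μ
  have hgS : ∀ (S : Set α) (hS : MeasurableSet S),
      ∫ x in S, g x ∂μ = ℓ (indicatorConstLp q hS (measure_ne_top μ S) 1) := fun S hS => by
    rw [← hs S hS, ← withDensityᵥ_apply hgi hS, hg, SignedMeasure.withDensityᵥ_rnDeriv_eq s μ hac]
  suffices hbound : eLpNorm g p μ ≤ ENNReal.ofReal δ by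
    have hgL : MemLp g p μ := ⟨hgm.aestronglyMeasurable, hbound.trans_lt ENNReal.ofReal_lt_top⟩
    exact ⟨g, hgL, hbound, eq_integral_of_indicator hq ℓ hgL hgS⟩
  rcases eq_or_ne p ⊤ with rfl | hp
  · obtain rfl : q = 1 := (ENNReal.HolderConjugate.eq_top_iff_eq_one ⊤ q).1 rfl
    have hle : ∀ (S : Set α), MeasurableSet S → |∫ x in S, g x ∂μ| ≤ ∫ _ in S, δ ∂μ := by
      intro S hS
      rw [hgS S hS, setIntegral_const, smul_eq_mul, mul_comm]
      refine (ℓ.le_opNorm _).trans ?_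
      have h1 := norm_indicatorConstLp_le (p := 1) (hs := hS) (hμs := measure_ne_top μ S)
        (c := (1 : ℝ))
      simp only [norm_one, ENNReal.toReal_one, div_one, Real.rpow_one, one_mul] at h1
      gcongr
    have b1 : g ≤ᵐ[μ] fun _ => δ := ae_le_of_forall_setIntegral_le hgi (integrable_const _)
      fun S hS _ => (le_abs_self _).trans (hle S hS)
    have b2 : (fun x => -g x) ≤ᵐ[μ] fun _ => δ :=
      ae_le_of_forall_setIntegral_le hgi.neg (integrable_const _) fun S hS _ => by
        rw [integral_neg]
        exact (neg_le_abs _).trans (hle S hS)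
    rw [eLpNorm_exponent_top]
    refine eLpNormEssSup_le_of_ae_enorm_bound ?_
    filter_upwards [b1, b2] with x h1 h2
    rw [← ofReal_norm]
    exact ENNReal.ofReal_le_ofReal (abs_le'.2 ⟨h1, h2⟩)
  · have hc := ENNReal.HolderConjugate.toReal_of_ne_top hp hq
    -- the truncations `g 1_{|g| ≤ n}` are bounded, and their norms are tested by the duality map
    let A : ℕ → Set α := fun n => {x | |g x| ≤ n}
    have hA : ∀ n, MeasurableSet (A n) := fun n => measurableSet_le hgm.abs measurable_const
    have hkm : ∀ n, AEStronglyMeasurable ((A n).indicator g) μ := fun n =>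
      (hgm.indicator (hA n)).aestronglyMeasurable
    have hkL : ∀ n, MemLp ((A n).indicator g) p μ := fun n => by
      refine MemLp.of_bound (hkm n) n (Eventually.of_forall fun x => ?_)
      by_cases hx : x ∈ A n
      · rw [indicator_of_mem hx]; exact hx
      · simp [hx]
    have hkn : ∀ n, eLpNorm ((A n).indicator g) p μ ≤ ENNReal.ofReal δ := by
      intro n
      set k := (A n).indicator g with hk
      let Q : Lp ℝ q μ →L[ℝ] Lp ℝ q μ := (ContinuousLinearMap.mul ℝ ℝ).holderL μ ⊤ q q
        (indicatorConstLp ⊤ (hA n) (measure_ne_top μ _) 1)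
      have hQ : ∀ v : Lp ℝ q μ, Q v =ᵐ[μ] (A n).indicator v := fun v => by
        have h1 : Q v =ᵐ[μ] fun x =>
            (ContinuousLinearMap.mul ℝ ℝ)
              (indicatorConstLp ⊤ (hA n) (measure_ne_top μ _) 1 x) (v x) :=
          ContinuousLinearMap.coeFn_holder _ _ _
        filter_upwards [h1, indicatorConstLp_coeFn (p := ⊤) (hs := hA n)
          (hμs := measure_ne_top μ (A n)) (c := (1 : ℝ))] with x hx hx2
        rw [hx, hx2]
        by_cases hxA : x ∈ A n <;> simp [hxA]
      have hrep := eq_integral_of_indicator (p := p) hq (ℓ.comp Q) (hkL n) (fun S hS => by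
        rw [setIntegral_indicator (hA n), hgS _ (hS.inter (hA n)), ContinuousLinearMap.comp_apply]
        congr 1
        ext1
        filter_upwards [hQ (indicatorConstLp q hS (measure_ne_top μ S) 1),
          indicatorConstLp_coeFn (p := q) (hs := hS.inter (hA n))
            (hμs := measure_ne_top μ (S ∩ A n)) (c := (1 : ℝ)),
          indicatorConstLp_coeFn (p := q) (hs := hS) (hμs := measure_ne_top μ S) (c := (1 : ℝ))]
          with x h1 h2 h3
        rw [h1, h2, inter_comm]
        by_cases hxA : x ∈ A n
        · rw [indicator_of_mem hxA, h3]
          by_cases hxS : x ∈ S <;> simp [hxA, hxS]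
        · simp [hxA])
      have hh := memLp_dualityMap hq hp (hkL n)
      have h1 := hrep hh.toLp
      have h2 : ∫ x, k x * (hh.toLp : Lp ℝ q μ) x ∂μ = (eLpNorm k p μ).toReal ^ p.toReal := by
        rw [← integral_dualityMap_mul hq hp (hkL n)]
        refine integral_congr_ae ?_
        filter_upwards [hh.coeFn_toLp] with x hx
        rw [hx, mul_comm]
      have h3 : ‖Q hh.toLp‖ ≤ (eLpNorm k p μ).toReal ^ (p.toReal - 1) := by
        rw [ENNReal.toReal_rpow, ← eLpNorm_dualityMap hq hp, ← Lp.norm_toLp _ hh]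
        refine Lp.norm_le_norm_of_ae_le ?_
        filter_upwards [hQ hh.toLp] with x hx
        rw [hx]
        exact norm_indicator_le_norm_self _ _
      set a := (eLpNorm k p μ).toReal with ha
      have ha0 : 0 ≤ a := ENNReal.toReal_nonneg
      have h4 : a ^ p.toReal ≤ δ * a ^ (p.toReal - 1) := by
        rw [← h2, ← h1, ContinuousLinearMap.comp_apply]
        refine (le_abs_self _).trans ((ℓ.le_opNorm _).trans ?_)
        gcongr
      have h5 : a ≤ δ := by
        rcases ha0.eq_or_lt with h0 | h0
        · rwa [← h0]
        · have e : a ^ p.toReal = a * a ^ (p.toReal - 1) := by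
            rw [← Real.rpow_one_add' ha0 (by linarith [hc.lt])]
            congr 1
            ring
          rw [e] at h4
          exact le_of_mul_le_mul_right h4 (Real.rpow_pos_of_pos h0 _)
      rw [← ENNReal.ofReal_toReal (hkL n).eLpNorm_ne_top]
      exact ENNReal.ofReal_le_ofReal h5
    refine (Lp.eLpNorm_lim_le_liminf_eLpNorm hkm g (Eventually.of_forall fun x => ?_)).trans ?_
    · refine tendsto_const_nhds.congr' ?_
      filter_upwards [eventually_ge_atTop ⌈|g x|⌉₊] with n hn
      have hx : x ∈ A n := Nat.ceil_le.1 hn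
      rw [indicator_of_mem hx]
    · exact liminf_le_of_le (by isBoundedDefault) fun b hb => by
        obtain ⟨n, hn⟩ := hb.exists
        exact hn.trans (hkn n)

/-- A functional on `V` that is bounded by the `L^q` norm of `T v`, `q < ∞`, is the pairing of `T v`
with a function in the dual ball: combine the theorem of Hahn and Banach with the description of
the dual of `L^q`. -/
theorem exists_memLp_of_le_norm [IsFiniteMeasure μ] {p q : ℝ≥0∞} [p.HolderConjugate q]
    [Fact (1 ≤ q)] (hq : q ≠ ⊤) {V : Type*} [AddCommGroup V] [Module ℝ V] (T : V →ₗ[ℝ] Lp ℝ q μ)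
    (c : V →ₗ[ℝ] ℝ) {δ : ℝ} (hδ : 0 ≤ δ) (hc : ∀ v, |c v| ≤ δ * ‖T v‖) :
    ∃ g, MemLp g p μ ∧ eLpNorm g p μ ≤ ENNReal.ofReal δ ∧ ∀ v, c v = ∫ x, g x * T v x ∂μ := by
  obtain ⟨f, hfδ, hf⟩ := exists_functional_on_range T c hδ hc
  obtain ⟨ℓ, hℓ, hℓn⟩ := exists_extension_norm_eq _ f
  obtain ⟨g, hg, hgδ, hgv⟩ := exists_memLp_of_dual (p := p) hq ℓ (hℓn.trans_le hfδ)
  refine ⟨g, hg, hgδ, fun v => ?_⟩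
  rw [← hgv, ← hf v]
  exact (hℓ ⟨T v, v, rfl⟩).symm

end DualRepresentation

/-! ### The energies as quadratic functionals -/

section Energies

variable {d : ℕ}

local notation "𝔼" => EuclideanSpace ℝ (Fin d)

theorem eLpNorm_restrict_of_ae_eq_zero_off {α E : Type*} {m : MeasurableSpace α} {μ : Measure α}
    [NormedAddCommGroup E] {S : Set α} {f : α → E} (h : ∀ᵐ x ∂μ, x ∉ S → f x = 0) (q : ℝ≥0∞) :
    eLpNorm f q (μ.restrict S) = eLpNorm f q μ := by
  have e : S.indicator f =ᵐ[μ] f := by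
    filter_upwards [h] with x hx
    by_cases hxS : x ∈ S <;> simp [hxS, hx]
  rw [← eLpNorm_congr_ae e, ← eLpNorm_congr_ae (ae_restrict_of_ae e),
    eLpNorm_restrict_eq_of_support_subset support_indicator_subset]

/-- The Poincaré inequality on `H¹₀(Ω)` for the exponents `q` and `2`, with constant `C`. -/
def PoincareBound (Ω : Set 𝔼) (q : ℝ≥0∞) (C : ℝ≥0) : Prop :=
  ∀ u ∈ H10 Ω, eLpNorm u q volume ≤ C * eLpNorm (weakGrad u) 2 volume ∧
    eLpNorm u 2 volume ≤ C * eLpNorm (weakGrad u) 2 volume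

variable {Ω D : Set (EuclideanSpace ℝ (Fin d))} {p q : ℝ≥0∞} {C : ℝ≥0}

theorem exists_poincareBound (hd : 1 ≤ d)
    (hp : ENNReal.ofReal (2 * (d : ℝ) / ((d : ℝ) + 2)) ≤ p) (hp2 : d = 2 → 1 < p)
    (hpq : ENNReal.HolderConjugate p q) (hΩ : volume Ω < ⊤) :
    ∃ C : ℝ≥0, PoincareBound Ω q C := by
  obtain ⟨C, hC, h⟩ := exists_poincare_const hd hp hp2 hpq hΩ
  lift C to ℝ≥0 using hC
  exact ⟨C, fun u hu => h u _ (H10.hasGradL2 hu) (H10.ae_eq_zero_off hu)⟩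

theorem PoincareBound.memLp (hP : PoincareBound Ω q C) {u : 𝔼 → ℝ} (hu : u ∈ H10 Ω) :
    MemLp u q volume :=
  ⟨(H10.hasGradL2 hu).memLp.1, (hP u hu).1.trans_lt
    (ENNReal.mul_lt_top ENNReal.coe_lt_top (H10.hasGradL2 hu).memLp_grad.2)⟩

theorem PoincareBound.toReal_eLpNorm_le (hP : PoincareBound Ω q C) (u : H10Submodule Ω) :
    (eLpNorm (u : 𝔼 → ℝ) q volume).toReal ≤ C * ‖gradMap Ω u‖ := by
  have h := (hP u u.2).1
  rw [← enorm_gradMap] at h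
  have := ENNReal.toReal_mono (ENNReal.mul_ne_top ENNReal.coe_ne_top enorm_ne_top) h
  simpa using this

theorem PoincareBound.ae_eq_of_gradMap_eq (hP : PoincareBound Ω q C) {u v : H10Submodule Ω}
    (h : gradMap Ω u = gradMap Ω v) : (u : 𝔼 → ℝ) =ᵐ[volume] v := by
  have h1 := (hP _ (u - v).2).2
  rw [← enorm_gradMap, map_sub, h, sub_self, enorm_zero, mul_zero] at h1
  have h2 : ((u - v : H10Submodule Ω) : 𝔼 → ℝ) =ᵐ[volume] 0 :=
    (eLpNorm_eq_zero_iff (H10.hasGradL2 (u - v).2).memLp.1 two_ne_zero).1 (le_antisymm h1 zero_le)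
  filter_upwards [h2] with x hx
  exact sub_eq_zero.1 hx

theorem PoincareBound.isClosed_range (hP : PoincareBound Ω q C) :
    IsClosed (range (gradMap Ω)) :=
  isClosed_range_gradMap ENNReal.coe_ne_top fun u hu => (hP u hu).2

theorem PoincareBound.integrableOn_mul [p.HolderConjugate q] (hP : PoincareBound Ω q C)
    {h u : 𝔼 → ℝ} (hh : MemLp h p (volume.restrict Ω)) (hu : u ∈ H10 Ω) :
    IntegrableOn (fun x => h x * u x) Ω volume :=
  hh.integrable_mul ((hP.memLp hu).restrict Ω)

/-- The linear functional `u ↦ ∫_Ω h u` on `H¹₀(Ω)`. -/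
def pairing [p.HolderConjugate q] (hP : PoincareBound Ω q C) {h : 𝔼 → ℝ}
    (hh : MemLp h p (volume.restrict Ω)) : H10Submodule Ω →ₗ[ℝ] ℝ where
  toFun u := ∫ x in Ω, h x * (u : 𝔼 → ℝ) x
  map_add' u v := by
    rw [← integral_add (hP.integrableOn_mul hh u.2) (hP.integrableOn_mul hh v.2)]
    simp [mul_add]
  map_smul' c u := by
    rw [RingHom.id_apply, smul_eq_mul, ← integral_const_mul]
    simp [mul_left_comm]

/-- The restriction to `Ω`, as a linear map from `H¹₀(Ω)` to `L^q(Ω)`. -/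
def valueMap (hP : PoincareBound Ω q C) :
    H10Submodule Ω →ₗ[ℝ] Lp ℝ q (volume.restrict Ω) where
  toFun u := (hP.memLp u.2).restrict Ω |>.toLp
  map_add' _ _ := MemLp.toLp_add _ _
  map_smul' c _ := MemLp.toLp_const_smul c _

theorem norm_valueMap (hP : PoincareBound Ω q C) (u : H10Submodule Ω) :
    ‖valueMap hP u‖ = (eLpNorm (u : 𝔼 → ℝ) q volume).toReal := by
  rw [← eLpNorm_restrict_of_ae_eq_zero_off (H10.ae_eq_zero_off u.2)]
  exact Lp.norm_toLp _ ((hP.memLp u.2).restrict Ω)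

theorem abs_pairing_le_eLpNorm [p.HolderConjugate q] (hP : PoincareBound Ω q C) {h : 𝔼 → ℝ}
    (hh : MemLp h p (volume.restrict Ω)) (u : H10Submodule Ω) :
    |pairing hP hh u| ≤
      (eLpNorm h p (volume.restrict Ω)).toReal * (eLpNorm (u : 𝔼 → ℝ) q volume).toReal := by
  rw [← eLpNorm_restrict_of_ae_eq_zero_off (H10.ae_eq_zero_off u.2) q]
  exact abs_integral_mul_le hh ((hP.memLp u.2).restrict Ω)

theorem abs_pairing_le [p.HolderConjugate q] (hP : PoincareBound Ω q C) {h : 𝔼 → ℝ}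
    (hh : MemLp h p (volume.restrict Ω)) (u : H10Submodule Ω) :
    |pairing hP hh u| ≤ (eLpNorm h p (volume.restrict Ω)).toReal * C * ‖gradMap Ω u‖ := by
  rw [mul_assoc]
  exact (abs_pairing_le_eLpNorm hP hh u).trans (by gcongr; exact hP.toReal_eLpNorm_le u)

theorem integral_norm_weakGrad_sq (u : H10Submodule Ω) :
    ∫ x, ‖weakGrad (u : 𝔼 → ℝ) x‖ ^ 2 = ‖gradMap Ω u‖ ^ 2 := by
  rw [← real_inner_self_eq_norm_sq, L2.inner_def]
  refine integral_congr_ae ?_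
  filter_upwards [coeFn_gradMap u] with x hx
  rw [hx, real_inner_self_eq_norm_sq]

theorem ae_weakGrad_eq_zero_off {u : 𝔼 → ℝ} (hu : u ∈ H10 Ω) :
    ∀ᵐ x, x ∉ Ω → weakGrad u x = 0 :=
  (H10.hasGradL2 hu).ae_eq_zero_off (H10.ae_eq_zero_off hu)

/-- Since `u` and its gradient vanish almost everywhere outside `Ω`, the integral over any larger
set `D` equals the integral over `Ω`. -/
theorem J_eq [p.HolderConjugate q] (hP : PoincareBound Ω q C) {h : 𝔼 → ℝ}
    (hh : MemLp h p (volume.restrict Ω)) (hD : NullMeasurableSet D volume) (hΩD : Ω ⊆ D)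
    (u : H10Submodule Ω) : J D u h = 1 / 2 * ‖gradMap Ω u‖ ^ 2 - pairing hP hh u := by
  have hg := ae_weakGrad_eq_zero_off u.2
  have hi : IntegrableOn (fun x => (1 / 2 : ℝ) * ‖weakGrad (u : 𝔼 → ℝ) x‖ ^ 2) Ω volume :=
    ((H10.hasGradL2 u.2).memLp_grad.integrable_norm_pow two_ne_zero).integrableOn.const_mul _
  rw [J, setIntegral_eq_of_subset_of_ae_sdiff_eq_zero hD hΩD,
    integral_sub hi (hP.integrableOn_mul hh u.2), integral_const_mul,
    setIntegral_eq_integral_of_ae_compl_eq_zero, integral_norm_weakGrad_sq]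
  · rfl
  · filter_upwards [hg] with x hx hxΩ
    simp [hx hxΩ]
  · filter_upwards [hg, H10.ae_eq_zero_off u.2] with x hx hx' hxΩ
    simp [hx hxΩ.2, hx' hxΩ.2]

theorem penalizedCost_eq [p.HolderConjugate q] (hP : PoincareBound Ω q C) {f : 𝔼 → ℝ}
    (hf : MemLp f p (volume.restrict Ω)) (hD : NullMeasurableSet D volume) (hΩD : Ω ⊆ D) (δ : ℝ)
    (u : H10Submodule Ω) : penalizedCost D f δ q u =
      1 / 2 * ‖gradMap Ω u‖ ^ 2 - pairing hP hf u + δ * (eLpNorm (u : 𝔼 → ℝ) q volume).toReal := by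
  have h0 : ∀ᵐ x, x ∉ D → (u : 𝔼 → ℝ) x = 0 := by
    filter_upwards [H10.ae_eq_zero_off u.2] with x hx hxD using hx fun hxΩ => hxD (hΩD hxΩ)
  rw [penalizedCost, J_eq hP hf hD hΩD, eLpNorm_restrict_of_ae_eq_zero_off h0]

/-- The Dirichlet energy is attained, by the Riesz representative of `u ↦ ∫_Ω h u`. -/
theorem exists_isMinOn_J [p.HolderConjugate q] (hP : PoincareBound Ω q C)
    (hΩ : NullMeasurableSet Ω volume) {h : 𝔼 → ℝ} (hh : MemLp h p (volume.restrict Ω)) :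
    ∃ u ∈ H10 Ω, IsMinOn (fun v => J Ω v h) (H10 Ω) u := by
  obtain ⟨w, hw⟩ := exists_riesz hP.isClosed_range (pairing hP hh) (abs_pairing_le hP hh)
  refine ⟨w, w.2, fun v hv => ?_⟩
  change J Ω w h ≤ J Ω (⟨v, hv⟩ : H10Submodule Ω) h
  rw [J_eq hP hh hΩ Subset.rfl, J_eq hP hh hΩ Subset.rfl, hw, hw, real_inner_self_eq_norm_sq]
  linarith [half_norm_sq_sub_inner_ge (gradMap Ω w) (gradMap Ω (⟨v, hv⟩ : H10Submodule Ω))]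

end Energies

/-! ### The worst-case energy -/

section WorstCaseEnergy

variable {d : ℕ}

local notation "𝔼" => EuclideanSpace ℝ (Fin d)

variable {Ω D : Set (EuclideanSpace ℝ (Fin d))} {p q : ℝ≥0∞} {C : ℝ≥0} {δ : ℝ}

theorem memLp_of_mem_perturbations (hΩD : Ω ⊆ D) {g : 𝔼 → ℝ} (hg : g ∈ perturbations D δ p) :
    MemLp g p (volume.restrict Ω) :=
  hg.1.mono_measure (Measure.restrict_mono_set _ hΩD)

theorem toReal_eLpNorm_le_of_mem_perturbations (hδ : 0 ≤ δ) (hΩD : Ω ⊆ D) {g : 𝔼 → ℝ}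
    (hg : g ∈ perturbations D δ p) : (eLpNorm g p (volume.restrict Ω)).toReal ≤ δ :=
  ENNReal.toReal_le_of_le_ofReal hδ
    ((eLpNorm_mono_measure _ (Measure.restrict_mono_set _ hΩD)).trans hg.2)

theorem indicator_ae_eq_restrict_of_nullMeasurableSet (hΩ : NullMeasurableSet Ω volume)
    (g : EuclideanSpace ℝ (Fin d) → ℝ) : Ω.indicator g =ᵐ[volume.restrict Ω] g := by
  filter_upwards [ae_restrict_mem₀ hΩ] with x hx using indicator_of_mem hx g

/-- Extension by zero turns a function on `Ω` into an admissible perturbation. -/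
theorem indicator_mem_perturbations (hΩ : NullMeasurableSet Ω volume) {g : 𝔼 → ℝ}
    (hg : MemLp g p (volume.restrict Ω))
    (hgδ : eLpNorm g p (volume.restrict Ω) ≤ ENNReal.ofReal δ) :
    Ω.indicator g ∈ perturbations D δ p := by
  have e : eLpNorm (Ω.indicator g) p volume ≤ ENNReal.ofReal δ := by
    rw [← eLpNorm_restrict_of_ae_eq_zero_off (S := Ω) (by simp +contextual),
      eLpNorm_congr_ae (indicator_ae_eq_restrict_of_nullMeasurableSet hΩ g)]
    exact hgδ
  have hm : MemLp (Ω.indicator g) p volume :=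
    ⟨(aestronglyMeasurable_indicator_iff₀ hΩ).2 hg.1, e.trans_lt ENNReal.ofReal_lt_top⟩
  exact ⟨hm.restrict D, (eLpNorm_mono_measure _ Measure.restrict_le_self).trans e⟩

theorem setIntegral_indicator_mul (hΩ : NullMeasurableSet Ω volume) (g u : 𝔼 → ℝ) :
    ∫ x in Ω, Ω.indicator g x * u x = ∫ x in Ω, g x * u x := by
  refine integral_congr_ae ?_
  filter_upwards [indicator_ae_eq_restrict_of_nullMeasurableSet hΩ g] with x hx
  rw [hx]

theorem J_add [p.HolderConjugate q] (hP : PoincareBound Ω q C) {f : 𝔼 → ℝ}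
    (hf : MemLp f p (volume.restrict Ω)) (hΩ : NullMeasurableSet Ω volume) (hΩD : Ω ⊆ D)
    {g : 𝔼 → ℝ} (hg : g ∈ perturbations D δ p) (v : H10Submodule Ω) :
    J Ω v (f + g) = 1 / 2 * ‖gradMap Ω v‖ ^ 2 -
      (pairing hP hf v + ∫ x in Ω, g x * (v : 𝔼 → ℝ) x) := by
  have hgΩ := memLp_of_mem_perturbations hΩD hg
  rw [J_eq hP (hf.add hgΩ) hΩ Subset.rfl]
  congr 1
  change ∫ x in Ω, (f x + g x) * (v : 𝔼 → ℝ) x = (∫ x in Ω, f x * (v : 𝔼 → ℝ) x) + _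
  rw [← integral_add (hP.integrableOn_mul hf v.2) (hP.integrableOn_mul hgΩ v.2)]
  simp [add_mul]

/-- `u` is one half of a saddle point of `(v, g) ↦ ∫ (½ |∇v|² - (f + g) v)`; the other half is the
functional `v ↦ ∫ (∇u · ∇v - f v)`, which takes the place of the perturbation `g` since it need not
be a function if `p = 1`. It is dominated by the norm dual to the perturbations, is extremal on `u`,
and is approximated by perturbations in the sense that their energies come close to the optimal
value `-½ ‖∇u‖²`. -/
structure IsSaddle [p.HolderConjugate q] (hP : PoincareBound Ω q C) (D : Set 𝔼) {f : 𝔼 → ℝ}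
    (hf : MemLp f p (volume.restrict Ω)) (δ : ℝ) (u : H10Submodule Ω) : Prop where
  neg_le : ∀ v, -(inner ℝ (gradMap Ω u) (gradMap Ω v) - pairing hP hf v) ≤
    δ * (eLpNorm (v : 𝔼 → ℝ) q volume).toReal
  self_eq : inner ℝ (gradMap Ω u) (gradMap Ω u) - pairing hP hf u =
    -(δ * (eLpNorm (u : 𝔼 → ℝ) q volume).toReal)
  approx : ∀ ε : ℝ, 0 < ε → ∃ g ∈ perturbations D δ p, ∀ v : H10Submodule Ω,
    -(1 / 2 * ‖gradMap Ω u‖ ^ 2) - ε ≤ J Ω v (f + g)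

theorem exists_isSaddle [p.HolderConjugate q] (hP : PoincareBound Ω q C) (hδ : 0 < δ)
    (hΩ : NullMeasurableSet Ω volume) (hΩfin : volume Ω < ⊤) (hΩD : Ω ⊆ D) {f : 𝔼 → ℝ}
    (hf : MemLp f p (volume.restrict Ω)) : ∃ u, IsSaddle hP D hf δ u := by
  have : IsFiniteMeasure (volume.restrict Ω) := ⟨by rwa [Measure.restrict_apply_univ]⟩
  have hp1 : 1 ≤ p := ENNReal.HolderConjugate.one_le p q
  let B : Set (H10Submodule Ω →ₗ[ℝ] ℝ) :=
    {b | ∃ g ∈ perturbations D δ p, ∀ v, b v = ∫ x in Ω, g x * (v : 𝔼 → ℝ) x}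
  have hBc : Convex ℝ B := by
    rintro b ⟨g, hg, hb⟩ b' ⟨g', hg', hb'⟩ r s hr hs hrs
    have hm := (hg.1.const_smul r).add (hg'.1.const_smul s)
    refine ⟨r • g + s • g', ⟨hm, ?_⟩, fun v => ?_⟩
    · refine (eLpNorm_add_le (hg.1.const_smul r).1 (hg'.1.const_smul s).1 hp1).trans ?_
      rw [eLpNorm_const_smul, eLpNorm_const_smul, Real.enorm_of_nonneg hr, Real.enorm_of_nonneg hs]
      calc _ ≤ ENNReal.ofReal r * ENNReal.ofReal δ + ENNReal.ofReal s * ENNReal.ofReal δ := by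
            gcongr
            exacts [hg.2, hg'.2]
        _ = ENNReal.ofReal δ := by
            rw [← add_mul, ← ENNReal.ofReal_add hr hs, hrs, ENNReal.ofReal_one, one_mul]
    · have i1 := (hP.integrableOn_mul (memLp_of_mem_perturbations hΩD hg) v.2).const_mul r
      have i2 := (hP.integrableOn_mul (memLp_of_mem_perturbations hΩD hg') v.2).const_mul s
      simp only [LinearMap.add_apply, LinearMap.smul_apply, hb, hb', smul_eq_mul]
      rw [← integral_const_mul, ← integral_const_mul, ← integral_add i1 i2]
      simp [add_mul, mul_assoc]
  have h0 : (0 : 𝔼 → ℝ) ∈ perturbations D δ p := ⟨MemLp.zero, by simp⟩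
  have hBle : ∀ b ∈ B, ∃ C : ℝ, ∀ u, |b u| ≤ C * ‖gradMap Ω u‖ := by
    rintro b ⟨g, hg, hb⟩
    have h4 := abs_pairing_le hP (memLp_of_mem_perturbations hΩD hg)
    exact ⟨_, fun u => by rw [hb]; exact h4 u⟩
  let N : H10Submodule Ω → ℝ := fun v => δ * (eLpNorm (v : 𝔼 → ℝ) q volume).toReal
  have hN : ∀ b ∈ B, ∀ v, -b v ≤ N v := by
    rintro b ⟨g, hg, hb⟩ v
    have h4 := abs_pairing_le_eLpNorm hP (memLp_of_mem_perturbations hΩD hg) v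
    rw [hb]
    refine (neg_le_abs _).trans (h4.trans (mul_le_mul_of_nonneg_right ?_ ENNReal.toReal_nonneg))
    exact toReal_eLpNorm_le_of_mem_perturbations hδ.le hΩD hg
  have hN' : ∀ v, ∀ ε : ℝ, 0 < ε → ∃ b ∈ B, N v - ε ≤ -b v := by
    intro v ε hε
    obtain ⟨g, hg, hgδ, hgv⟩ := exists_almost_norming (p := p) ((hP.memLp v.2).restrict Ω) hδ hε
    have hmem : Ω.indicator g ∈ perturbations D δ p := indicator_mem_perturbations hΩ hg hgδ
    refine ⟨pairing hP (memLp_of_mem_perturbations hΩD hmem), ⟨_, hmem, fun _ => rfl⟩, ?_⟩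
    change δ * (eLpNorm (v : 𝔼 → ℝ) q volume).toReal - ε ≤
      -∫ x in Ω, Ω.indicator g x * (v : 𝔼 → ℝ) x
    rw [setIntegral_indicator_mul hΩ]
    rw [eLpNorm_restrict_of_ae_eq_zero_off (H10.ae_eq_zero_off v.2)] at hgv
    linarith
  obtain ⟨u, h1, h2, h3⟩ := exists_minimax hP.isClosed_range (pairing hP hf) (abs_pairing_le hP hf)
    B hBc ⟨0, 0, h0, by simp⟩ hBle N hN hN'
  refine ⟨u, h1, h2, fun ε hε => ?_⟩
  obtain ⟨b, ⟨g, hg, hb⟩, hv⟩ := h3 ε hε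
  exact ⟨g, hg, fun v => (hv v).trans_eq (by rw [J_add hP hf hΩ hΩD hg, hb])⟩

variable {f : EuclideanSpace ℝ (Fin d) → ℝ}

namespace IsSaddle

variable [p.HolderConjugate q] {hP : PoincareBound Ω q C} {hf : MemLp f p (volume.restrict Ω)}
  {u : H10Submodule Ω}

theorem penalizedCost_self (h : IsSaddle hP D hf δ u) (hD : NullMeasurableSet D volume)
    (hΩD : Ω ⊆ D) : penalizedCost D f δ q u = -(1 / 2 * ‖gradMap Ω u‖ ^ 2) := by
  have := h.self_eq
  rw [real_inner_self_eq_norm_sq] at this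
  rw [penalizedCost_eq hP hf hD hΩD]
  linarith

/-- The penalized cost grows quadratically away from the saddle point. -/
theorem penalizedCost_ge (h : IsSaddle hP D hf δ u) (hD : NullMeasurableSet D volume)
    (hΩD : Ω ⊆ D) (v : H10Submodule Ω) :
    penalizedCost D f δ q u + 1 / 2 * ‖gradMap Ω u - gradMap Ω v‖ ^ 2 ≤
      penalizedCost D f δ q v := by
  have h1 := h.neg_le v
  rw [h.penalizedCost_self hD hΩD, penalizedCost_eq hP hf hD hΩD, norm_sub_sq_real]
  linarith

theorem isMinOn (h : IsSaddle hP D hf δ u) (hD : NullMeasurableSet D volume) (hΩD : Ω ⊆ D) :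
    IsMinOn (penalizedCost D f δ q) (H10 Ω) u := fun v hv => by
  have := h.penalizedCost_ge hD hΩD ⟨v, hv⟩
  change penalizedCost D f δ q u ≤ penalizedCost D f δ q v
  linarith [sq_nonneg ‖gradMap Ω u - gradMap Ω (⟨v, hv⟩ : H10Submodule Ω)‖]

theorem ae_eq_of_isMinOn (h : IsSaddle hP D hf δ u) (hD : NullMeasurableSet D volume)
    (hΩD : Ω ⊆ D) {v : 𝔼 → ℝ} (hv : v ∈ H10 Ω) (hmin : IsMinOn (penalizedCost D f δ q) (H10 Ω) v) :
    (u : 𝔼 → ℝ) =ᵐ[volume] v := by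
  have h1 := h.penalizedCost_ge hD hΩD ⟨v, hv⟩
  have h2 : penalizedCost D f δ q v ≤ penalizedCost D f δ q u := hmin u.2
  have h3 : gradMap Ω u - gradMap Ω (⟨v, hv⟩ : H10Submodule Ω) = 0 := by
    rw [← norm_eq_zero, ← sq_eq_zero_iff]
    exact le_antisymm (by linarith) (sq_nonneg _)
  exact hP.ae_eq_of_gradMap_eq (sub_eq_zero.1 h3)

/-- The minimum of the penalized cost is the worst-case energy: the inequality `≤` tests the
Dirichlet energies with the saddle point, the inequality `≥` uses the approximating
perturbations. -/
theorem worstCaseEnergy_eq (h : IsSaddle hP D hf δ u) (hδ : 0 ≤ δ)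
    (hΩ : NullMeasurableSet Ω volume) (hD : NullMeasurableSet D volume) (hΩD : Ω ⊆ D) :
    worstCaseEnergy D Ω f δ p = ((penalizedCost D f δ q u : ℝ) : EReal) := by
  refine le_antisymm (iSup₂_le fun g hg => (iInf₂_le (u : 𝔼 → ℝ) u.2).trans ?_) ?_
  · rw [EReal.coe_le_coe_iff, J_add hP hf hΩ hΩD hg, penalizedCost_eq hP hf hD hΩD]
    have hgΩ := memLp_of_mem_perturbations hΩD hg
    have h1 : |∫ x in Ω, g x * (u : 𝔼 → ℝ) x| ≤ δ * (eLpNorm (u : 𝔼 → ℝ) q volume).toReal := by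
      refine (abs_pairing_le_eLpNorm hP hgΩ u).trans ?_
      gcongr
      exact toReal_eLpNorm_le_of_mem_perturbations hδ hΩD hg
    linarith [(abs_le.1 h1).1]
  · rw [h.penalizedCost_self hD hΩD]
    refine EReal.ge_of_forall_gt_iff_ge.1 fun z hz => ?_
    obtain ⟨g, hg, hv⟩ := h.approx (-(1 / 2 * ‖gradMap Ω u‖ ^ 2) - z)
      (sub_pos.2 (EReal.coe_lt_coe_iff.1 hz))
    refine le_trans (le_iInf₂ fun v hv' => ?_) (le_iSup₂ (f := fun g _ =>
      dirichletEnergy Ω (f + g)) g hg)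
    rw [EReal.coe_le_coe_iff]
    linarith [hv ⟨v, hv'⟩]

/-- A perturbation that represents the functional of the saddle point attains the worst case. -/
theorem attainsWorstCase (h : IsSaddle hP D hf δ u) (hδ : 0 ≤ δ)
    (hΩ : NullMeasurableSet Ω volume) (hD : NullMeasurableSet D volume) (hΩD : Ω ⊆ D) {g : 𝔼 → ℝ}
    (hg : g ∈ perturbations D δ p) (hgu : ∀ v : H10Submodule Ω, ∫ x in Ω, g x * (v : 𝔼 → ℝ) x =
      inner ℝ (gradMap Ω u) (gradMap Ω v) - pairing hP hf v) : AttainsWorstCase D Ω f δ p g := by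
  refine ⟨hg, le_antisymm (le_iSup₂_of_le g hg le_rfl) ?_⟩
  rw [h.worstCaseEnergy_eq hδ hΩ hD hΩD, h.penalizedCost_self hD hΩD]
  refine le_iInf₂ fun v hv => ?_
  rw [EReal.coe_le_coe_iff]
  refine (half_norm_sq_sub_inner_ge (gradMap Ω u)
    (gradMap Ω (⟨v, hv⟩ : H10Submodule Ω))).trans_eq ?_
  have h1 := J_add hP hf hΩ hΩD hg (⟨v, hv⟩ : H10Submodule Ω)
  have h2 := hgu ⟨v, hv⟩
  rw [h2] at h1
  rw [h1]
  ring

/-- For `q < ∞` the functional of the saddle point is represented by a perturbation, which attains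
the worst case and is extremal in Hölder's inequality. -/
theorem exists_attainsWorstCase (h : IsSaddle hP D hf δ u) (hδ : 0 ≤ δ)
    (hΩ : NullMeasurableSet Ω volume) (hΩfin : volume Ω < ⊤) (hD : NullMeasurableSet D volume)
    (hΩD : Ω ⊆ D) (hq : q ≠ ⊤) : ∃ g, AttainsWorstCase D Ω f δ p g ∧
      ∫ x in Ω, g x * (u : 𝔼 → ℝ) x = -(δ * (eLpNorm (u : 𝔼 → ℝ) q volume).toReal) := by
  have : IsFiniteMeasure (volume.restrict Ω) := ⟨by rwa [Measure.restrict_apply_univ]⟩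
  have : q.HolderConjugate p := ENNReal.HolderConjugate.symm
  have : Fact (1 ≤ q) := ⟨ENNReal.HolderConjugate.one_le q p⟩
  let c : H10Submodule Ω →ₗ[ℝ] ℝ :=
    (innerₛₗ ℝ (gradMap Ω u)).comp (gradMap Ω) - pairing hP hf
  have hcv : ∀ v, c v = inner ℝ (gradMap Ω u) (gradMap Ω v) - pairing hP hf v := fun v => rfl
  have hc : ∀ v, |c v| ≤ δ * ‖valueMap hP v‖ := fun v => by
    rw [norm_valueMap]
    refine abs_le'.2 ⟨?_, h.neg_le v⟩
    have h1 := h.neg_le (-v)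
    rw [← hcv, map_neg, neg_neg] at h1
    rwa [show ((-v : H10Submodule Ω) : 𝔼 → ℝ) = -(v : 𝔼 → ℝ) from rfl, eLpNorm_neg] at h1
  obtain ⟨g, hg, hgδ, hgv⟩ := exists_memLp_of_le_norm (p := p) hq (valueMap hP) c hδ hc
  have hgc : ∀ v : H10Submodule Ω, ∫ x in Ω, Ω.indicator g x * (v : 𝔼 → ℝ) x = c v := fun v => by
    rw [setIntegral_indicator_mul hΩ, hgv]
    refine integral_congr_ae ?_
    have h1 : valueMap hP v =ᵐ[volume.restrict Ω] (v : 𝔼 → ℝ) :=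
      MemLp.coeFn_toLp ((hP.memLp v.2).restrict Ω)
    filter_upwards [h1] with x hx
    rw [hx]
  exact ⟨Ω.indicator g, h.attainsWorstCase hδ hΩ hD hΩD (indicator_mem_perturbations hΩ hg hgδ) hgc,
    (hgc u).trans h.self_eq⟩

end IsSaddle

theorem AttainsWorstCase.congr_ae {g g' : 𝔼 → ℝ} (hΩD : Ω ⊆ D) (h : AttainsWorstCase D Ω f δ p g)
    (hg : g =ᵐ[volume.restrict D] g') : AttainsWorstCase D Ω f δ p g' := by
  refine ⟨⟨(memLp_congr_ae hg).1 h.1.1, (eLpNorm_congr_ae hg).symm.trans_le h.1.2⟩, ?_⟩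
  rw [← h.2]
  have hJ : ∀ u : 𝔼 → ℝ, J Ω u (f + g') = J Ω u (f + g) := fun u => by
    refine integral_congr_ae ?_
    filter_upwards [ae_mono (Measure.restrict_mono_set _ hΩD) hg] with x hx
    simp [hx]
  simp_rw [dirichletEnergy, hJ]

/-- The equality case of Hölder's inequality between `L^∞` and `L¹`. -/
theorem ae_eq_of_integral_eq_neg_mul_eLpNorm_one {α : Type*} {m : MeasurableSpace α}
    {μ : Measure α} {g u : α → ℝ} (hδ : 0 ≤ δ) (hg : MemLp g ⊤ μ) (hu : MemLp u 1 μ)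
    (hgδ : eLpNorm g ⊤ μ ≤ ENNReal.ofReal δ)
    (h : ∫ x, g x * u x ∂μ = -(δ * (eLpNorm u 1 μ).toReal)) :
    ∀ᵐ x ∂μ, u x ≠ 0 → g x = -δ * u x * |u x|⁻¹ := by
  have hi : Integrable (fun x => g x * u x) μ := hg.integrable_mul hu
  have hu1 : Integrable (fun x => δ * ‖u x‖) μ := (memLp_one_iff_integrable.1 hu).norm.const_mul δ
  have hle : ∀ᵐ x ∂μ, |g x| ≤ δ := by
    rw [eLpNorm_exponent_top] at hgδ
    filter_upwards [ae_le_eLpNormEssSup (f := g) (μ := μ)] with x hx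
    have := hx.trans hgδ
    rwa [← ofReal_norm, ENNReal.ofReal_le_ofReal_iff hδ] at this
  have hnn : 0 ≤ᵐ[μ] fun x => g x * u x + δ * ‖u x‖ := by
    filter_upwards [hle] with x hx
    have h1 := neg_abs_le (g x * u x)
    have h2 : |g x * u x| ≤ δ * ‖u x‖ := by
      rw [abs_mul]
      exact mul_le_mul_of_nonneg_right hx (abs_nonneg _)
    change 0 ≤ g x * u x + δ * ‖u x‖
    linarith
  have h0 : ∫ x, (g x * u x + δ * ‖u x‖) ∂μ = 0 := by
    rw [integral_add hi hu1, h, integral_const_mul, integral_norm_eq_lintegral_enorm hu.1,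
      ← eLpNorm_one_eq_lintegral_enorm]
    ring
  filter_upwards [(integral_eq_zero_iff_of_nonneg_ae hnn (hi.add hu1)).1 h0] with x hx hux
  have h1 : g x * u x + δ * |u x| = 0 := hx
  have h2 : 0 < |u x| := abs_pos.2 hux
  refine mul_right_cancel₀ hux ?_
  rw [eq_neg_of_add_eq_zero_left h1]
  field_simp
  rw [sq_abs]

end WorstCaseEnergy

end WorstCase

end

open WorstCase in
theorem proposition3p1 (d : ℕ) (hd : 1 ≤ d) (p p' : ℝ≥0∞)
    (hp : ENNReal.ofReal (2 * (d : ℝ) / ((d : ℝ) + 2)) ≤ p) (hp2 : d = 2 → 1 < p)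
    (hpp' : ENNReal.HolderConjugate p p')
    (δ : ℝ) (hδ : 0 < δ)
    (D Ω : Set (EuclideanSpace ℝ (Fin d)))
    (hD : NullMeasurableSet D volume) (hΩD : Ω ⊆ D)
    (hΩ : QuasiOpen Ω) (hΩfin : volume Ω < ⊤)
    (f : EuclideanSpace ℝ (Fin d) → ℝ) (hf : MemLp f p (volume.restrict Ω)) :
    -- the Dirichlet energies are genuine minima of well-defined integrals
    (∀ h : EuclideanSpace ℝ (Fin d) → ℝ, MemLp h p (volume.restrict Ω) →
      (∀ u ∈ H10 Ω, IntegrableOn (fun x => h x * u x) Ω volume) ∧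
      ∃ u ∈ H10 Ω, IsMinOn (fun v => J Ω v h) (H10 Ω) u) ∧
    -- the penalized cost is well defined on `H¹₀(Ω)`
    (∀ u ∈ H10 Ω, MemLp u p' (volume.restrict D) ∧
      IntegrableOn (fun x => f x * u x) D volume) ∧
    -- it has a minimizer, which is unique
    (∃ u ∈ H10 Ω, IsMinOn (penalizedCost D f δ p') (H10 Ω) u) ∧
    (∀ u ∈ H10 Ω, ∀ v ∈ H10 Ω, IsMinOn (penalizedCost D f δ p') (H10 Ω) u →
      IsMinOn (penalizedCost D f δ p') (H10 Ω) v → u =ᵐ[volume] v) ∧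
    -- the supremum is attained when `p > 1`
    (1 < p → ∃ g, AttainsWorstCase D Ω f δ p g) ∧
    -- the minimum is the worst-case energy, and the minimizer gives the worst perturbation
    ∀ u ∈ H10 Ω, IsMinOn (penalizedCost D f δ p') (H10 Ω) u →
      worstCaseEnergy D Ω f δ p = ((penalizedCost D f δ p' u : ℝ) : EReal) ∧
      (1 < p → p < ⊤ → ¬ u =ᵐ[volume] 0 →
        AttainsWorstCase D Ω f δ p (fun x =>
          -δ * u x * |u x| ^ ((2 - p.toReal) / (p.toReal - 1)) *
            (eLpNorm u p' (volume.restrict D)).toReal ^ (-(p'.toReal / p.toReal)))) ∧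
      (p = ⊤ → ∃ g, AttainsWorstCase D Ω f δ p g ∧
        ∀ᵐ x ∂(volume.restrict D), u x ≠ 0 → g x = -δ * u x * |u x|⁻¹) := by
  have hΩm := hΩ.nullMeasurableSet
  obtain ⟨C, hP⟩ := exists_poincareBound hd hp hp2 hpp' hΩfin
  obtain ⟨w, hw⟩ := exists_isSaddle hP hδ hΩm hΩfin hΩD hf
  have hp'lt : 1 < p → p' ≠ ⊤ := fun h =>
    have := hpp'.symm
    ((ENNReal.HolderConjugate.lt_top_iff_one_lt p' p).2 h).ne
  have hoff : ∀ u ∈ H10 Ω, ∀ᵐ x, x ∉ D → u x = 0 := fun u hu => by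
    filter_upwards [H10.ae_eq_zero_off hu] with x hx hxD using hx fun hxΩ => hxD (hΩD hxΩ)
  -- every minimizer is almost everywhere equal to the saddle point and inherits its extremal
  -- perturbation
  have hext : ∀ u ∈ H10 Ω, IsMinOn (penalizedCost D f δ p') (H10 Ω) u → p' ≠ ⊤ →
      ∃ g, AttainsWorstCase D Ω f δ p g ∧ ∫ x in D, g x * u x =
        -(δ * (eLpNorm u p' (volume.restrict D)).toReal) := fun u hu hmin hp' => by
    obtain ⟨g, hg, hgw⟩ := hw.exists_attainsWorstCase hδ.le hΩm hΩfin hD hΩD hp'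
    have hwu := hw.ae_eq_of_isMinOn hD hΩD hu hmin
    refine ⟨g, hg, ?_⟩
    rw [eLpNorm_restrict_of_ae_eq_zero_off (hoff u hu), ← eLpNorm_congr_ae hwu, ← hgw,
      setIntegral_eq_of_subset_of_ae_sdiff_eq_zero hD hΩD]
    · refine integral_congr_ae (ae_restrict_of_ae ?_)
      filter_upwards [hwu] with x hx
      rw [hx]
    · filter_upwards [H10.ae_eq_zero_off hu] with x hx hxΩ
      rw [hx hxΩ.2, mul_zero]
  refine ⟨fun h hh => ⟨fun u hu => hP.integrableOn_mul hh hu, exists_isMinOn_J hP hΩm hh⟩,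
    fun u hu => ⟨(hP.memLp hu).restrict D, ?_⟩, ⟨w, w.2, hw.isMinOn hD hΩD⟩,
    fun u hu v hv hu' hv' => (hw.ae_eq_of_isMinOn hD hΩD hu hu').symm.trans
      (hw.ae_eq_of_isMinOn hD hΩD hv hv'), fun hp1 => ?_, fun u hu hmin => ⟨?_, ?_, ?_⟩⟩
  · refine (hP.integrableOn_mul hf hu).of_ae_sdiff_eq_zero hD ?_
    filter_upwards [H10.ae_eq_zero_off hu] with x hx hxΩ
    rw [hx hxΩ.2, mul_zero]
  · obtain ⟨g, hg, -⟩ := hext w w.2 (hw.isMinOn hD hΩD) (hp'lt hp1)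
    exact ⟨g, hg⟩
  · rw [hw.worstCaseEnergy_eq hδ.le hΩm hD hΩD]
    exact congrArg _ (le_antisymm (hw.isMinOn hD hΩD hu) (hmin w.2))
  · intro hp1 hptop hu0
    obtain ⟨g, hg, hgu⟩ := hext u hu hmin (hp'lt hp1)
    have hpos : 0 < (eLpNorm u p' (volume.restrict D)).toReal := by
      have hm := hP.memLp hu
      rw [eLpNorm_restrict_of_ae_eq_zero_off (hoff u hu)]
      refine ENNReal.toReal_pos (fun h0 => hu0 ?_) hm.eLpNorm_ne_top
      have := hpp'.symm
      exact (eLpNorm_eq_zero_iff hm.1 (ENNReal.HolderConjugate.ne_zero p' p)).1 h0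
    have hc := ENNReal.HolderConjugate.toReal_of_ne_top hptop.ne (hp'lt hp1)
    have hq := hc.conjugate_eq
    have hr := hc.sub_one_pos
    have e1 : (2 - p.toReal) / (p.toReal - 1) = p'.toReal - 2 := by
      rw [hq]
      field_simp
      ring
    have e2 : p'.toReal / p.toReal = p'.toReal - 1 := by
      have := hc.pos
      rw [hq]
      field_simp
      ring
    rw [e1, e2]
    exact hg.congr_ae hΩD (ae_eq_dualityMap_of_integral_eq hptop.ne (hp'lt hp1) hδ hg.1.1
      ((hP.memLp hu).restrict D) hg.1.2 hpos hgu)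
  · rintro rfl
    obtain rfl : p' = 1 := (ENNReal.HolderConjugate.eq_top_iff_eq_one ⊤ p').1 rfl
    obtain ⟨g, hg, hgu⟩ := hext u hu hmin ENNReal.one_ne_top
    exact ⟨g, hg, ae_eq_of_integral_eq_neg_mul_eLpNorm_one hδ.le hg.1.1
      ((hP.memLp hu).restrict D) hg.1.2 hgu⟩
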